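/- Let $(W,S)$ be a Coxeter system with length function $\ell$, and fix a realisation over $\mathbb{R}$: a finite-dimensional real vector space $\mathfrak h$ with linearly independent families $\{\alpha_s\}_{s\in S}\subset\mathfrak h^*$ and $\{\alpha_s^\vee\}_{s\in S}\subset\mathfrak h$ such that $\langle\alpha_s,\alpha_t^\vee\rangle=-2\cos(\pi/m_{st})$ for all $s,t\in S$, with $\dim\mathfrak h$ minimal among all such data. Let $W$ act on $\mathfrak h$ by $s\cdot v=v-\langle\alpha_s,v\rangle\alpha_s^\vee$. Let $R=S(\mathfrak h^*)$ be the ring of regular functions on $\mathfrak h$, graded with $\deg\mathfrak h^*=2$, with the induced action of $W$. Regard graded $R$-bimodules as graded $R\otimes_{\mathbb R}R$-modules; morphisms are of degree $0$, and $M[j]^i=M^{i+j}$. Soergel bimodules are the objects of the smallest class of graded $R$-bimodules that contains $R$ and all $B(s)=R\otimes_{R^s}R[1]$, $s\in S$, and is closed under $\otimes_R$, finite direct sums, shifts and direct summands. For $x\in W$ put $\mathrm{Gr}_x=\{(x\lambda,\lambda)\mid\lambda\in\mathfrak h\}\subset\mathfrak h\times\mathfrak h$, and for $X\subset W$ put $\mathrm{Gr}_X=\bigcup_{x\in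 X}\mathrm{Gr}_x$. Let $R(x)$ and $R(x,y)$ be the graded bimodules of regular functions on $\mathrm{Gr}_x$ and on $\mathrm{Gr}_x\cup\mathrm{Gr}_y$. For a graded bimodule $B$ and $X\subset W$ let $\Gamma_XB\subset B$ be the subbimodule of sections supported on $\mathrm{Gr}_F$ for some finite $F\subset X$, that is, of the elements killed by a power of the vanishing ideal of such a $\mathrm{Gr}_F$. The stalk of $B$ along $\mathrm{Gr}_X$ is $B_X:=B/\Gamma_{W\setminus X}B$; write $B_{x,y}=B_{\{x,y\}}$. Let $x\in W$ and $s\in S$. (a) If $x<xs$ in the Bruhat order, then for every Soergel bimodule $B$ the bimodule $B_{x,xs}$ is isomorphic to a finite direct sum of shifts of $R(x,xs)$ and $R(x)$. (b) Let $E$ be a graded $R$-bimodule with a biflag with respect to $x,xs$: that is, there are short exact sequences of graded bimodules $C\hookrightarrow E\twoheadrightarrow D$ and $D'\hookrightarrow E\twoheadrightarrow C'$ such that $C$ and $C'$ are isomorphic to finite direct sums of shifts of $R(x)$, and $D$ and $D'$ to finite direct sums of shifts of $R(xs)$. Then $E$ is isomorphic to a finite direct sum of shifts of $R(x)$, $R(xs)$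 and $R(x,xs)$. -/

import Mathlib

open scoped TensorProduct DirectSum

noncomputable section

namespace Soergel

universe u

section Coxeter

variable {S : Type*} (M : CoxeterMatrix S)

/-- Simple roots and simple coroots of a Coxeter matrix `M` in a real vector space `V`: linearly
independent families `α_s ∈ V*` and `α_s^∨ ∈ V` with `⟨α_s, α_t^∨⟩ = -2 cos(π / m_st)`. Mathlib
encodes `m_st = ∞` as `M s t = 0`, and then the right hand side is `-2 cos 0 = -2`, as it should. -/
structure PreRealisation (V : Type*) [AddCommGroup V] [Module ℝ V] where
  root : S → Module.Dual ℝ V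
  coroot : S → V
  linearIndependent_root : LinearIndependent ℝ root
  linearIndependent_coroot : LinearIndependent ℝ coroot
  pairing : ∀ s t : S, root s (coroot t) = -2 * Real.cos (Real.pi / (M s t : ℝ))

/-- A realisation whose underlying space has the smallest possible dimension. -/
structure Realisation (V : Type*) [AddCommGroup V] [Module ℝ V] extends PreRealisation M V where
  minimal : ∀ n : ℕ, Nonempty (PreRealisation M (Fin n → ℝ)) → Module.finrank ℝ V ≤ n

variable {M}
variable {V : Type*} [AddCommGroup V] [Module ℝ V]

theorem PreRealisation.root_coroot_self (𝔥 : PreRealisation M V) (s : S) :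
    𝔥.root s (𝔥.coroot s) = 2 := by
  rw [𝔥.pairing, M.diagonal]; simp

/-- The simple reflection `v ↦ v - ⟨α_s, v⟩ α_s^∨` of `V`. -/
def PreRealisation.simpleReflection (𝔥 : PreRealisation M V) (s : S) : V ≃ₗ[ℝ] V :=
  Module.reflection (𝔥.root_coroot_self s)

theorem PreRealisation.isLiftable (𝔥 : PreRealisation M V) :
    M.IsLiftable 𝔥.simpleReflection := by
  intro i j
  by_cases hij : i = j
  · subst hij
    rw [M.diagonal, pow_one]
    ext v
    simp only [PreRealisation.simpleReflection, LinearEquiv.mul_apply, Module.reflection_apply,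
      map_sub, map_smul, 𝔥.root_coroot_self, LinearEquiv.coe_one, id]
    module
  have h1 : M i j ≠ 1 := M.off_diagonal i j hij
  have hji : M j i = M i j := M.symmetric j i
  have hp1 := 𝔥.pairing i j
  have hp2 := 𝔥.pairing j i
  rw [hji] at hp2
  rcases Nat.eq_zero_or_pos (M i j) with h0 | h0
  · rw [h0, pow_zero]
  rcases (show M i j = 2 ∨ 3 ≤ M i j by omega) with h2 | h3
  · rw [h2] at hp1 hp2 ⊢
    have hc : Real.cos (Real.pi / ((2 : ℕ) : ℝ)) = 0 := by
      rw [Nat.cast_ofNat, Real.cos_pi_div_two]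
    rw [hc, mul_zero] at hp1 hp2
    ext v
    simp only [PreRealisation.simpleReflection, pow_two, LinearEquiv.mul_apply,
      Module.reflection_apply, map_sub, map_smul, hp1, hp2, 𝔥.root_coroot_self,
      LinearEquiv.coe_one, id]
    module
  · apply LinearEquiv.toLinearMap_injective
    set m := M i j with hm
    set θ : ℝ := 2 * Real.pi / m with hθ
    have hmpos : (0 : ℝ) < m := by exact_mod_cast h0
    have ht : 2 * Real.cos θ = 𝔥.root i (𝔥.coroot j) * 𝔥.root j (𝔥.coroot i) - 2 := by
      have : θ = 2 * (Real.pi / m) := by rw [hθ]; ring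
      rw [hp1, hp2, this, Real.cos_two_mul]; ring
    have hsin : Real.sin θ ≠ 0 := by
      apply ne_of_gt
      apply Real.sin_pos_of_pos_of_lt_pi
      · positivity
      · rw [hθ, div_lt_iff₀ hmpos]
        have : (3 : ℝ) ≤ m := by exact_mod_cast h3
        nlinarith [Real.pi_pos]
    have hS := Polynomial.Chebyshev.S_two_mul_real_cos θ
    rw [PreRealisation.simpleReflection, PreRealisation.simpleReflection,
      Module.reflection_mul_reflection_pow _ _ m (2 * Real.cos θ) ht]
    have hmθ : (m : ℝ) * θ = 2 * Real.pi := by rw [hθ]; field_simp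
    rcases Nat.even_or_odd' m with ⟨k, hk | hk⟩
    · have e1 : ((m : ℤ) - 2) / 2 = k - 1 := by omega
      have e2 : ((m : ℤ) - 1) / 2 = k - 1 := by omega
      have hz : (Polynomial.Chebyshev.S ℝ ((k : ℤ) - 1)).eval (2 * Real.cos θ) = 0 := by
        have := hS ((k : ℤ) - 1)
        push_cast at this
        rw [sub_add_cancel, show (k : ℝ) * θ = Real.pi by
          rw [hk] at hmθ; push_cast at hmθ; linarith, Real.sin_pi] at this
        exact (mul_eq_zero.mp this).resolve_right hsin
      rw [e1, e2, hz]
      simp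
    · have e1 : ((m : ℤ) - 2) / 2 = k - 1 := by omega
      have e2 : ((m : ℤ) - 1) / 2 = k := by omega
      have e3 : ((m : ℤ) - 3) / 2 = k - 1 := by omega
      have e4 : (m : ℤ) / 2 = k := by omega
      have hz : (Polynomial.Chebyshev.S ℝ (k : ℤ)).eval (2 * Real.cos θ) +
          (Polynomial.Chebyshev.S ℝ ((k : ℤ) - 1)).eval (2 * Real.cos θ) = 0 := by
        have a := hS ((k : ℤ) - 1)
        have b := hS (k : ℤ)
        push_cast at a b
        rw [sub_add_cancel] at a
        have c : ((k : ℝ) + 1) * θ = 2 * Real.pi - k * θ := by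
          rw [hk] at hmθ; push_cast at hmθ; linarith
        rw [c, Real.sin_two_pi_sub] at b
        have : ((Polynomial.Chebyshev.S ℝ (k : ℤ)).eval (2 * Real.cos θ) +
          (Polynomial.Chebyshev.S ℝ ((k : ℤ) - 1)).eval (2 * Real.cos θ)) * Real.sin θ = 0 := by
          rw [add_mul, a, b]; ring
        exact (mul_eq_zero.mp this).resolve_right hsin
      rw [e1, e2, e3, e4, hz]
      simp

variable {W : Type*} [Group W] (cs : CoxeterSystem M W)

/-- The reflection representation of `W` on `V`. -/
def PreRealisation.rep (𝔥 : PreRealisation M V) : W →* (V ≃ₗ[ℝ] V) :=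
  cs.lift ⟨𝔥.simpleReflection, 𝔥.isLiftable⟩

/-- The strict Bruhat order: generated by `u < u t` for `t` a reflection with `ℓ(u) < ℓ(u t)`. -/
def BruhatLT : W → W → Prop :=
  Relation.TransGen fun u v => (∃ t : W, cs.IsReflection t ∧ v = u * t) ∧ cs.length u < cs.length v

end Coxeter

section GradedAlgebra

variable {A : Type*} [CommRing A] [Algebra ℝ A]

/-- Criterion for a commutative algebra to be graded by the powers of a generating subspace. -/
@[reducible] def gradedAlgebraOfGenerators (L : Submodule ℝ A) (hL : Algebra.adjoin ℝ (L : Set A) = ⊤)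
    (f : A →ₐ[ℝ] ⨁ n : ℕ, ↥(L ^ n))
    (hf : ∀ l (hl : l ∈ L), f l =
      DirectSum.of (fun n : ℕ => ↥(L ^ n)) 1 ⟨l, by rwa [pow_one]⟩) :
    GradedAlgebra fun n : ℕ => L ^ n :=
  GradedAlgebra.ofAlgHom _ f
    (by
      refine AlgHom.ext_of_adjoin_eq_top hL fun l hl => ?_
      rw [AlgHom.comp_apply, hf l hl, DirectSum.coeAlgHom_of, AlgHom.id_apply])
    fun i x => by
      obtain ⟨x, hx⟩ := x
      dsimp only [Subtype.coe_mk]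
      induction hx using Submodule.pow_induction_on_left' with
      | algebraMap r =>
        rw [AlgHom.commutes, DirectSum.algebraMap_apply]; rfl
      | add x y i hx hy ihx ihy =>
        rw [map_add, ihx, ihy, ← map_add]
        rfl
      | mem_mul m hm i x hx ih =>
        rw [map_mul, ih, hf m hm, DirectSum.of_mul_of]
        exact DirectSum.of_eq_of_gradedMonoid_eq (Sigma.subtype_ext (add_comm _ _) rfl)

end GradedAlgebra

section Polynomials

variable (V : Type u) [AddCommGroup V] [Module ℝ V]

/-- `R = S(V*)`, the regular functions on `V`. -/
abbrev R : Type u := SymmetricAlgebra ℝ (Module.Dual ℝ V)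

/-- `R ⊗ R`, the regular functions on `V × V`. An `R`-bimodule on which both actions of `ℝ` agree
is the same thing as an `R ⊗ R`-module: `f ⊗ 1` acts by `f` from the left, `1 ⊗ g` acts by `g` from
the right. -/
def RR : Type u := R V ⊗[ℝ] R V

instance : CommRing (RR V) := inferInstanceAs (CommRing (R V ⊗[ℝ] R V))

instance : Algebra ℝ (RR V) := inferInstanceAs (Algebra ℝ (R V ⊗[ℝ] R V))

/-- The linear forms on `V`, as a subspace of `R`. -/
def lin : Submodule ℝ (R V) := LinearMap.range (SymmetricAlgebra.ι ℝ (Module.Dual ℝ V))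

/-- The left embedding `f ↦ f ⊗ 1`. -/
def inl : R V →ₐ[ℝ] RR V :=
  (Algebra.TensorProduct.includeLeft : R V →ₐ[ℝ] R V ⊗[ℝ] R V)

/-- The right embedding `g ↦ 1 ⊗ g`. -/
def inr : R V →ₐ[ℝ] RR V :=
  (Algebra.TensorProduct.includeRight : R V →ₐ[ℝ] R V ⊗[ℝ] R V)

/-- The linear forms on `V × V`, as a subspace of `R ⊗ R`. -/
def lin₂ : Submodule ℝ (RR V) := (lin V).map (inl V).toLinearMap ⊔ (lin V).map (inr V).toLinearMap

theorem adjoin_lin : Algebra.adjoin ℝ (lin V : Set (R V)) = ⊤ := by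
  rw [eq_top_iff]
  intro a _
  induction a using SymmetricAlgebra.induction with
  | algebraMap r => exact Subalgebra.algebraMap_mem _ r
  | ι x => exact Algebra.subset_adjoin (LinearMap.mem_range_self _ x)
  | mul a b ha hb => exact Subalgebra.mul_mem _ (ha trivial) (hb trivial)
  | add a b ha hb => exact Subalgebra.add_mem _ (ha trivial) (hb trivial)

theorem inl_lin_le : (lin V).map (inl V).toLinearMap ≤ lin₂ V := le_sup_left

theorem inr_lin_le : (lin V).map (inr V).toLinearMap ≤ lin₂ V := le_sup_right

theorem RR_induction {P : RR V → Prop} (h0 : P 0) (hadd : ∀ a b, P a → P b → P (a + b))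
    (hmul : ∀ f g, P (inl V f * inr V g)) (t : RR V) : P t := by
  refine TensorProduct.induction_on (motive := P) t h0 (fun f g => ?_) hadd
  have : inl V f * inr V g = (f ⊗ₜ[ℝ] g : R V ⊗[ℝ] R V) := by
    refine (Algebra.TensorProduct.tmul_mul_tmul f 1 1 g).trans ?_
    rw [mul_one, one_mul]
  exact this ▸ hmul f g

/-- The algebra homomorphism `f ⊗ g ↦ φ(f) ψ(g)` from `R ⊗ R` to a commutative algebra. -/
def RRlift {A : Type*} [CommSemiring A] [Algebra ℝ A] (φ ψ : R V →ₐ[ℝ] A) : RR V →ₐ[ℝ] A :=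
  (Algebra.TensorProduct.productMap φ ψ : R V ⊗[ℝ] R V →ₐ[ℝ] A)

theorem RRlift_inl {A : Type*} [CommSemiring A] [Algebra ℝ A] (φ ψ : R V →ₐ[ℝ] A) (f : R V) :
    RRlift V φ ψ (inl V f) = φ f :=
  Algebra.TensorProduct.productMap_left_apply φ ψ f

theorem RRlift_inr {A : Type*} [CommSemiring A] [Algebra ℝ A] (φ ψ : R V →ₐ[ℝ] A) (g : R V) :
    RRlift V φ ψ (inr V g) = ψ g :=
  Algebra.TensorProduct.productMap_right_apply φ ψ g

theorem map_adjoin_lin_le {A : Type*} [CommRing A] [Algebra ℝ A] (φ : R V →ₐ[ℝ] A)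
    (C : Subalgebra ℝ A) (h : ∀ l ∈ lin V, φ l ∈ C) (f : R V) : φ f ∈ C := by
  have : (⊤ : Subalgebra ℝ (R V)) ≤ C.comap φ := by
    rw [← adjoin_lin V, Algebra.adjoin_le_iff]
    exact h
  exact this trivial

theorem adjoin_lin₂ : Algebra.adjoin ℝ (lin₂ V : Set (RR V)) = ⊤ := by
  rw [eq_top_iff]
  intro a _
  induction a using RR_induction V with
  | h0 => exact Subalgebra.zero_mem _
  | hadd a b ha hb => exact Subalgebra.add_mem _ (ha trivial) (hb trivial)
  | hmul f g =>
    refine Subalgebra.mul_mem _ ?_ ?_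
    · exact map_adjoin_lin_le V _ _ (fun l hl =>
        Algebra.subset_adjoin (inl_lin_le V (Submodule.mem_map_of_mem hl))) f
    · exact map_adjoin_lin_le V _ _ (fun l hl =>
        Algebra.subset_adjoin (inr_lin_le V (Submodule.mem_map_of_mem hl))) g

/-- `R` is graded by polynomial degree: `lin V ^ n` is its component of polynomial degree `n`.
In the convention `deg V* = 2` this is the component of degree `2n`. -/
instance gradedR : GradedAlgebra fun n : ℕ => lin V ^ n := by
  refine gradedAlgebraOfGenerators (lin V) (adjoin_lin V)
    (SymmetricAlgebra.lift
      (DirectSum.lof ℝ ℕ (fun n => ↥(lin V ^ n)) 1 ∘ₗ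
        (SymmetricAlgebra.ι ℝ (Module.Dual ℝ V)).codRestrict _ fun m => by
          rw [pow_one]; exact LinearMap.mem_range_self _ m)) ?_
  rintro _ ⟨x, rfl⟩
  rw [SymmetricAlgebra.lift_ι_apply]
  rfl

/-- Auxiliary map used to grade `R ⊗ R`. -/
def toGradedRR (φ : R V →ₐ[ℝ] RR V) (hφ : (lin V).map φ.toLinearMap ≤ lin₂ V) :
    R V →ₐ[ℝ] ⨁ n : ℕ, ↥(lin₂ V ^ n) :=
  SymmetricAlgebra.lift
    (DirectSum.lof ℝ ℕ (fun n => ↥(lin₂ V ^ n)) 1 ∘ₗ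
      (φ.toLinearMap ∘ₗ SymmetricAlgebra.ι ℝ (Module.Dual ℝ V)).codRestrict (lin₂ V ^ 1) fun m => by
        rw [pow_one]
        exact hφ (Submodule.mem_map_of_mem (LinearMap.mem_range_self _ m)))

/-- `R ⊗ R` is graded by polynomial degree; again the component `lin₂ V ^ n` has degree `2n` in the
convention `deg V* = 2`. -/
instance gradedRR : GradedAlgebra fun n : ℕ => lin₂ V ^ n := by
  refine gradedAlgebraOfGenerators (lin₂ V) (adjoin_lin₂ V)
    (RRlift V (toGradedRR V (inl V) (inl_lin_le V)) (toGradedRR V (inr V) (inr_lin_le V))) ?_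
  intro l hl
  obtain ⟨_, ⟨_, ⟨x, rfl⟩, rfl⟩, _, ⟨_, ⟨y, rfl⟩, rfl⟩, rfl⟩ := Submodule.mem_sup.mp hl
  rw [map_add]
  simp only [AlgHom.toLinearMap_apply, RRlift_inl, RRlift_inr, toGradedRR,
    SymmetricAlgebra.lift_ι_apply, LinearMap.comp_apply, DirectSum.lof_eq_of]
  rw [← map_add]
  rfl

end Polynomials

section Internal

variable {X : Type*} [AddCommGroup X] [Module ℝ X] {d : ℤ → Submodule ℝ X}

theorem isInternal_of_proj (p : ℤ → X →+ X) (hmem : ∀ i x, p i x ∈ d i)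
    (hself : ∀ i, ∀ x ∈ d i, p i x = x) (hne : ∀ i j, i ≠ j → ∀ x ∈ d i, p j x = 0)
    (hsum : ∀ x, ∃ s : Finset ℤ, ∀ t, s ⊆ t → ∑ i ∈ t, p i x = x) : DirectSum.IsInternal d := by
  classical
  constructor
  · rw [injective_iff_map_eq_zero]
    intro a ha
    have key : ∀ (a : ⨁ i, d i) (j : ℤ), p j (DirectSum.coeAddMonoidHom d a) = (a j : X) := by
      intro a j
      induction a using DirectSum.induction_on with
      | zero => simp
      | add a b ha hb => rw [map_add, map_add, ha, hb, DirectSum.add_apply]; rfl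
      | of i x =>
        rw [DirectSum.coeAddMonoidHom_of]
        by_cases h : i = j
        · subst h
          rw [hself _ _ x.2, DirectSum.of_eq_same]
        · rw [hne i j h _ x.2, DirectSum.of_eq_of_ne _ _ _ (Ne.symm h)]; rfl
    refine DFinsupp.ext fun j => Subtype.ext ?_
    have := key a j
    rw [ha, map_zero] at this
    exact this.symm
  · intro x
    obtain ⟨s, hs⟩ := hsum x
    refine ⟨∑ i ∈ s, DirectSum.of (fun i => d i) i ⟨p i x, hmem i x⟩, ?_⟩
    rw [map_sum]
    simp only [DirectSum.coeAddMonoidHom_of]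
    exact hs s subset_rfl

/-- The decomposition of a graded space into its components. -/
def equivOf (h : DirectSum.IsInternal d) : (⨁ i, d i) ≃ₗ[ℝ] X :=
  LinearEquiv.ofBijective (DirectSum.coeLinearMap d) (by exact h)

/-- The projection to the component of degree `i`. -/
def projOf (h : DirectSum.IsInternal d) (i : ℤ) : X →ₗ[ℝ] X :=
  (d i).subtype ∘ₗ DirectSum.component ℝ ℤ (fun i => d i) i ∘ₗ (equivOf h).symm.toLinearMap

theorem projOf_mem (h : DirectSum.IsInternal d) (i : ℤ) (x : X) : projOf h i x ∈ d i := Submodule.coe_mem _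

theorem equivOf_symm_of_mem (h : DirectSum.IsInternal d) {i : ℤ} {x : X} (hx : x ∈ d i) :
    (equivOf h).symm x = DirectSum.of (fun i => d i) i ⟨x, hx⟩ := by
  rw [LinearEquiv.symm_apply_eq]
  exact (DirectSum.coeLinearMap_of d i ⟨x, hx⟩).symm

theorem projOf_same (h : DirectSum.IsInternal d) {i : ℤ} {x : X} (hx : x ∈ d i) : projOf h i x = x := by
  have : projOf h i x = ((equivOf h).symm x i : X) := rfl
  rw [this, equivOf_symm_of_mem h hx, DirectSum.of_eq_same]

theorem projOf_ne (h : DirectSum.IsInternal d) {i j : ℤ} (hij : i ≠ j) {x : X} (hx : x ∈ d i) : projOf h j x = 0 := by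
  have : projOf h j x = ((equivOf h).symm x j : X) := rfl
  rw [this, equivOf_symm_of_mem h hx, DirectSum.of_eq_of_ne _ _ _ (Ne.symm hij)]
  rfl

theorem internal_induction (h : DirectSum.IsInternal d) {P : X → Prop} (h0 : P 0) (hadd : ∀ x y, P x → P y → P (x + y))
    (hom : ∀ i, ∀ x ∈ d i, P x) (x : X) : P x := by
  obtain ⟨a, rfl⟩ := h.surjective x
  induction a using DirectSum.induction_on with
  | zero => rw [map_zero]; exact h0
  | add a b ha hb => rw [map_add]; exact hadd _ _ ha hb
  | of i y => rw [DirectSum.coeAddMonoidHom_of]; exact hom i _ y.2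

theorem projOf_sum (h : DirectSum.IsInternal d) (x : X) : ∃ s : Finset ℤ, ∀ t, s ⊆ t → ∑ i ∈ t, projOf h i x = x := by
  classical
  induction x using internal_induction h with
  | h0 => exact ⟨∅, fun t _ => by simp⟩
  | hadd x y hx hy =>
    obtain ⟨s, hs⟩ := hx
    obtain ⟨s', hs'⟩ := hy
    refine ⟨s ∪ s', fun t ht => ?_⟩
    simp only [map_add]
    rw [Finset.sum_add_distrib, hs t (Finset.union_subset_left ht),
      hs' t (Finset.union_subset_right ht)]
  | hom i x hx =>
    refine ⟨{i}, fun t ht => ?_⟩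
    rw [Finset.sum_eq_single_of_mem i (ht (Finset.mem_singleton_self i))
      fun j _ hj => projOf_ne h (Ne.symm hj) hx, projOf_same h hx]

end Internal


section Bimodules

variable (V : Type u) [AddCommGroup V] [Module ℝ V]

/-- Graded `R`-bimodules, presented as `ℤ`-graded modules over `R ⊗ R`, where `V*` has degree `2`. -/
structure GBimod where
  carrier : Type u
  [addCommGroup : AddCommGroup carrier]
  [moduleReal : Module ℝ carrier]
  [module : Module (RR V) carrier]
  [isScalarTower : IsScalarTower ℝ (RR V) carrier]
  /-- The homogeneous component of each degree. -/
  deg : ℤ → Submodule ℝ carrier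
  isInternal : DirectSum.IsInternal deg
  smul_mem : ∀ (n : ℕ) (i : ℤ) (t : RR V) (m : carrier),
    t ∈ lin₂ V ^ n → m ∈ deg i → t • m ∈ deg (i + 2 * n)

namespace GBimod

instance : CoeSort (GBimod V) (Type u) := ⟨GBimod.carrier⟩

attribute [instance] GBimod.addCommGroup GBimod.moduleReal GBimod.module GBimod.isScalarTower

variable {V}

/-- Morphisms of graded bimodules: bimodule maps of degree zero. -/
structure Hom (M N : GBimod V) where
  toLin : M →ₗ[RR V] N
  map_deg : ∀ i, ∀ m ∈ M.deg i, toLin m ∈ N.deg i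

/-- Isomorphisms of graded bimodules. -/
structure Iso (M N : GBimod V) where
  toEquiv : M ≃ₗ[RR V] N
  map_deg : ∀ i m, toEquiv m ∈ N.deg i ↔ m ∈ M.deg i

/-- The shifted bimodule `M[j]`, with `M[j]^i = M^(i+j)`. -/
def shift (M : GBimod V) (j : ℤ) : GBimod V where
  carrier := M
  deg i := M.deg (i + j)
  isInternal := by
    refine isInternal_of_proj (fun i => (projOf M.isInternal (i + j)).toAddMonoidHom)
      (fun i x => projOf_mem _ _ _) (fun i x hx => projOf_same _ hx)
      (fun i i' h x hx => projOf_ne _ (fun h' => h (by omega)) hx) fun x => ?_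
    obtain ⟨s, hs⟩ := projOf_sum M.isInternal x
    refine ⟨s.map (Equiv.subRight j).toEmbedding, fun t ht => ?_⟩
    refine Eq.trans ?_ (hs (t.map (Equiv.addRight j).toEmbedding) ?_)
    · rw [Finset.sum_map]; rfl
    · intro i hi
      rw [Finset.mem_map]
      refine ⟨i - j, ht ?_, by simp⟩
      rw [Finset.mem_map]
      exact ⟨i, hi, rfl⟩
  smul_mem n i t m ht hm := by
    rw [show i + 2 * (n : ℤ) + j = (i + j) + 2 * n by ring]
    exact M.smul_mem n _ t m ht hm

/-- Finite direct sums. -/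
def dsum {n : ℕ} (M : Fin n → GBimod V) : GBimod V where
  carrier := ∀ k, M k
  deg i := Submodule.pi Set.univ fun k => (M k).deg i
  isInternal := by
    refine isInternal_of_proj
      (fun i => (LinearMap.pi fun k =>
        projOf (M k).isInternal i ∘ₗ LinearMap.proj k : (∀ k, M k) →ₗ[ℝ] ∀ k, M k).toAddMonoidHom)
      (fun i x k _ => projOf_mem _ _ _)
      (fun i x hx => funext fun k => projOf_same _ (hx k trivial))
      (fun i j h x hx => funext fun k => projOf_ne _ h (hx k trivial)) fun x => ?_
    choose s hs using fun k => projOf_sum (M k).isInternal (x k)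
    refine ⟨Finset.univ.biUnion s, fun t ht => funext fun k => ?_⟩
    rw [Finset.sum_apply]
    exact hs k t ((Finset.subset_biUnion_of_mem s (Finset.mem_univ k)).trans ht)
  smul_mem n i t m ht hm := fun k _ => (M k).smul_mem n i t (m k) ht (hm k trivial)

/-- An `R ⊗ R`-submodule is homogeneous if it contains the homogeneous components of its elements. -/
def IsHomogeneous (M : GBimod V) (N : Submodule (RR V) M) : Prop :=
  ∀ i, ∀ m ∈ N, projOf M.isInternal i m ∈ N

/-- The quotient of a graded bimodule by a homogeneous subbimodule. -/
def quot (M : GBimod V) (N : Submodule (RR V) M) (hN : M.IsHomogeneous N) : GBimod V where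
  carrier := M ⧸ N
  deg i := (M.deg i).map (N.mkQ.restrictScalars ℝ)
  isInternal := by
    refine isInternal_of_proj (fun i => QuotientAddGroup.map N.toAddSubgroup N.toAddSubgroup
      (projOf M.isInternal i).toAddMonoidHom fun m hm => hN i m hm) ?_ ?_ ?_ ?_
    · intro i x
      obtain ⟨m, rfl⟩ := N.mkQ_surjective x
      exact ⟨_, projOf_mem M.isInternal i m, rfl⟩
    · rintro i _ ⟨m, hm, rfl⟩
      exact congrArg N.mkQ (projOf_same M.isInternal hm)
    · rintro i j h _ ⟨m, hm, rfl⟩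
      exact (congrArg N.mkQ (projOf_ne M.isInternal h hm)).trans (map_zero _)
    · intro x
      obtain ⟨m, rfl⟩ := N.mkQ_surjective x
      obtain ⟨s, hs⟩ := projOf_sum M.isInternal m
      refine ⟨s, fun t ht => ?_⟩
      have := congrArg N.mkQ (hs t ht)
      rw [map_sum] at this
      exact this
  smul_mem n i t x ht hx := by
    obtain ⟨m, hm, rfl⟩ := hx
    exact ⟨t • m, M.smul_mem n i t m ht hm, rfl⟩

/-- A sequence `C ↪ E ↠ D` of graded bimodules which is short exact. -/
def IsShortExact {C E D : GBimod V} (f : Hom C E) (g : Hom E D) : Prop :=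
  Function.Injective f.toLin ∧ Function.Exact f.toLin g.toLin ∧ Function.Surjective g.toLin

/-- `E` is isomorphic to a finite direct sum of shifts of bimodules from the family `X`. -/
def IsSumOfShifts (X : Set (GBimod V)) (E : GBimod V) : Prop :=
  ∃ (n : ℕ) (Y : Fin n → GBimod V) (m : Fin n → ℤ),
    (∀ k, Y k ∈ X) ∧ Nonempty (Iso E (dsum fun k => (Y k).shift (m k)))

end GBimod

variable {V}

theorem proj_smul_of_mem (M : GBimod V) {n : ℕ} {t : RR V} (ht : t ∈ lin₂ V ^ n) (i : ℤ) (m : M) :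
    projOf M.isInternal (i + 2 * n) (t • m) = t • projOf M.isInternal i m := by
  induction m using internal_induction M.isInternal with
  | h0 => simp
  | hadd x y hx hy => rw [smul_add, map_add, map_add, smul_add, hx, hy]
  | hom j x hx =>
    by_cases h : j = i
    · subst h
      rw [projOf_same _ hx, projOf_same _ (M.smul_mem n j t x ht hx)]
    · rw [projOf_ne _ h hx, projOf_ne _ (fun h' => h (by omega)) (M.smul_mem n j t x ht hx),
        smul_zero]

variable (V) in
/-- `R ⊗ R` as a graded bimodule. -/
def regular : GBimod V where
  carrier := RR V
  deg i := ⨆ (n : ℕ) (_ : 2 * (n : ℤ) = i), lin₂ V ^ n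
  isInternal := by
    have hmem : ∀ i x, x ∈ (⨆ (n : ℕ) (_ : 2 * (n : ℤ) = i), lin₂ V ^ n) →
        x = 0 ∨ ∃ n : ℕ, 2 * (n : ℤ) = i ∧ x ∈ lin₂ V ^ n := by
      intro i x hx
      by_cases h : ∃ n : ℕ, 2 * (n : ℤ) = i
      · obtain ⟨n, hn⟩ := h
        refine Or.inr ⟨n, hn, ?_⟩
        have : (⨆ (n : ℕ) (_ : 2 * (n : ℤ) = i), lin₂ V ^ n) ≤ lin₂ V ^ n :=
          iSup₂_le fun k hk => by rw [show k = n by omega]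
        exact this hx
      · left
        have : (⨆ (n : ℕ) (_ : 2 * (n : ℤ) = i), lin₂ V ^ n) ≤ ⊥ :=
          iSup₂_le fun k hk => absurd ⟨k, hk⟩ h
        exact (Submodule.mem_bot ℝ).mp (this hx)
    refine isInternal_of_proj (fun i => if 0 ≤ i ∧ Even i then
      (GradedAlgebra.proj (fun n : ℕ => lin₂ V ^ n) (i / 2).toNat).toAddMonoidHom else 0) ?_ ?_ ?_ ?_
    · intro i x
      split_ifs with h
      · refine Submodule.mem_iSup_of_mem (i / 2).toNat (Submodule.mem_iSup_of_mem ?_ ?_)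
        · obtain ⟨h1, k, hk⟩ := h; omega
        · exact SetLike.coe_mem (DirectSum.decompose (fun n : ℕ => lin₂ V ^ n) x (i / 2).toNat)
      · exact Submodule.zero_mem _
    · intro i x hx
      rcases hmem i x hx with rfl | ⟨n, rfl, hn⟩
      · rw [map_zero]
      · rw [if_pos ⟨by omega, ⟨n, by ring⟩⟩]
        rw [show (2 * (n : ℤ) / 2).toNat = n by omega]
        exact DirectSum.decompose_of_mem_same _ hn
    · intro i j hij x hx
      rcases hmem i x hx with rfl | ⟨n, rfl, hn⟩
      · rw [map_zero]
      · split_ifs with h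
        · refine DirectSum.decompose_of_mem_ne _ hn ?_
          obtain ⟨h1, k, hk⟩ := h; omega
        · rfl
    · intro x
      classical
      refine ⟨((DirectSum.decompose (fun n : ℕ => lin₂ V ^ n) x).support).image
        (fun n : ℕ => 2 * (n : ℤ)), fun t ht => ?_⟩
      rw [← Finset.sum_subset ht, Finset.sum_image (fun a _ b _ h => by simpa using h)]
      · conv_rhs => rw [← DirectSum.sum_support_decompose (fun n : ℕ => lin₂ V ^ n) x]
        refine Finset.sum_congr rfl fun n _ => ?_
        rw [if_pos ⟨by omega, ⟨n, by ring⟩⟩]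
        rw [show (2 * (n : ℤ) / 2).toNat = n by omega]
        rfl
      · intro i _ hi
        split_ifs with h
        · by_contra h0
          refine hi (Finset.mem_image.mpr ⟨(i / 2).toNat, ?_, ?_⟩)
          · rw [DFinsupp.mem_support_iff]
            intro h1
            exact h0 (congrArg Subtype.val h1)
          · obtain ⟨h1, k, hk⟩ := h; omega
        · rfl
  smul_mem n i t m ht hm := by
    rw [← SetLike.mem_coe] at hm
    have : (⨆ (k : ℕ) (_ : 2 * (k : ℤ) = i), lin₂ V ^ k) ≤
        (⨆ (k : ℕ) (_ : 2 * (k : ℤ) = i + 2 * n), lin₂ V ^ k).comap (LinearMap.mulLeft ℝ t) :=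
      iSup₂_le fun k hk x hx => Submodule.mem_iSup_of_mem (n + k)
        (Submodule.mem_iSup_of_mem (by push_cast; omega)
          (by rw [pow_add]; exact Submodule.mul_mem_mul ht hx))
    exact this hm

theorem mem_regular_deg {n : ℕ} {t : RR V} (ht : t ∈ lin₂ V ^ n) : (show (regular V).carrier from t) ∈ (regular V).deg (2 * n) := by
  have : t ∈ ⨆ (k : ℕ) (_ : 2 * (k : ℤ) = 2 * n), lin₂ V ^ k :=
    Submodule.mem_iSup_of_mem n (Submodule.mem_iSup_of_mem rfl ht)
  exact this

theorem isHomogeneous_regular {I : Ideal (RR V)}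
    (hI : I.IsHomogeneous fun n : ℕ => lin₂ V ^ n) : (regular V).IsHomogeneous I := by
  intro i t ht
  classical
  have key : ∀ (T : Finset ℕ) (c : ℕ → (regular V).carrier) (s : (regular V).carrier),
      ∑ n ∈ T, c n = s → (∀ n : ℕ, c n ∈ (regular V).deg (2 * n)) → (∀ n, c n ∈ I) →
      projOf (regular V).isInternal i s ∈ I := by
    rintro T c _ rfl hc hI
    rw [map_sum]
    refine Submodule.sum_mem I fun n _ => ?_
    by_cases h : 2 * (n : ℤ) = i
    · subst h
      rw [projOf_same _ (hc n)]; exact hI n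
    · rw [projOf_ne _ h (hc n)]; exact Submodule.zero_mem I
  let t' : RR V := t
  exact key _ (fun n => (DirectSum.decompose (fun n : ℕ => lin₂ V ^ n) t' n : RR V)) t
    (DirectSum.sum_support_decompose (fun n : ℕ => lin₂ V ^ n) t')
    (fun n => mem_regular_deg (SetLike.coe_mem _)) fun n => hI n ht

/-- The graded bimodule `(R ⊗ R) / I` for a homogeneous ideal `I`. -/
def cyclic (I : Ideal (RR V)) (hI : I.IsHomogeneous fun n : ℕ => lin₂ V ^ n) : GBimod V :=
  (regular V).quot I (isHomogeneous_regular hI)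


section Tensor

/-- `M` regarded as an `R`-module through its right action. -/
def RightRes (M : GBimod V) : Type u := M.carrier

/-- `N` regarded as an `R`-module through its left action. -/
def LeftRes (N : GBimod V) : Type u := N.carrier

variable (M N : GBimod V)

instance : AddCommGroup (RightRes M) := inferInstanceAs (AddCommGroup M.carrier)
instance : Module ℝ (RightRes M) := inferInstanceAs (Module ℝ M.carrier)
instance : Module (R V) (RightRes M) := Module.compHom M.carrier (inr V).toRingHom
instance : AddCommGroup (LeftRes N) := inferInstanceAs (AddCommGroup N.carrier)
instance : Module ℝ (LeftRes N) := inferInstanceAs (Module ℝ N.carrier)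
instance : Module (R V) (LeftRes N) := Module.compHom N.carrier (inl V).toRingHom

instance : IsScalarTower ℝ (R V) (RightRes M) where
  smul_assoc c r m := by
    have : ∀ m : M.carrier, inr V (c • r) • m = c • (inr V r • m) := fun m => by
      rw [map_smul, smul_assoc]
    exact this m

instance : IsScalarTower ℝ (R V) (LeftRes N) where
  smul_assoc c r n := by
    have : ∀ n : N.carrier, inl V (c • r) • n = c • (inl V r • n) := fun n => by
      rw [map_smul, smul_assoc]
    exact this n

/-- Left multiplication by `f` commutes with the right action. -/
def rightResEnd (f : R V) : RightRes M →ₗ[R V] RightRes M :=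
  let φ : M.carrier → M.carrier := fun m => inl V f • m
  { toFun := φ
    map_add' := smul_add (A := M.carrier) (inl V f)
    map_smul' := fun r m => smul_comm (α := M.carrier) (inl V f) (inr V r) m }

/-- Right multiplication by `g` commutes with the left action. -/
def leftResEnd (g : R V) : LeftRes N →ₗ[R V] LeftRes N :=
  let φ : N.carrier → N.carrier := fun n => inr V g • n
  { toFun := φ
    map_add' := smul_add (A := N.carrier) (inr V g)
    map_smul' := fun r n => smul_comm (α := N.carrier) (inr V g) (inl V r) n }

/-- The space `M ⊗_R N`. -/
def TensorCarrier : Type u := RightRes M ⊗[R V] LeftRes N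

instance : AddCommGroup (TensorCarrier M N) :=
  inferInstanceAs (AddCommGroup (RightRes M ⊗[R V] LeftRes N))
instance : Module ℝ (TensorCarrier M N) := inferInstanceAs (Module ℝ (RightRes M ⊗[R V] LeftRes N))

variable {M N}

/-- The pure tensor `m ⊗ n` in `M ⊗_R N`. -/
def tprod (m : M) (n : N) : TensorCarrier M N :=
  TensorProduct.tmul (R V) (M := RightRes M) (N := LeftRes N) m n

theorem tprod_add_left (m m' : M) (n : N) : tprod (m + m') n = tprod m n + tprod m' n :=
  TensorProduct.add_tmul _ _ _

theorem tprod_add_right (m : M) (n n' : N) : tprod m (n + n') = tprod m n + tprod m n' :=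
  TensorProduct.tmul_add _ _ _

theorem tprod_zero_left (n : N) : tprod (0 : M) n = 0 := TensorProduct.zero_tmul _ _

theorem tprod_zero_right (m : M) : tprod m (0 : N) = 0 := TensorProduct.tmul_zero _ _

theorem smul_tprod (c : ℝ) (m : M) (n : N) : c • tprod m n = tprod (c • m) n := rfl

theorem tprod_balanced (r : R V) (m : M) (n : N) : tprod (inr V r • m) n = tprod m (inl V r • n) :=
  TensorProduct.smul_tmul (R := R V) (M := RightRes M) (N := LeftRes N) r m n

theorem tensor_induction {P : TensorCarrier M N → Prop} (h0 : P 0)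
    (hadd : ∀ x y, P x → P y → P (x + y))
    (hom : ∀ i j, ∀ m ∈ M.deg i, ∀ n ∈ N.deg j, P (tprod m n)) (x : TensorCarrier M N) : P x := by
  have key : ∀ (m : M) (n : N), P (tprod m n) := by
    intro m n
    induction m using internal_induction M.isInternal with
    | h0 => rw [tprod_zero_left]; exact h0
    | hadd x y hx hy => rw [tprod_add_left]; exact hadd _ _ hx hy
    | hom i x hx =>
      induction n using internal_induction N.isInternal with
      | h0 => rw [tprod_zero_right]; exact h0
      | hadd y z hy hz => rw [tprod_add_right]; exact hadd _ _ hy hz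
      | hom j y hy => exact hom i j x hx y hy
  exact TensorProduct.induction_on (motive := P) x h0 key hadd

variable (M N)

/-- The left action of `f` on `M ⊗_R N`. -/
def tensorLeft (f : R V) : Module.End ℝ (TensorCarrier M N) :=
  (TensorProduct.map (R := R V) (rightResEnd M f)
    (LinearMap.id : LeftRes N →ₗ[R V] LeftRes N)).restrictScalars ℝ

/-- The right action of `g` on `M ⊗_R N`. -/
def tensorRight (g : R V) : Module.End ℝ (TensorCarrier M N) :=
  (TensorProduct.map (R := R V) (LinearMap.id : RightRes M →ₗ[R V] RightRes M) (leftResEnd N g)).restrictScalars ℝ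

variable {M N}

theorem tensorLeft_tprod (f : R V) (m : M) (n : N) :
    tensorLeft M N f (tprod m n) = tprod (inl V f • m) n := rfl

theorem tensorRight_tprod (g : R V) (m : M) (n : N) :
    tensorRight M N g (tprod m n) = tprod m (inr V g • n) := rfl

theorem tensor_end_ext {φ ψ : Module.End ℝ (TensorCarrier M N)}
    (h : ∀ (m : M) (n : N), φ (tprod m n) = ψ (tprod m n)) : φ = ψ := by
  refine LinearMap.ext fun x => ?_
  induction x using tensor_induction with
  | h0 => simp
  | hadd x y hx hy => rw [map_add, map_add, hx, hy]
  | hom i j m hm n hn => exact h m n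

variable (M N)

/-- The left action of `R` on `M ⊗_R N` as an algebra homomorphism. -/
def tensorLeftHom : R V →ₐ[ℝ] Module.End ℝ (TensorCarrier M N) where
  toFun := tensorLeft M N
  map_one' := tensor_end_ext fun m n => by rw [tensorLeft_tprod, map_one, one_smul]; rfl
  map_mul' f g := tensor_end_ext fun m n => by
    rw [Module.End.mul_apply, tensorLeft_tprod, tensorLeft_tprod, tensorLeft_tprod, map_mul, mul_smul]
  map_zero' := tensor_end_ext fun m n => by
    rw [tensorLeft_tprod, map_zero, zero_smul, tprod_zero_left]; rfl
  map_add' f g := tensor_end_ext fun m n => by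
    rw [LinearMap.add_apply, tensorLeft_tprod, tensorLeft_tprod, tensorLeft_tprod, map_add, add_smul,
      tprod_add_left]
  commutes' c := tensor_end_ext fun m n => by
    rw [tensorLeft_tprod, AlgHom.commutes, algebraMap_smul, Module.algebraMap_end_apply, smul_tprod]

/-- The right action of `R` on `M ⊗_R N` as an algebra homomorphism. -/
def tensorRightHom : R V →ₐ[ℝ] Module.End ℝ (TensorCarrier M N) where
  toFun := tensorRight M N
  map_one' := tensor_end_ext fun m n => by rw [tensorRight_tprod, map_one, one_smul]; rfl
  map_mul' f g := tensor_end_ext fun m n => by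
    rw [Module.End.mul_apply, tensorRight_tprod, tensorRight_tprod, tensorRight_tprod, map_mul,
      mul_smul]
  map_zero' := tensor_end_ext fun m n => by
    rw [tensorRight_tprod, map_zero, zero_smul, tprod_zero_right]; rfl
  map_add' f g := tensor_end_ext fun m n => by
    rw [LinearMap.add_apply, tensorRight_tprod, tensorRight_tprod, tensorRight_tprod, map_add,
      add_smul, tprod_add_right]
  commutes' c := tensor_end_ext fun m n => by
    rw [tensorRight_tprod, AlgHom.commutes, algebraMap_smul, Module.algebraMap_end_apply, smul_tprod]
    have h := tprod_balanced (algebraMap ℝ (R V) c) m n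
    rw [AlgHom.commutes, AlgHom.commutes, algebraMap_smul, algebraMap_smul] at h
    exact h.symm

theorem tensor_commute (f g : R V) : Commute (tensorLeftHom M N f) (tensorRightHom M N g) :=
  tensor_end_ext fun _ _ => rfl

/-- The action of `R ⊗ R` on `M ⊗_R N`. -/
def tensorHom : RR V →ₐ[ℝ] Module.End ℝ (TensorCarrier M N) :=
  (Algebra.TensorProduct.lift (tensorLeftHom M N) (tensorRightHom M N) (tensor_commute M N) :
    R V ⊗[ℝ] R V →ₐ[ℝ] Module.End ℝ (TensorCarrier M N))

instance : Module (RR V) (TensorCarrier M N) :=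
  Module.compHom (TensorCarrier M N) (tensorHom M N).toRingHom

instance : IsScalarTower ℝ (RR V) (TensorCarrier M N) where
  smul_assoc c t x := by
    change tensorHom M N (c • t) x = c • tensorHom M N t x
    rw [map_smul, LinearMap.smul_apply]

variable {M N}

theorem inl_smul_tprod (f : R V) (m : M) (n : N) : inl V f • tprod m n = tprod (inl V f • m) n := by
  change tensorHom M N (inl V f) (tprod m n) = _
  have : tensorHom M N (inl V f) = tensorLeftHom M N f :=
    Algebra.TensorProduct.lift_tmul _ _ _ f 1 |>.trans (by rw [map_one, mul_one])
  rw [this]; rfl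

theorem inr_smul_tprod (g : R V) (m : M) (n : N) : inr V g • tprod m n = tprod m (inr V g • n) := by
  change tensorHom M N (inr V g) (tprod m n) = _
  have : tensorHom M N (inr V g) = tensorRightHom M N g :=
    Algebra.TensorProduct.lift_tmul _ _ _ 1 g |>.trans (by rw [map_one, one_mul])
  rw [this]; rfl

variable (M N)

/-- The component of degree `k` of `M ⊗_R N`, spanned by the `m ⊗ n` with `deg m + deg n = k`. -/
def tensorDeg (k : ℤ) : Submodule ℝ (TensorCarrier M N) :=
  Submodule.span ℝ {x | ∃ i j : ℤ, i + j = k ∧ ∃ m ∈ M.deg i, ∃ n ∈ N.deg j, x = tprod m n}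


variable {M N}

theorem tprod_mem_tensorDeg {i j : ℤ} {m : M} {n : N} (hm : m ∈ M.deg i) (hn : n ∈ N.deg j) :
    tprod m n ∈ tensorDeg M N (i + j) :=
  Submodule.subset_span ⟨i, j, rfl, m, hm, n, hn, rfl⟩

theorem tprod_smul_right (c : ℝ) (m : M) (n : N) : tprod m (c • n) = c • tprod m n := by
  have h := tprod_balanced (algebraMap ℝ (R V) c) m n
  rw [AlgHom.commutes, AlgHom.commutes, algebraMap_smul, algebraMap_smul] at h
  exact h.symm

variable (M N)

/-- Auxiliary map for the grading of `M ⊗_R N`, on homogeneous components. -/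
def tensorAux₁ (i j : ℤ) : M.deg i →+ N.deg j →+ (ℤ →₀ TensorCarrier M N) :=
  AddMonoidHom.mk' (fun m => AddMonoidHom.mk'
    (fun n => Finsupp.single (i + j) (tprod (m : M) (n : N)))
    fun n n' => by rw [Submodule.coe_add, tprod_add_right, Finsupp.single_add])
    fun m m' => by
      ext1 n
      change Finsupp.single (i + j) (tprod ((m : M) + (m' : M)) (n : N)) = _
      rw [tprod_add_left, Finsupp.single_add]
      rfl

/-- Auxiliary map for the grading of `M ⊗_R N`: the sum of all `m_i ⊗ n_j`, placed in degree
`i + j`. -/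
def tensorAux₂ : M →+ N →+ (ℤ →₀ TensorCarrier M N) :=
  AddMonoidHom.mk' (fun m => (DirectSum.toAddMonoid (fun i => AddMonoidHom.flip
      (DirectSum.toAddMonoid fun j => AddMonoidHom.flip (tensorAux₁ M N i j)))
      ((equivOf M.isInternal).symm m)).comp (equivOf N.isInternal).symm.toLinearMap.toAddMonoidHom)
    fun m m' => by rw [map_add, map_add]; rfl

variable {M N}

theorem tensorAux₂_apply {i j : ℤ} {m : M} {n : N} (hm : m ∈ M.deg i) (hn : n ∈ N.deg j) :
    tensorAux₂ M N m n = Finsupp.single (i + j) (tprod m n) := by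
  change DirectSum.toAddMonoid (fun i => AddMonoidHom.flip
      (DirectSum.toAddMonoid fun j => AddMonoidHom.flip (tensorAux₁ M N i j)))
      ((equivOf M.isInternal).symm m) ((equivOf N.isInternal).symm n) = _
  rw [equivOf_symm_of_mem _ hm, equivOf_symm_of_mem _ hn, DirectSum.toAddMonoid_of,
    AddMonoidHom.flip_apply, DirectSum.toAddMonoid_of]
  rfl

theorem balance_of_homogeneous {a : RR V} {b : RR V}
    (h : ∀ i j, ∀ m ∈ M.deg i, ∀ n ∈ N.deg j,
      tensorAux₂ M N (a • m) n = tensorAux₂ M N m (b • n)) (m : M) (n : N) :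
    tensorAux₂ M N (a • m) n = tensorAux₂ M N m (b • n) := by
  induction m using internal_induction M.isInternal with
  | h0 => simp
  | hadd x y hx hy => rw [smul_add, map_add, map_add, AddMonoidHom.add_apply, hx, hy]; rfl
  | hom i x hx =>
    induction n using internal_induction N.isInternal with
    | h0 => simp
    | hadd y z hy hz => rw [smul_add, map_add, map_add, hy, hz]
    | hom j y hy => exact h i j x hx y hy

theorem inl_ι_mem (l : Module.Dual ℝ V) : inl V (SymmetricAlgebra.ι ℝ _ l) ∈ lin₂ V ^ 1 := by
  rw [pow_one]
  exact inl_lin_le V (Submodule.mem_map_of_mem (LinearMap.mem_range_self _ l))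

theorem inr_ι_mem (l : Module.Dual ℝ V) : inr V (SymmetricAlgebra.ι ℝ _ l) ∈ lin₂ V ^ 1 := by
  rw [pow_one]
  exact inr_lin_le V (Submodule.mem_map_of_mem (LinearMap.mem_range_self _ l))

theorem tensorAux₂_balanced (r : R V) (m : M) (n : N) :
    tensorAux₂ M N (inr V r • m) n = tensorAux₂ M N m (inl V r • n) := by
  induction r using SymmetricAlgebra.induction generalizing m n with
  | algebraMap c =>
    refine balance_of_homogeneous (fun i j m hm n hn => ?_) m n
    rw [AlgHom.commutes, AlgHom.commutes, algebraMap_smul, algebraMap_smul,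
      tensorAux₂_apply (Submodule.smul_mem _ c hm) hn,
      tensorAux₂_apply hm (Submodule.smul_mem _ c hn), tprod_smul_right, smul_tprod]
  | ι l =>
    refine balance_of_homogeneous (fun i j m hm n hn => ?_) m n
    rw [tensorAux₂_apply (M.smul_mem 1 i _ m (inr_ι_mem l) hm) hn,
      tensorAux₂_apply hm (N.smul_mem 1 j _ n (inl_ι_mem l) hn), tprod_balanced]
    congr 1
    ring
  | mul a b ha hb =>
    rw [map_mul, mul_smul, ha, hb, map_mul, ← mul_smul, mul_comm]
  | add a b ha hb =>
    rw [map_add, add_smul, map_add, AddMonoidHom.add_apply, ha, hb, map_add, add_smul, map_add]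

variable (M N)

/-- Auxiliary map for the grading of `M ⊗_R N`: it sends a tensor to its components. -/
def tensorAux : TensorCarrier M N →+ (ℤ →₀ TensorCarrier M N) :=
  TensorProduct.liftAddHom (R := R V) (M := RightRes M) (N := LeftRes N) (tensorAux₂ M N)
    tensorAux₂_balanced

variable {M N}

theorem tensorAux_tprod {i j : ℤ} {m : M} {n : N} (hm : m ∈ M.deg i) (hn : n ∈ N.deg j) :
    tensorAux M N (tprod m n) = Finsupp.single (i + j) (tprod m n) :=
  tensorAux₂_apply hm hn

theorem tensorAux_of_mem {k : ℤ} {x : TensorCarrier M N} (hx : x ∈ tensorDeg M N k) :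
    tensorAux M N x = Finsupp.single k x := by
  induction hx using Submodule.span_induction with
  | mem x h =>
    obtain ⟨i, j, rfl, m, hm, n, hn, rfl⟩ := h
    exact tensorAux_tprod hm hn
  | zero => simp
  | add x y _ _ hx hy => rw [map_add, hx, hy, Finsupp.single_add]
  | smul c x _ hx =>
    have : ∀ x, tensorAux M N (c • x) = c • tensorAux M N x := by
      intro x
      induction x using tensor_induction with
      | h0 => simp
      | hadd x y hx hy => rw [smul_add, map_add, map_add, smul_add, hx, hy]
      | hom i j m hm n hn =>
        rw [smul_tprod, tensorAux_tprod (Submodule.smul_mem _ c hm) hn, tensorAux_tprod hm hn,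
          Finsupp.smul_single, smul_tprod]
    rw [this, hx, Finsupp.smul_single]

variable (M N)

theorem tensor_isInternal : DirectSum.IsInternal (tensorDeg M N) := by
  refine isInternal_of_proj (fun k => (Finsupp.applyAddHom k).comp (tensorAux M N)) ?_ ?_ ?_ ?_
  · intro k x
    change tensorAux M N x k ∈ _
    induction x using tensor_induction with
    | h0 => simp
    | hadd x y hx hy => rw [map_add, Finsupp.add_apply]; exact Submodule.add_mem _ hx hy
    | hom i j m hm n hn =>
      rw [tensorAux_tprod hm hn]
      by_cases h : i + j = k
      · subst h; rw [Finsupp.single_eq_same]; exact tprod_mem_tensorDeg hm hn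
      · rw [Finsupp.single_eq_of_ne (Ne.symm h)]; exact Submodule.zero_mem _
  · intro k x hx
    change tensorAux M N x k = x
    rw [tensorAux_of_mem hx, Finsupp.single_eq_same]
  · intro k l h x hx
    change tensorAux M N x l = 0
    rw [tensorAux_of_mem hx, Finsupp.single_eq_of_ne (Ne.symm h)]
  · intro x
    refine ⟨(tensorAux M N x).support, fun t ht => ?_⟩
    change ∑ k ∈ t, tensorAux M N x k = x
    rw [← Finsupp.sum_of_support_subset (tensorAux M N x) ht (fun _ y => y) fun _ _ => rfl]
    clear ht
    induction x using tensor_induction with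
    | h0 => simp
    | hadd x y hx hy =>
      rw [map_add, Finsupp.sum_add_index' (fun _ => rfl) (fun _ _ _ => rfl), hx, hy]
    | hom i j m hm n hn => rw [tensorAux_tprod hm hn, Finsupp.sum_single_index rfl]

theorem tensor_smul_lin (k : ℤ) (l : RR V) (hl : l ∈ lin₂ V) (x : TensorCarrier M N)
    (hx : x ∈ tensorDeg M N k) : l • x ∈ tensorDeg M N (k + 2) := by
  obtain ⟨_, ⟨_, ⟨y, rfl⟩, rfl⟩, _, ⟨_, ⟨z, rfl⟩, rfl⟩, rfl⟩ := Submodule.mem_sup.mp hl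
  rw [add_smul]
  induction hx using Submodule.span_induction with
  | mem x h =>
    obtain ⟨i, j, rfl, m, hm, n, hn, rfl⟩ := h
    refine Submodule.add_mem _ ?_ ?_
    · have := tprod_mem_tensorDeg (M.smul_mem 1 i _ m (inl_ι_mem y) hm) hn
      rw [← inl_smul_tprod] at this
      rw [show i + j + 2 = i + 2 * ((1 : ℕ) : ℤ) + j by push_cast; ring]
      exact this
    · have := tprod_mem_tensorDeg hm (N.smul_mem 1 j _ n (inr_ι_mem z) hn)
      rw [← inr_smul_tprod] at this
      rw [show i + j + 2 = i + (j + 2 * ((1 : ℕ) : ℤ)) by push_cast; ring]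
      exact this
  | zero => simp
  | add x y _ _ hx hy =>
    rw [smul_add, smul_add, add_add_add_comm]
    exact Submodule.add_mem _ hx hy
  | smul c x _ hx =>
    rw [smul_comm _ c x, smul_comm _ c x, ← smul_add]
    exact Submodule.smul_mem _ c hx

/-- The tensor product `M ⊗_R N` of graded bimodules. -/
def tensor : GBimod V where
  carrier := TensorCarrier M N
  deg := tensorDeg M N
  isInternal := tensor_isInternal M N
  smul_mem n k t x ht hx := by
    induction ht using Submodule.pow_induction_on_left' with
    | algebraMap r =>
      rw [algebraMap_smul, Nat.cast_zero, mul_zero, add_zero]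
      exact Submodule.smul_mem _ r hx
    | add s t n hs ht ihs iht => rw [add_smul]; exact Submodule.add_mem _ ihs iht
    | mem_mul l hl n t ht ih =>
      rw [mul_smul]
      have := tensor_smul_lin M N _ l hl _ ih
      convert this using 2
      push_cast
      ring

end Tensor

section Geometry

variable {S : Type*} {M : CoxeterMatrix S} {W : Type*} [Group W] (cs : CoxeterSystem M W)
variable (𝔥 : Realisation M V)

/-- The contragredient action of `x ∈ W` on linear forms, `(x λ)(v) = λ(x⁻¹ v)`. -/
def dualAct (x : W) : Module.Dual ℝ V →ₗ[ℝ] Module.Dual ℝ V :=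
  ((𝔥.rep cs x⁻¹ : V ≃ₗ[ℝ] V) : V →ₗ[ℝ] V).dualMap

/-- The action of `x ∈ W` on `R`. -/
def act (x : W) : R V →ₐ[ℝ] R V :=
  SymmetricAlgebra.lift (SymmetricAlgebra.ι ℝ (Module.Dual ℝ V) ∘ₗ dualAct cs 𝔥 x)

/-- Restriction of functions from `V × V` to the twisted graph `Gr_x = {(x v, v)}`. In terms of the
first coordinate it is `f ⊗ g ↦ f · x(g)`. -/
def restrictGr (x : W) : RR V →ₐ[ℝ] R V := RRlift V (AlgHom.id ℝ (R V)) (act cs 𝔥 x)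

/-- The vanishing ideal of `Gr_X = ⋃_{x ∈ X} Gr_x`. -/
def idealGr (X : Set W) : Ideal (RR V) := ⨅ x ∈ X, RingHom.ker (restrictGr cs 𝔥 x)

theorem act_lin (x : W) : (lin V).map (act cs 𝔥 x).toLinearMap ≤ lin V := by
  rintro _ ⟨_, ⟨y, rfl⟩, rfl⟩
  refine ⟨dualAct cs 𝔥 x y, ?_⟩
  rw [AlgHom.toLinearMap_apply, act, SymmetricAlgebra.lift_ι_apply]
  rfl

theorem restrictGr_lin (x : W) : (lin₂ V).map (restrictGr cs 𝔥 x).toLinearMap ≤ lin V := by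
  rintro _ ⟨l, hl, rfl⟩
  obtain ⟨_, ⟨y, hy, rfl⟩, _, ⟨z, hz, rfl⟩, rfl⟩ := Submodule.mem_sup.mp hl
  rw [map_add]
  refine Submodule.add_mem _ ?_ ?_
  · change restrictGr cs 𝔥 x (inl V y) ∈ _
    rw [restrictGr, RRlift_inl]; exact hy
  · change restrictGr cs 𝔥 x (inr V z) ∈ _
    rw [restrictGr, RRlift_inr]; exact act_lin cs 𝔥 x (Submodule.mem_map_of_mem hz)

theorem map_decompose {A B : Type*} [CommRing A] [Algebra ℝ A] [CommRing B] [Algebra ℝ B]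
    (L : Submodule ℝ A) (L' : Submodule ℝ B) [GradedAlgebra fun n : ℕ => L ^ n]
    [GradedAlgebra fun n : ℕ => L' ^ n] (φ : A →ₐ[ℝ] B) (h : L.map φ.toLinearMap ≤ L')
    (a : A) (n : ℕ) :
    φ (DirectSum.decompose (fun n : ℕ => L ^ n) a n : A) =
      (DirectSum.decompose (fun n : ℕ => L' ^ n) (φ a) n : B) := by
  have hpow : ∀ n : ℕ, ∀ x ∈ L ^ n, φ x ∈ L' ^ n := by
    intro n x hx
    have h2 : (L ^ n).map φ.toLinearMap ≤ L' ^ n := by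
      rw [Submodule.map_pow]
      exact pow_le_pow_left' h n
    exact h2 (Submodule.mem_map_of_mem hx)
  induction a using DirectSum.Decomposition.inductionOn (fun n : ℕ => L ^ n) with
  | zero => simp
  | add x y hx hy => simp [hx, hy, DirectSum.decompose_add]
  | @homogeneous i x =>
    by_cases hi : i = n
    · subst hi
      rw [DirectSum.decompose_of_mem_same _ x.2, DirectSum.decompose_of_mem_same _ (hpow _ _ x.2)]
    · rw [DirectSum.decompose_of_mem_ne _ x.2 hi, DirectSum.decompose_of_mem_ne _ (hpow _ _ x.2) hi,
        map_zero]

theorem idealGr_isHomogeneous (X : Set W) :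
    (idealGr cs 𝔥 X).IsHomogeneous fun n : ℕ => lin₂ V ^ n := by
  refine Ideal.IsHomogeneous.iInf₂ fun x _ n t ht => ?_
  rw [RingHom.mem_ker] at ht ⊢
  refine (map_decompose (lin₂ V) (lin V) (restrictGr cs 𝔥 x) (restrictGr_lin cs 𝔥 x) t n).trans ?_
  rw [show restrictGr cs 𝔥 x t = 0 from ht]
  simp

/-- The graded bimodule of regular functions on `Gr_X`; for `X = {x}` this is `R(x)`, and for
`X = {x, y}` it is `R(x, y)`. -/
def RGr (X : Set W) : GBimod V := cyclic (idealGr cs 𝔥 X) (idealGr_isHomogeneous cs 𝔥 X)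

/-- The invariants `R^s` of a simple reflection. -/
def invariants (s : S) : Subalgebra ℝ (R V) :=
  AlgHom.equalizer (act cs 𝔥 (cs.simple s)) (AlgHom.id ℝ (R V))

/-- The kernel of `R ⊗ R → R ⊗_{R^s} R`. -/
def idealInv (s : S) : Ideal (RR V) :=
  Ideal.span {t | ∃ f ∈ invariants cs 𝔥 s, t = inl V f - inr V f}

theorem idealInv_isHomogeneous (s : S) :
    (idealInv cs 𝔥 s).IsHomogeneous fun n : ℕ => lin₂ V ^ n := by
  classical
  have e : idealInv cs 𝔥 s = Ideal.span {t | ∃ n : ℕ, ∃ f ∈ invariants cs 𝔥 s,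
      f ∈ lin V ^ n ∧ t = inl V f - inr V f} := by
    refine le_antisymm (Ideal.span_le.mpr ?_) (Ideal.span_mono ?_)
    · rintro _ ⟨f, hf, rfl⟩
      rw [← DirectSum.sum_support_decompose (fun n : ℕ => lin V ^ n) f, map_sum, map_sum,
        ← Finset.sum_sub_distrib]
      refine Ideal.sum_mem _ fun n _ => Ideal.subset_span ⟨n, _, ?_, SetLike.coe_mem _, rfl⟩
      change act cs 𝔥 _ _ = _
      rw [map_decompose (lin V) (lin V) _ (act_lin cs 𝔥 _)]
      rw [show act cs 𝔥 (cs.simple s) f = f from hf]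
      rfl
    · rintro _ ⟨n, f, hf, _, rfl⟩
      exact ⟨f, hf, rfl⟩
  rw [e]
  refine Ideal.homogeneous_span _ _ ?_
  rintro _ ⟨n, f, _, hn, rfl⟩
  have hl : inl V f ∈ lin₂ V ^ n := by
    have h := Submodule.mem_map_of_mem (f := (inl V).toLinearMap) hn
    rw [Submodule.map_pow] at h
    exact pow_le_pow_left' (inl_lin_le V) n h
  have hr : inr V f ∈ lin₂ V ^ n := by
    have h := Submodule.mem_map_of_mem (f := (inr V).toLinearMap) hn
    rw [Submodule.map_pow] at h
    exact pow_le_pow_left' (inr_lin_le V) n h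
  exact ⟨n, Submodule.sub_mem _ hl hr⟩

/-- `B(s) = R ⊗_{R^s} R[1]`. -/
def Bs (s : S) : GBimod V := (cyclic (idealInv cs 𝔥 s) (idealInv_isHomogeneous cs 𝔥 s)).shift 1

/-- Soergel bimodules: the smallest class of graded bimodules that contains the monoidal unit
`R = R(id)` and all `B(s)` and that is closed under tensor products, finite direct sums, shifts and
direct summands (in particular under isomorphism). -/
inductive IsSoergel : GBimod V → Prop
  | unit : IsSoergel (RGr cs 𝔥 {1})
  | gen (s : S) : IsSoergel (Bs cs 𝔥 s)
  | tensor {M N : GBimod V} : IsSoergel M → IsSoergel N → IsSoergel (tensor M N)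
  | dsum {n : ℕ} (M : Fin n → GBimod V) : (∀ k, IsSoergel (M k)) → IsSoergel (GBimod.dsum M)
  | shift {M : GBimod V} (j : ℤ) : IsSoergel M → IsSoergel (M.shift j)
  | summand {M N : GBimod V} (i : N.Hom M) (p : M.Hom N) :
      (∀ n, p.toLin (i.toLin n) = n) → IsSoergel M → IsSoergel N

/-- `Γ_X B`: the sections of `B` with support in `Gr_X`. An element is supported in the closed set
`Gr_F`, for a finite `F`, if it is annihilated by a power of the vanishing ideal of `Gr_F`; for an
infinite `X` it is required to be supported in `Gr_F` for some finite subset `F` of `X`. -/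
def sectionsWithSupport (B : GBimod V) (X : Set W) : Submodule (RR V) B where
  carrier := {b | ∃ F : Set W, F.Finite ∧ F ⊆ X ∧ ∃ n : ℕ, ∀ t ∈ idealGr cs 𝔥 F ^ n, t • b = 0}
  zero_mem' := ⟨∅, Set.finite_empty, Set.empty_subset _, 0, fun t _ => smul_zero t⟩
  add_mem' := by
    rintro a b ⟨F, hF, hFX, n, hn⟩ ⟨G, hG, hGX, k, hk⟩
    refine ⟨F ∪ G, hF.union hG, Set.union_subset hFX hGX, n + k, fun t ht => ?_⟩
    have h1 : idealGr cs 𝔥 (F ∪ G) ≤ idealGr cs 𝔥 F := biInf_mono fun x hx => Or.inl hx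
    have h2 : idealGr cs 𝔥 (F ∪ G) ≤ idealGr cs 𝔥 G := biInf_mono fun x hx => Or.inr hx
    rw [smul_add, hn t (Ideal.pow_le_pow_right (Nat.le_add_right n k) (Ideal.pow_right_mono h1 _ ht)),
      hk t (Ideal.pow_le_pow_right (Nat.le_add_left k n) (Ideal.pow_right_mono h2 _ ht)), add_zero]
  smul_mem' := by
    rintro r b ⟨F, hF, hFX, n, hn⟩
    exact ⟨F, hF, hFX, n, fun t ht => by rw [smul_comm, hn t ht, smul_zero]⟩

theorem sectionsWithSupport_isHomogeneous (B : GBimod V) (X : Set W) :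
    B.IsHomogeneous (sectionsWithSupport cs 𝔥 B X) := by
  classical
  rintro i b ⟨F, hF, hFX, n, hn⟩
  refine ⟨F, hF, hFX, n, fun t ht => ?_⟩
  have hpow : ∀ n : ℕ, (idealGr cs 𝔥 F ^ n).IsHomogeneous fun n : ℕ => lin₂ V ^ n := by
    intro n
    induction n with
    | zero => rw [pow_zero, Ideal.one_eq_top]; exact Ideal.IsHomogeneous.top _
    | succ n ih => rw [pow_succ]; exact ih.mul (idealGr_isHomogeneous cs 𝔥 F)
  rw [← DirectSum.sum_support_decompose (fun n : ℕ => lin₂ V ^ n) t, Finset.sum_smul]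
  refine Finset.sum_eq_zero fun k _ => ?_
  rw [← proj_smul_of_mem B (SetLike.coe_mem _), hn _ (hpow n k ht), map_zero]

/-- The stalk `B_X` of `B` along `Gr_X`: the quotient of `B` by the sections that are supported on
the remaining twisted graphs. -/
def stalk (B : GBimod V) (X : Set W) : GBimod V :=
  B.quot (sectionsWithSupport cs 𝔥 B Xᶜ) (sectionsWithSupport_isHomogeneous cs 𝔥 B Xᶜ)

/-- `E` has a biflag with respect to `x, y`: there are short exact sequences `C ↪ E ↠ D` and
`D' ↪ E ↠ C'` in which `C, C'` are finite direct sums of shifts of `R(x)` and `D, D'` are finite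
direct sums of shifts of `R(y)`. -/
def HasBiflag (x y : W) (E : GBimod V) : Prop :=
  (∃ (C D : GBimod V) (f : C.Hom E) (g : E.Hom D), GBimod.IsShortExact f g ∧
    GBimod.IsSumOfShifts {RGr cs 𝔥 {x}} C ∧ GBimod.IsSumOfShifts {RGr cs 𝔥 {y}} D) ∧
  (∃ (D' C' : GBimod V) (f : D'.Hom E) (g : E.Hom C'), GBimod.IsShortExact f g ∧
    GBimod.IsSumOfShifts {RGr cs 𝔥 {y}} D' ∧ GBimod.IsSumOfShifts {RGr cs 𝔥 {x}} C')

end Geometry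

end Bimodules

end Soergel

end

/-!
Both parts rest on the same decomposition. Put `y = xs` and let `β = x(α_s)` be the root of the
reflection `r = x s x⁻¹`, so that `y = r x`. The graphs `Gr_x` and `Gr_y` meet in the hyperplane
`β = 0` of either, and `β ⊗ 1` is the sum of a function `t₁` that vanishes on `Gr_y` and a function
`t₂` that vanishes on `Gr_x` (`exists_add_eq_root`).

*Bimodules with a biflag* (`IsBiflag`, `IsBiflag.isSumOfShifts`). Let `C, D ⊆ E` be the
subbimodules of a biflag: `C` and `E / D` live on `Gr_x`, `D` and `E / C` live on `Gr_y`, and all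
of them are projective over `R` acting from the left. Write `𝔪` for the augmentation ideal of `R`.
Choose homogeneous elements `e` that form a basis of `E` modulo `𝔪 E + C + D`, elements `c` of `C`
that form a basis of its image modulo `𝔪 E + D`, and elements `g` of `D` that form a basis of its
image modulo `𝔪 E + C`. By the graded Nakayama lemma `e, c` is an `R`-basis of `E / D` and `e, g`
is one of `E / C`. Moreover `D` is spanned by `g` and `t₂ e` (`IsBiflag.exists_sum_eq`): if `d ∈ D`
has coordinates `f` along `e` and `f'` along `g` in `E / C`, then `β d` is the combination of
`t₂ e` and `β g` with coefficients `f` and `f'`. So `β` divides `f`, because the elements `t₂ e` of `D`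
are independent modulo `𝔪 D`, and this in turn holds because `β ∉ 𝔪²`. Hence `e, c, g` generate `E`
as a bimodule, and the two bases show that the only relations are those of `R(x, y)`, `R(x)` and
`R(y)` respectively. This is part (b). If `D ⊆ 𝔪 E + C`, there are no elements `g`, and no summands
`R(y)`.

*Soergel bimodules* (`IsStratified`, `isStratified_of_isSoergel`). For part (a) it remains to see
that the stalk of a Soergel bimodule `B` along `Gr_x ∪ Gr_y` has a biflag, given by the sections
that vanish on `Gr_y` and on `Gr_x`, and that `D ⊆ 𝔪 E + C` if `x < y`. Both follow from properties
that pass from `N` to `N ⊗_R B(s)` and to direct summands and sums, and hence hold for all Soergel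
bimodules, starting from `R`:

* sections are determined by their generic values on finitely many twisted graphs (`IsReducedOn`);
* the stalks along finite lower sets of the Bruhat order are projective over `R`, even after the
  order has been translated by an arbitrary `u ∈ W` (`HasFlags`). Translation by `x⁻¹` and by `y⁻¹`
  makes all of `{x}`, `{y}` and `{x, y}` lower sets;
* if `x < r x` for a reflection `r` with root `β`, then a section that vanishes on `Gr_x` is
  divisible by `β` on `Gr_{rx}`, up to factors prime to `β` (`HasDivisibility`).

An element of `N ⊗_R R ⊗_{R^s} R` is a sum `n ⊗ 1 + m ⊗ α_s` and is determined by its two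
projections to `N` (`Induction`), so that everything is computed in `N`. For `Induction.hasFlags`
one enlarges a lower set to one that is stable under `s`. This does not affect the sections on the
graph of a maximal element, since the additional graphs meet it in codimension at least two
(`relKer_union`).

That two graphs `Gr_x`, `Gr_z` meet in codimension one only if `z = r x` for a reflection `r` says
that the representation is reflection faithful (`eq_one_or_isReflection_of_rank_one`). It is proved
from the positivity of coroots (`Pos.of_length_lt`), with a strictly dominant vector that exists
because the simple roots are linearly independent.
-/

open scoped TensorProduct DirectSum

noncomputable section

namespace Soergel

universe u

/-! ### The reflection representation -/

section Reflections

variable {S : Type*} {M : CoxeterMatrix S} {V : Type*} [AddCommGroup V] [Module ℝ V]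
variable {W : Type*} [Group W] (cs : CoxeterSystem M W) (𝔥 : PreRealisation M V)

theorem rep_simple_apply (s : S) (v : V) :
    𝔥.rep cs (cs.simple s) v = v - 𝔥.root s v • 𝔥.coroot s := by
  rw [PreRealisation.rep, cs.lift_apply_simple]
  exact Module.reflection_apply _ _

theorem rep_mul_apply (x y : W) (v : V) : 𝔥.rep cs (x * y) v = 𝔥.rep cs x (𝔥.rep cs y v) := by
  rw [map_mul]; rfl

theorem rep_one_apply (v : V) : 𝔥.rep cs 1 v = v := by
  rw [map_one]; rfl

theorem rep_inv_apply_self (x : W) (v : V) : 𝔥.rep cs x⁻¹ (𝔥.rep cs x v) = v := by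
  rw [← rep_mul_apply, inv_mul_cancel, rep_one_apply]

theorem rep_self_apply_inv (x : W) (v : V) : 𝔥.rep cs x (𝔥.rep cs x⁻¹ v) = v := by
  rw [← rep_mul_apply, mul_inv_cancel, rep_one_apply]

theorem rep_simple_coroot_self (s : S) :
    𝔥.rep cs (cs.simple s) (𝔥.coroot s) = -𝔥.coroot s := by
  rw [rep_simple_apply, 𝔥.root_coroot_self]; module

/-- Membership in the cone spanned by the simple coroots. -/
def Pos (v : V) : Prop := ∃ c : S →₀ ℝ, 0 ≤ c ∧ Finsupp.linearCombination ℝ 𝔥.coroot c = v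

variable {𝔥}

theorem Pos.zero : Pos 𝔥 0 := ⟨0, le_rfl, map_zero _⟩

theorem Pos.add {v w : V} : Pos 𝔥 v → Pos 𝔥 w → Pos 𝔥 (v + w) := by
  rintro ⟨c, hc, rfl⟩ ⟨d, hd, rfl⟩
  exact ⟨c + d, add_nonneg hc hd, map_add _ _ _⟩

theorem Pos.smul {v : V} {a : ℝ} (ha : 0 ≤ a) : Pos 𝔥 v → Pos 𝔥 (a • v) := by
  rintro ⟨c, hc, rfl⟩
  exact ⟨a • c, fun s => mul_nonneg ha (hc s), map_smul _ _ _⟩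

theorem Pos.coroot (s : S) : Pos 𝔥 (𝔥.coroot s) :=
  ⟨Finsupp.single s 1, by simp, by simp⟩

theorem Pos.eq_zero_of_neg {v : V} : Pos 𝔥 v → Pos 𝔥 (-v) → v = 0 := by
  rintro ⟨c, hc, rfl⟩ ⟨d, hd, h⟩
  have : c + d = 0 := 𝔥.linearIndependent_coroot (by rw [map_add, h, map_zero]; abel)
  have hc0 : c = 0 := by
    ext s
    have h1 := DFunLike.congr_fun this s
    have h2 := hc s
    have h3 := hd s
    simp only [Finsupp.coe_zero, Pi.zero_apply, Finsupp.coe_add, Pi.add_apply] at h1 h2 h3 ⊢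
    linarith
  rw [hc0, map_zero]

variable (𝔥)

theorem coroot_ne_zero (s : S) : 𝔥.coroot s ≠ 0 := 𝔥.linearIndependent_coroot.ne_zero s

/-- The numbers `sin (j θ) / sin θ`, in terms of `c = 2 cos θ`. -/
def sinRatio (c : ℝ) : ℕ → ℝ
  | 0 => 0
  | 1 => 1
  | (j + 2) => c * sinRatio c (j + 1) - sinRatio c j

theorem sin_mul_sinRatio (θ : ℝ) (j : ℕ) :
    Real.sin θ * sinRatio (2 * Real.cos θ) j = Real.sin (j * θ) := by
  induction j using Nat.twoStepInduction with
  | zero => simp [sinRatio]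
  | one => simp [sinRatio]
  | more j h0 h1 =>
    rw [sinRatio, mul_sub, h0, mul_left_comm, h1]
    have e1 : ((j : ℝ) + 2) * θ = (j + 1) * θ + θ := by ring
    have e2 : (j : ℝ) * θ = (j + 1) * θ - θ := by ring
    push_cast
    rw [e1, e2, Real.sin_add, Real.sin_sub]
    ring

theorem sinRatio_two (j : ℕ) : sinRatio 2 j = j := by
  induction j using Nat.twoStepInduction with
  | zero => simp [sinRatio]
  | one => simp [sinRatio]
  | more j h0 h1 => rw [sinRatio, h0, h1]; push_cast; ring

/-- For `m = 0`, which encodes `m = ∞`, the quotient `π / m` is `0` and there is no bound on `j`. -/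
theorem sinRatio_nonneg {m : ℕ} (hm : m ≠ 1) {j : ℕ} (hj : m = 0 ∨ j ≤ m) :
    0 ≤ sinRatio (2 * Real.cos (Real.pi / m)) j := by
  rcases Nat.eq_zero_or_pos m with rfl | h0
  · simp only [Nat.cast_zero, div_zero, Real.cos_zero, mul_one, sinRatio_two]
    positivity
  · have hj : j ≤ m := hj.resolve_left h0.ne'
    have hm2 : (2 : ℝ) ≤ m := by exact_mod_cast (show 2 ≤ m by omega)
    have hs : 0 < Real.sin (Real.pi / m) := by
      apply Real.sin_pos_of_pos_of_lt_pi
      · positivity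
      · rw [div_lt_iff₀ (by linarith)]; nlinarith [Real.pi_pos]
    have h := sin_mul_sinRatio (Real.pi / m) j
    have h2 : 0 ≤ Real.sin (j * (Real.pi / m)) := by
      apply Real.sin_nonneg_of_nonneg_of_le_pi
      · positivity
      · rw [mul_div_assoc', div_le_iff₀ (by linarith), mul_comm]
        have : (j : ℝ) ≤ m := by exact_mod_cast hj
        nlinarith [Real.pi_pos]
    rw [← h] at h2
    exact nonneg_of_mul_nonneg_right h2 hs

/-- If `v` keeps `α_s^∨` and `α_t^∨` positive, then so does `v` times an alternating word in `s` and
`t` of length less than `m_st` for suitable combinations of the two coroots; for `j = 0` the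
combination is `α_s^∨`. The coefficients are those that arise from the coroots in the dihedral group
generated by `s` and `t`. -/
theorem Pos.alternatingWord {v : W} (k : ℕ) (s t : S) (hst : s ≠ t)
    (hs : Pos 𝔥 (𝔥.rep cs v (𝔥.coroot s))) (ht : Pos 𝔥 (𝔥.rep cs v (𝔥.coroot t))) (j : ℕ)
    (hj : M s t = 0 ∨ j + k + 1 ≤ M s t) :
    Pos 𝔥 (𝔥.rep cs (v * cs.wordProd (CoxeterSystem.alternatingWord s t k))
      (sinRatio (2 * Real.cos (Real.pi / (M s t : ℝ))) (j + 1) • 𝔥.coroot s +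
        sinRatio (2 * Real.cos (Real.pi / (M s t : ℝ))) j • 𝔥.coroot t)) := by
  induction k generalizing s t j with
  | zero =>
    have hm := M.off_diagonal s t hst
    rw [show CoxeterSystem.alternatingWord s t 0 = [] from rfl, cs.wordProd_nil, mul_one, map_add,
      map_smul, map_smul]
    exact (hs.smul (sinRatio_nonneg hm (by omega))).add (ht.smul (sinRatio_nonneg hm (by omega)))
  | succ k ih =>
    rw [CoxeterSystem.alternatingWord_succ, cs.wordProd_concat, ← mul_assoc, rep_mul_apply]
    have h := ih t s hst.symm ht hs (j + 1) (by rw [M.symmetric]; omega)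
    rw [M.symmetric t s] at h
    convert h using 2
    rw [map_add, map_smul, map_smul, rep_simple_coroot_self, rep_simple_apply, 𝔥.pairing,
      M.symmetric t s, sinRatio]
    module

/-- The simple coroot `α_s^∨` stays positive under `w` if `s` is not a right descent of `w`. -/
theorem Pos.of_length_lt (w : W) (s : S) (h : cs.length w < cs.length (w * cs.simple s)) :
    Pos 𝔥 (𝔥.rep cs w (𝔥.coroot s)) := by
  induction hn : cs.length w using Nat.strong_induction_on generalizing w s with
  | _ n ih =>
  subst hn
  by_cases hw : w = 1
  · subst hw; rw [rep_one_apply]; exact Pos.coroot s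
  obtain ⟨t, ht⟩ := cs.exists_rightDescent_of_ne_one hw
  have hst : s ≠ t := by
    rintro rfl
    exact absurd ht (not_lt.mpr h.le)
  rw [CoxeterSystem.isRightDescent_iff] at ht
  let p : ℕ → W := fun k => cs.wordProd (CoxeterSystem.alternatingWord s t k)
  have hp : ∀ k, p (k + 1) = cs.simple (if Even k then t else s) * p k := fun k => by
    simp only [p]
    rw [CoxeterSystem.alternatingWord_succ', cs.wordProd_cons]
  have hp0 : p 0 = 1 := cs.wordProd_nil
  have hplen : ∀ k, cs.length (p k) ≤ k := fun k => by
    have := cs.length_wordProd_le (CoxeterSystem.alternatingWord s t k)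
    rwa [CoxeterSystem.length_alternatingWord] at this
  have hex : ∃ k, ¬ cs.length (w * (p k)⁻¹) + k = cs.length w :=
    ⟨cs.length w + 1, by omega⟩
  classical
  -- cut off the longest alternating word in `s` and `t` on the right of `w`; what remains is `v`
  obtain ⟨K, hK⟩ : ∃ K, K = Nat.find hex := ⟨_, rfl⟩
  have hPK : ¬ cs.length (w * (p K)⁻¹) + K = cs.length w := hK ▸ Nat.find_spec hex
  have hP : ∀ j < K, cs.length (w * (p j)⁻¹) + j = cs.length w := fun j hj =>
    not_not.mp (Nat.find_min hex (hK ▸ hj))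
  have hp1 : p 1 = cs.simple t := by rw [hp 0, hp0]; simp
  obtain ⟨k, rfl⟩ : ∃ k, K = k + 2 := by
    rcases K with _ | _ | k
    · simp [hp0] at hPK
    · rw [zero_add, hp1, cs.inv_simple] at hPK; omega
    · exact ⟨k, rfl⟩
  have h1 := hP (k + 1) (by omega)
  have h0 := hP k (by omega)
  set v := w * (p (k + 1))⁻¹ with hv
  have hvw : w = v * p (k + 1) := by rw [hv]; group
  have e0 : v * cs.simple (if Even k then t else s) = w * (p k)⁻¹ := by
    rw [hv, hp k]; simp [mul_assoc]
  have e2 : v * cs.simple (if Even (k + 1) then t else s) = w * (p (k + 2))⁻¹ := by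
    rw [hv, hp (k + 1)]; simp [mul_assoc]
  have l0 : cs.length v < cs.length (v * cs.simple (if Even k then t else s)) := by
    rw [e0]; omega
  have l2 : cs.length v < cs.length (v * cs.simple (if Even (k + 1) then t else s)) := by
    rcases cs.length_mul_simple v (if Even (k + 1) then t else s) with h' | h'
    · omega
    · rw [e2] at h'; omega
  have hlt : cs.length v < cs.length w := by omega
  have hs : cs.length v < cs.length (v * cs.simple s) := by
    rcases Nat.even_or_odd k with hk | hk
    · rwa [if_neg (by rw [Nat.not_even_iff_odd]; exact hk.add_one)] at l2
    · rwa [if_neg (by rwa [Nat.not_even_iff_odd])] at l0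
  have ht' : cs.length v < cs.length (v * cs.simple t) := by
    rcases Nat.even_or_odd k with hk | hk
    · rwa [if_pos hk] at l0
    · rwa [if_pos hk.add_one] at l2
  have hm : M s t = 0 ∨ k + 1 + 1 ≤ M s t := by
    by_contra hcon
    push Not at hcon
    obtain ⟨hm0, hm1⟩ := hcon
    have h2 := hP (M s t) (by omega)
    obtain ⟨m, hm⟩ := Nat.exists_eq_succ_of_ne_zero hm0
    -- the two alternating words of length `m_st` agree
    have hbraid : p (M s t) = p m * cs.simple s := by
      have := cs.prod_alternatingWord_eq_prod_alternatingWord_sub s t (M s t) (by omega)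
      simp only [p]
      rw [this, show M s t * 2 - M s t = m + 1 by omega, CoxeterSystem.alternatingWord_succ,
        cs.wordProd_concat]
    rw [hbraid, mul_inv_rev, cs.inv_simple, ← mul_assoc] at h2
    have h3 := cs.length_le_length_mul_add_right (w * cs.simple s) (p m)⁻¹
    rw [cs.length_inv] at h3
    have := hplen m
    omega
  have := Pos.alternatingWord cs 𝔥 (v := v) (k + 1) s t hst (ih _ hlt v s hs rfl)
    (ih _ hlt v t ht' rfl) 0 (by simpa using hm)
  rw [hvw]
  simpa [sinRatio] using this

/-- The simple coroot `α_s^∨` becomes negative under `w` if `s` is a right descent of `w`. -/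
theorem Pos.neg_of_lt_length (w : W) (s : S) (h : cs.length (w * cs.simple s) < cs.length w) :
    Pos 𝔥 (-𝔥.rep cs w (𝔥.coroot s)) := by
  have := Pos.of_length_lt cs 𝔥 (w * cs.simple s) s
    (by rwa [cs.simple_mul_simple_cancel_right])
  rwa [rep_mul_apply, rep_simple_coroot_self, map_neg] at this

/-- The representation is faithful. -/
theorem eq_one_of_rep (w : W) (h : ∀ v, 𝔥.rep cs w v = v) : w = 1 := by
  by_contra hw
  obtain ⟨s, hs⟩ := cs.exists_rightDescent_of_ne_one hw
  have h1 := Pos.neg_of_lt_length cs 𝔥 w s hs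
  rw [h] at h1
  exact coroot_ne_zero 𝔥 s ((Pos.coroot s).eq_zero_of_neg h1)

/-- A vector on which all simple roots take the value one. -/
theorem exists_root_eq_one [FiniteDimensional ℝ V] : ∃ v : V, ∀ s, 𝔥.root s v = 1 := by
  classical
  have hli := 𝔥.linearIndependent_root
  let b := Module.Basis.span hli
  obtain ⟨φ, hφ⟩ := LinearMap.exists_extend (b.constr ℝ (fun _ => (1 : ℝ)))
  refine ⟨(Module.evalEquiv ℝ V).symm φ, fun s => ?_⟩
  rw [Module.apply_evalEquiv_symm_apply]
  have h2 : b s = ⟨𝔥.root s, Submodule.subset_span ⟨s, rfl⟩⟩ := Module.Basis.span_apply hli s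
  have := LinearMap.congr_fun hφ (b s)
  rw [Module.Basis.constr_basis, LinearMap.comp_apply, h2] at this
  exact this

/-- A dominant vector decreases under every element of `W`. -/
theorem Pos.sub_rep {v : V} (hv : ∀ s, 0 ≤ 𝔥.root s v) (w : W) : Pos 𝔥 (v - 𝔥.rep cs w v) := by
  induction hn : cs.length w using Nat.strong_induction_on generalizing w with
  | _ n ih =>
  subst hn
  by_cases hw : w = 1
  · subst hw; rw [rep_one_apply, sub_self]; exact Pos.zero
  obtain ⟨s, hs⟩ := cs.exists_rightDescent_of_ne_one hw
  have h1 := ih _ hs (w * cs.simple s) rfl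
  have h2 := (Pos.neg_of_lt_length cs 𝔥 w s hs).smul (hv s)
  have h3 := h1.add h2
  rw [rep_mul_apply, rep_simple_apply, map_sub, map_smul] at h3
  refine h3.imp fun c hc => ⟨hc.1, hc.2.trans ?_⟩
  module

/-- A strictly dominant vector has trivial stabiliser. -/
theorem eq_one_of_rep_eq_self {v : V} (hv : ∀ s, 0 < 𝔥.root s v) (w : W)
    (h : 𝔥.rep cs w v = v) : w = 1 := by
  by_contra hw
  obtain ⟨s, hs⟩ := cs.exists_rightDescent_of_ne_one hw
  have h1 := Pos.sub_rep cs 𝔥 (fun s => (hv s).le) (w * cs.simple s)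
  have h2 := (Pos.neg_of_lt_length cs 𝔥 w s hs).smul (hv s).le
  have h3 : 𝔥.root s v • -𝔥.rep cs w (𝔥.coroot s) = 0 := by
    refine h2.eq_zero_of_neg ?_
    convert h1 using 1
    rw [rep_mul_apply, rep_simple_apply, map_sub, map_smul, h]
    module
  rw [smul_eq_zero, neg_eq_zero, LinearEquiv.map_eq_zero_iff] at h3
  exact h3.elim (hv s).ne' (coroot_ne_zero 𝔥 s)

/-- An element of `W` that differs from the identity by an operator of rank one, and whose
eigenvalue on the image of that operator is positive, is trivial: for a strictly dominant `v` both
`v - g v` and `v - g⁻¹ v` are positive, but they are multiples of `γ` of opposite signs. -/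
theorem eq_one_of_rank_one [FiniteDimensional ℝ V] (g : W) (ψ : V → ℝ) (γ : V)
    (hg : ∀ v, 𝔥.rep cs g v = v - ψ v • γ) (c : ℝ) (hc : 0 < c) (hγ : 𝔥.rep cs g γ = c • γ) :
    g = 1 := by
  obtain ⟨v, hv⟩ := exists_root_eq_one 𝔥
  have h1 := Pos.sub_rep cs 𝔥 (v := v) (fun s => by rw [hv]; exact zero_le_one)
  have h2 := h1 g
  rw [hg v, sub_sub_cancel] at h2
  have e : 𝔥.rep cs g⁻¹ v = v + (ψ v / c) • γ := by
    have : 𝔥.rep cs g (v + (ψ v / c) • γ) = v := by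
      rw [map_add, map_smul, hγ, hg v, smul_smul, div_mul_cancel₀ _ hc.ne', sub_add_cancel]
    rw [← rep_inv_apply_self cs 𝔥 g (v + (ψ v / c) • γ), this]
  have h3 := (h1 g⁻¹).smul hc.le
  rw [e, sub_add_cancel_left, smul_neg, smul_smul, mul_div_cancel₀ _ hc.ne'] at h3
  have h4 := h2.eq_zero_of_neg h3
  refine eq_one_of_rep_eq_self cs 𝔥 (v := v) (fun s => by rw [hv]; exact one_pos) g ?_
  rw [hg v, h4, sub_zero]

variable {𝔥} in
/-- A positive vector that becomes negative under `s` is a multiple of `α_s^∨`. -/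
theorem Pos.eq_smul_coroot {v : V} {s : S} :
    Pos 𝔥 v → Pos 𝔥 (-𝔥.rep cs (cs.simple s) v) → ∃ k : ℝ, v = k • 𝔥.coroot s := by
  rintro ⟨c, hc, h1⟩ ⟨d, hd, h2⟩
  have h3 : c + d - Finsupp.single s (𝔥.root s v) = 0 :=
    𝔥.linearIndependent_coroot (by
      rw [map_sub, map_add, h1, h2, Finsupp.linearCombination_single, map_zero, rep_simple_apply]
      abel)
  refine ⟨c s, ?_⟩
  have h4 : c = Finsupp.single s (c s) := by
    ext t
    by_cases h : t = s
    · subst h; simp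
    · have e1 := DFunLike.congr_fun h3 t
      have e2 := hc t
      have e3 := hd t
      simp only [Finsupp.coe_zero, Pi.zero_apply, Finsupp.coe_add, Finsupp.coe_sub, Pi.sub_apply,
        Pi.add_apply, Finsupp.single_eq_of_ne h] at e1 e2 e3 ⊢
      linarith
  rw [← h1]
  conv_lhs => rw [h4]
  rw [Finsupp.linearCombination_single]

theorem pos_or_neg (w : W) (s : S) :
    Pos 𝔥 (𝔥.rep cs w (𝔥.coroot s)) ∨ Pos 𝔥 (-𝔥.rep cs w (𝔥.coroot s)) := by
  rcases (cs.length_mul_simple_ne w s).lt_or_gt with h | h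
  · exact Or.inr (Pos.neg_of_lt_length cs 𝔥 w s h)
  · exact Or.inl (Pos.of_length_lt cs 𝔥 w s h)

/-- The representation is reflection faithful: the only elements of `W` that differ from the
identity by an operator of rank at most one are the identity and the reflections. -/
theorem eq_one_or_isReflection_of_rank_one [FiniteDimensional ℝ V] (w : W) (φ : V → ℝ) (γ : V)
    (hw : ∀ v, 𝔥.rep cs w v = v - φ v • γ) : w = 1 ∨ cs.IsReflection w := by
  induction hn : cs.length w using Nat.strong_induction_on generalizing w φ γ with
  | _ n ih =>
  subst hn
  by_cases hw1 : w = 1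
  · exact Or.inl hw1
  right
  by_cases hγ : γ = 0
  · exact absurd (eq_one_of_rep cs 𝔥 w fun v => by rw [hw, hγ, smul_zero, sub_zero]) hw1
  have hc : 𝔥.rep cs w γ = (1 - φ γ) • γ := by rw [hw]; module
  have hc0 : 1 - φ γ ≠ 0 := by
    intro h
    rw [h, zero_smul, LinearEquiv.map_eq_zero_iff] at hc
    exact hγ hc
  -- the square of `w` has a positive eigenvalue on the line of `γ`
  have hw2 : w * w = 1 := by
    refine eq_one_of_rank_one cs 𝔥 (w * w) (fun v => φ v * (2 - φ γ)) γ (fun v => ?_)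
      ((1 - φ γ) ^ 2) (by positivity) ?_
    · rw [rep_mul_apply, hw v, map_sub, map_smul, hc, hw v]; module
    · rw [rep_mul_apply, hc, map_smul, hc]; module
  have hwi : w⁻¹ = w := inv_eq_of_mul_eq_one_left hw2
  obtain ⟨s, hs⟩ := cs.exists_rightDescent_of_ne_one hw1
  have hneg := Pos.neg_of_lt_length cs 𝔥 w s hs
  by_cases hk : ∃ k : ℝ, 𝔥.rep cs w (𝔥.coroot s) = k • 𝔥.coroot s
  -- if `γ` is proportional to the coroot of the descent `s`, then `w s = 1`
  · obtain ⟨k, hk⟩ := hk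
    have hk0 : k < 0 := by
      by_contra h
      have h1 := (Pos.coroot (𝔥 := 𝔥) s).smul (not_lt.mp h)
      rw [← hk] at h1
      have := h1.eq_zero_of_neg hneg
      rw [LinearEquiv.map_eq_zero_iff] at this
      exact coroot_ne_zero 𝔥 s this
    have hφ : φ (𝔥.coroot s) ≠ 0 := by
      intro h
      have h1 := hw (𝔥.coroot s)
      rw [h, zero_smul, sub_zero] at h1
      rw [h1] at hneg
      exact coroot_ne_zero 𝔥 s ((Pos.coroot s).eq_zero_of_neg hneg)
    have hγs : γ = ((1 - k) / φ (𝔥.coroot s)) • 𝔥.coroot s := by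
      have h1 := hw (𝔥.coroot s)
      rw [hk] at h1
      have h2 : φ (𝔥.coroot s) • γ = (1 - k) • 𝔥.coroot s := by
        rw [sub_smul, h1]; module
      rw [div_eq_inv_mul, mul_smul, ← h2, inv_smul_smul₀ hφ]
    have h1 : w * cs.simple s = 1 := by
      refine eq_one_of_rank_one cs 𝔥 _
        (fun v => φ v * ((1 - k) / φ (𝔥.coroot s)) + 𝔥.root s v * k) (𝔥.coroot s) (fun v => ?_)
        (-k) (by linarith) ?_
      · rw [rep_mul_apply, rep_simple_apply, map_sub, map_smul, hk, hw v]
        conv_lhs => rw [hγs]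
        module
      · rw [rep_mul_apply, rep_simple_coroot_self, map_neg, hk, neg_smul]
    rw [eq_inv_of_mul_eq_one_left h1, cs.inv_simple]
    exact cs.isReflection_simple s
  · -- otherwise conjugation by `s` makes `w` shorter
    have hlt : cs.length (cs.simple s * w * cs.simple s) < cs.length w := by
      have h0 : cs.length (cs.simple s * w) = cs.length (w * cs.simple s) := by
        rw [← cs.length_inv (w * cs.simple s), mul_inv_rev, hwi, cs.inv_simple]
      by_contra hcon
      have h1 : cs.length (cs.simple s * w) < cs.length (cs.simple s * w * cs.simple s) := by
        have : cs.length (w * cs.simple s) < cs.length w := hs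
        omega
      have h2 := Pos.of_length_lt cs 𝔥 _ s h1
      rw [rep_mul_apply, ← neg_neg (𝔥.rep cs w (𝔥.coroot s)), map_neg] at h2
      obtain ⟨k, hk'⟩ := hneg.eq_smul_coroot cs h2
      exact hk ⟨-k, by rw [neg_smul, ← hk', neg_neg]⟩
    have hrank : ∀ v, 𝔥.rep cs (cs.simple s * w * cs.simple s) v =
        v - φ (𝔥.rep cs (cs.simple s) v) • 𝔥.rep cs (cs.simple s) γ := fun v => by
      rw [rep_mul_apply, rep_mul_apply, hw, map_sub, map_smul, ← rep_mul_apply,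
        cs.simple_mul_simple_self, rep_one_apply]
    rcases ih _ hlt _ _ _ hrank rfl with h | h
    · refine absurd ?_ hw1
      have h1 : w = cs.simple s * (cs.simple s * w * cs.simple s) * cs.simple s := by
        simp [mul_assoc]
      rw [h1, h, mul_one, cs.simple_mul_simple_self]
    · have := h.conj (cs.simple s)
      rwa [cs.inv_simple, ← mul_assoc, ← mul_assoc, cs.simple_mul_simple_self, one_mul, mul_assoc,
        cs.simple_mul_simple_self, mul_one] at this

theorem rep_conj_apply (w : W) (s : S) (v : V) : 𝔥.rep cs (w * cs.simple s * w⁻¹) v =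
    v - 𝔥.root s (𝔥.rep cs w⁻¹ v) • 𝔥.rep cs w (𝔥.coroot s) := by
  rw [rep_mul_apply, rep_mul_apply, rep_simple_apply, map_sub, map_smul, rep_self_apply_inv]

theorem rep_conj_apply_self (w : W) (s : S) :
    𝔥.rep cs (w * cs.simple s * w⁻¹) (𝔥.rep cs w (𝔥.coroot s)) = -𝔥.rep cs w (𝔥.coroot s) := by
  rw [rep_mul_apply, rep_inv_apply_self, rep_mul_apply, rep_simple_coroot_self, map_neg]

/-- Reflections with proportional coroots are equal: their product is unipotent. -/
theorem reflection_eq_of_coroot_eq_smul [FiniteDimensional ℝ V] (w w' : W) (s s' : S) (k : ℝ)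
    (h : 𝔥.rep cs w (𝔥.coroot s) = k • 𝔥.rep cs w' (𝔥.coroot s')) :
    w * cs.simple s * w⁻¹ = w' * cs.simple s' * w'⁻¹ := by
  set r := w * cs.simple s * w⁻¹ with hr
  set r' := w' * cs.simple s' * w'⁻¹ with hr'
  set δ := 𝔥.rep cs w' (𝔥.coroot s')
  have hδ : 𝔥.rep cs r δ = -δ := by
    have h1 := rep_conj_apply_self cs 𝔥 w s
    have hk : k ≠ 0 := by
      rintro rfl
      rw [zero_smul, LinearEquiv.map_eq_zero_iff] at h
      exact coroot_ne_zero 𝔥 s h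
    rw [h, map_smul, ← smul_neg] at h1
    exact smul_right_injective _ hk h1
  have h1 : r * r' = 1 := by
    refine eq_one_of_rank_one cs 𝔥 _ (fun v => 𝔥.root s (𝔥.rep cs w⁻¹ v) * k -
      𝔥.root s' (𝔥.rep cs w'⁻¹ v)) δ (fun v => ?_) 1 one_pos ?_
    · rw [rep_mul_apply, rep_conj_apply cs 𝔥 w' s', map_sub, map_smul, hδ, rep_conj_apply, h]
      module
    · rw [rep_mul_apply, rep_conj_apply_self, map_neg, hδ, neg_neg, one_smul]
  rw [eq_inv_of_mul_eq_one_left h1, hr']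
  simp [mul_assoc]

/-- A reflection whose positive coroot becomes negative under `x⁻¹` shortens `x`. -/
theorem length_mul_lt_of_pos [FiniteDimensional ℝ V] (w x : W) (s : S)
    (h1 : Pos 𝔥 (𝔥.rep cs w (𝔥.coroot s))) (h2 : Pos 𝔥 (-𝔥.rep cs (x⁻¹ * w) (𝔥.coroot s))) :
    cs.length (w * cs.simple s * w⁻¹ * x) < cs.length x := by
  induction hn : cs.length x using Nat.strong_induction_on generalizing x w with
  | _ n ih =>
  subst hn
  by_cases hx : x = 1
  · subst hx
    rw [inv_one, one_mul] at h2
    have := h1.eq_zero_of_neg h2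
    rw [LinearEquiv.map_eq_zero_iff] at this
    exact absurd this (coroot_ne_zero 𝔥 s)
  obtain ⟨t, ht⟩ := cs.exists_leftDescent_of_ne_one hx
  rcases pos_or_neg cs 𝔥 (cs.simple t * w) s with h | h
  · have h3 := ih _ ht (cs.simple t * w) (cs.simple t * x) h
      (by rwa [mul_inv_rev, cs.inv_simple, mul_assoc, cs.simple_mul_simple_cancel_left]) rfl
    have e : w * cs.simple s * w⁻¹ * x = cs.simple t *
        (cs.simple t * w * cs.simple s * (cs.simple t * w)⁻¹ * (cs.simple t * x)) := by
      simp [mul_assoc]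
    rw [e]
    rw [CoxeterSystem.isLeftDescent_iff] at ht
    rcases cs.length_simple_mul
      (cs.simple t * w * cs.simple s * (cs.simple t * w)⁻¹ * (cs.simple t * x)) t with h' | h' <;>
    omega
  · rw [rep_mul_apply] at h
    obtain ⟨k, hk⟩ := h1.eq_smul_coroot cs h
    have := reflection_eq_of_coroot_eq_smul cs 𝔥 w 1 s t k (by rwa [rep_one_apply])
    rw [this, one_mul, inv_one, mul_one]
    exact ht

/-- If a reflection `r` shortens `x`, then it shortens `x s`, unless `r x = x s`: the simple
reflection `s` changes the sign of `α_s^∨` and its multiples only. -/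
theorem length_reflection_mul_lt [FiniteDimensional ℝ V] (𝔥 : PreRealisation M V) {r x : W} {s : S}
    (hr : cs.IsReflection r) (h : cs.length (r * x) < cs.length x) (hne : r * x ≠ x * cs.simple s) :
    cs.length (r * (x * cs.simple s)) < cs.length (x * cs.simple s) := by
  obtain ⟨w, s', hws, hpos⟩ : ∃ w s', r = w * cs.simple s' * w⁻¹ ∧
      Pos 𝔥 (𝔥.rep cs w (𝔥.coroot s')) := by
    obtain ⟨w, s', rfl⟩ := hr
    rcases pos_or_neg cs 𝔥 w s' with h | h
    · exact ⟨w, s', rfl, h⟩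
    · refine ⟨w * cs.simple s', s', by simp [mul_assoc], ?_⟩
      rwa [rep_mul_apply, rep_simple_coroot_self, map_neg]
  subst hws
  have hneg : Pos 𝔥 (-𝔥.rep cs (x⁻¹ * w) (𝔥.coroot s')) := by
    refine (pos_or_neg cs 𝔥 (x⁻¹ * w) s').resolve_left fun h' => ?_
    have := length_mul_lt_of_pos cs 𝔥 w (w * cs.simple s' * w⁻¹ * x) s' hpos (by
      rw [mul_inv_rev, mul_assoc, rep_mul_apply, show (w * cs.simple s' * w⁻¹)⁻¹ * w =
        (w * cs.simple s' * w⁻¹) * w by simp [mul_assoc], rep_mul_apply, rep_conj_apply_self,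
        map_neg, neg_neg, ← rep_mul_apply]
      exact h')
    rw [← mul_assoc, show w * cs.simple s' * w⁻¹ * (w * cs.simple s' * w⁻¹) = 1 by
      simp [mul_assoc], one_mul] at this
    omega
  refine length_mul_lt_of_pos cs 𝔥 w (x * cs.simple s) s' hpos ?_
  rw [mul_inv_rev, cs.inv_simple, mul_assoc]
  refine (pos_or_neg cs 𝔥 (cs.simple s * (x⁻¹ * w)) s').resolve_left fun h' => hne ?_
  rw [rep_mul_apply, ← neg_neg (𝔥.rep cs (x⁻¹ * w) (𝔥.coroot s')), map_neg] at h'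
  obtain ⟨k, hk⟩ := hneg.eq_smul_coroot cs h'
  have := reflection_eq_of_coroot_eq_smul cs 𝔥 w x s' s (-k) (by
    rw [← rep_self_apply_inv cs 𝔥 x (𝔥.rep cs w (𝔥.coroot s')), ← rep_mul_apply cs 𝔥 x⁻¹ w,
      neg_smul, ← map_smul, ← hk, map_neg, neg_neg])
  rw [this]
  simp [mul_assoc]

/-- Reflections with proportional roots are equal: their product differs from the identity by an
operator of rank one, but its length is even. -/
theorem reflection_eq_of_root_eq_smul [FiniteDimensional ℝ V] (w w' : W) (s s' : S) (k : ℝ)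
    (h : ∀ v, 𝔥.root s (𝔥.rep cs w⁻¹ v) = k * 𝔥.root s' (𝔥.rep cs w'⁻¹ v)) :
    w * cs.simple s * w⁻¹ = w' * cs.simple s' * w'⁻¹ := by
  have h1 : ∀ v, 𝔥.rep cs (w * cs.simple s * w⁻¹ * (w' * cs.simple s' * w'⁻¹)) v =
      v - 𝔥.root s' (𝔥.rep cs w'⁻¹ v) •
        (𝔥.rep cs w' (𝔥.coroot s') - k • 𝔥.rep cs w (𝔥.coroot s)) := fun v => by
    rw [rep_mul_apply, rep_conj_apply, h, rep_conj_apply cs 𝔥 w', map_sub, map_smul,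
      rep_inv_apply_self, map_sub, map_smul, 𝔥.root_coroot_self, smul_eq_mul]
    module
  rcases eq_one_or_isReflection_of_rank_one cs 𝔥 _ _ _ h1 with h2 | h2
  · rw [eq_inv_of_mul_eq_one_left h2]
    simp [mul_assoc]
  · exfalso
    have o1 := h2.odd_length
    have o2 := ((cs.isReflection_simple s).conj w).odd_length
    have o3 := ((cs.isReflection_simple s').conj w').odd_length
    have := cs.length_mul_mod_two (w * cs.simple s * w⁻¹) (w' * cs.simple s' * w'⁻¹)
    rw [Nat.odd_iff] at o1 o2 o3
    omega

end Reflections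

/-! ### The action on linear forms -/

section Dual

variable {S : Type*} {M : CoxeterMatrix S} {V : Type u} [AddCommGroup V] [Module ℝ V]
variable {W : Type*} [Group W] (cs : CoxeterSystem M W) (𝔥 : Realisation M V)

theorem dualAct_apply (x : W) (l : Module.Dual ℝ V) (v : V) :
    dualAct cs 𝔥 x l v = l (𝔥.rep cs x⁻¹ v) := rfl

theorem dualAct_mul (x y : W) (l : Module.Dual ℝ V) :
    dualAct cs 𝔥 (x * y) l = dualAct cs 𝔥 x (dualAct cs 𝔥 y l) := by
  ext v
  rw [dualAct_apply, dualAct_apply, dualAct_apply, mul_inv_rev, rep_mul_apply]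

theorem dualAct_one (l : Module.Dual ℝ V) : dualAct cs 𝔥 1 l = l := by
  ext v
  rw [dualAct_apply, inv_one, rep_one_apply]

theorem dualAct_simple (s : S) (l : Module.Dual ℝ V) :
    dualAct cs 𝔥 (cs.simple s) l = l - l (𝔥.coroot s) • 𝔥.root s := by
  ext v
  rw [dualAct_apply, cs.inv_simple, rep_simple_apply, map_sub, map_smul, LinearMap.sub_apply,
    LinearMap.smul_apply, smul_eq_mul, smul_eq_mul, mul_comm]

theorem dualAct_simple_root (s : S) : dualAct cs 𝔥 (cs.simple s) (𝔥.root s) = -𝔥.root s := by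
  rw [dualAct_simple, 𝔥.root_coroot_self]; module

theorem dualAct_root_ne_zero (w : W) (s : S) : dualAct cs 𝔥 w (𝔥.root s) ≠ 0 := by
  intro h
  have : dualAct cs 𝔥 w⁻¹ (dualAct cs 𝔥 w (𝔥.root s)) = 0 := by rw [h, map_zero]
  rw [← dualAct_mul, inv_mul_cancel, dualAct_one] at this
  exact 𝔥.linearIndependent_root.ne_zero s this

/-- The twisted graphs of different elements are different. -/
theorem exists_dualAct_ne [FiniteDimensional ℝ V] {x z : W} (h : x ≠ z) :
    ∃ l, dualAct cs 𝔥 x l ≠ dualAct cs 𝔥 z l := by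
  by_contra! hcon
  refine h ?_
  have : x⁻¹ * z = 1 := by
    refine eq_one_of_rep cs 𝔥.toPreRealisation _ fun v => ?_
    rw [← sub_eq_zero, ← Module.forall_dual_apply_eq_zero_iff ℝ]
    intro l
    have := LinearMap.congr_fun (hcon l) (𝔥.rep cs z v)
    rw [dualAct_apply, dualAct_apply, rep_inv_apply_self] at this
    rw [map_sub, rep_mul_apply, this, sub_self]
  exact (inv_mul_eq_one.mp this)

/-- If `x ≠ z` are not related by a reflection, then `Gr_x ∩ Gr_z` has codimension at least two in
`Gr_x`: two linearly independent forms vanish on it. -/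
theorem exists_linearIndependent_dualAct_sub [FiniteDimensional ℝ V] {x z : W} (h : x ≠ z)
    (h' : ∀ r, cs.IsReflection r → z ≠ r * x) :
    ∃ l₁ l₂, LinearIndependent ℝ ![dualAct cs 𝔥 x l₁ - dualAct cs 𝔥 z l₁,
      dualAct cs 𝔥 x l₂ - dualAct cs 𝔥 z l₂] := by
  by_contra! hcon
  obtain ⟨l₀, h₀⟩ := exists_dualAct_ne cs 𝔥 h
  rw [← sub_ne_zero] at h₀
  have key : ∀ l, ∃ a : ℝ, a • (dualAct cs 𝔥 x l₀ - dualAct cs 𝔥 z l₀) =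
      dualAct cs 𝔥 x l - dualAct cs 𝔥 z l := by
    intro l
    have := hcon l₀ l
    rw [LinearIndependent.pair_iff' h₀] at this
    push Not at this
    exact this
  obtain ⟨v₁, hv₁⟩ : ∃ v, (dualAct cs 𝔥 x l₀ - dualAct cs 𝔥 z l₀) v ≠ 0 := by
    by_contra! hv
    exact h₀ (LinearMap.ext hv)
  set f := dualAct cs 𝔥 x l₀ - dualAct cs 𝔥 z l₀ with hf
  have hrank : ∀ u, 𝔥.rep cs (x⁻¹ * z) u = u - (f (𝔥.rep cs z u) / f v₁) •
      (𝔥.rep cs z⁻¹ v₁ - 𝔥.rep cs x⁻¹ v₁) := by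
    intro u
    rw [← sub_eq_zero, ← Module.forall_dual_apply_eq_zero_iff ℝ]
    intro l
    obtain ⟨a, ha⟩ := key l
    have h1 := LinearMap.congr_fun ha (𝔥.rep cs z u)
    have h2 := LinearMap.congr_fun ha v₁
    simp only [LinearMap.smul_apply, LinearMap.sub_apply, dualAct_apply, smul_eq_mul,
      rep_inv_apply_self] at h1 h2
    rw [map_sub, map_sub, map_smul, map_sub, rep_mul_apply, smul_eq_mul,
      show l (𝔥.rep cs z⁻¹ v₁) - l (𝔥.rep cs x⁻¹ v₁) = -(a * f v₁) by rw [h2]; ring,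
      show l (𝔥.rep cs x⁻¹ (𝔥.rep cs z u)) = a * f (𝔥.rep cs z u) + l u by rw [h1]; ring]
    field_simp
    ring
  rcases eq_one_or_isReflection_of_rank_one cs 𝔥.toPreRealisation _ _ _ hrank with h1 | h1
  · exact h (inv_mul_eq_one.mp h1)
  · exact h' _ (h1.conj x) (by group)

/-- Roots of different reflections are not proportional. -/
theorem dualAct_root_ne_smul [FiniteDimensional ℝ V] {w w' : W} {s s' : S}
    (h : w * cs.simple s * w⁻¹ ≠ w' * cs.simple s' * w'⁻¹) (k : ℝ) :
    dualAct cs 𝔥 w (𝔥.root s) ≠ k • dualAct cs 𝔥 w' (𝔥.root s') := fun hk =>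
  h (reflection_eq_of_root_eq_smul cs 𝔥.toPreRealisation w w' s s' k fun v =>
    LinearMap.congr_fun hk v)

end Dual

/-! ### Linear forms in the ring of polynomial functions -/

section PolynomialRing

variable {V : Type u} [AddCommGroup V] [Module ℝ V]

/-- The inclusion of the linear forms into `R`. -/
abbrev lf : Module.Dual ℝ V →ₗ[ℝ] R V := SymmetricAlgebra.ι ℝ (Module.Dual ℝ V)

/-- Evaluation of a polynomial function at a point. -/
def evalAt (v : V) : R V →ₐ[ℝ] ℝ := SymmetricAlgebra.lift (Module.Dual.eval ℝ V v)

theorem evalAt_lf (v : V) (l : Module.Dual ℝ V) : evalAt v (lf l) = l v := by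
  rw [evalAt, SymmetricAlgebra.lift_ι_apply]; rfl

/-- The value at the origin together with the derivative there in direction `v`, as a homomorphism
to the dual numbers. -/
def jetAt (v : V) : R V →ₐ[ℝ] TrivSqZeroExt ℝ ℝ :=
  SymmetricAlgebra.lift (TrivSqZeroExt.inrHom ℝ ℝ ∘ₗ Module.Dual.eval ℝ V v)

theorem jetAt_lf (v : V) (l : Module.Dual ℝ V) : jetAt v (lf l) = TrivSqZeroExt.inr (l v) := by
  rw [jetAt, SymmetricAlgebra.lift_ι_apply]; rfl

variable (V) in
/-- The ideal of polynomial functions that vanish at the origin. -/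
def augIdeal : Ideal (R V) :=
  RingHom.ker (SymmetricAlgebra.algebraMapInv (R := ℝ) (M := Module.Dual ℝ V))

theorem lf_mem_augIdeal (l : Module.Dual ℝ V) : lf l ∈ augIdeal V :=
  SymmetricAlgebra.algebraMapInv_ι l

theorem sub_algebraMap_mem_augIdeal (f : R V) :
    f - algebraMap ℝ (R V) (SymmetricAlgebra.algebraMapInv f) ∈ augIdeal V := by
  rw [augIdeal, RingHom.mem_ker, map_sub, sub_eq_zero]
  exact (SymmetricAlgebra.algebraMap_leftInverse _ _).symm

theorem fst_jetAt {f : R V} (hf : f ∈ augIdeal V) (v : V) : (jetAt v f).fst = 0 := by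
  have : (TrivSqZeroExt.fstHom ℝ ℝ ℝ).comp (jetAt v) = SymmetricAlgebra.algebraMapInv := by
    refine SymmetricAlgebra.algHom_ext ?_
    ext l
    change (jetAt v (lf l)).fst = _
    rw [jetAt_lf, TrivSqZeroExt.fst_inr]
    exact (SymmetricAlgebra.algebraMapInv_ι l).symm
  exact (DFunLike.congr_fun this f).trans hf

/-- A nonzero linear form does not lie in the square of the ideal of the origin. -/
theorem eq_zero_of_lf_mem {l : Module.Dual ℝ V} (h : lf l ∈ augIdeal V * augIdeal V) : l = 0 := by
  ext v
  have : ∀ f ∈ augIdeal V * augIdeal V, jetAt v f = 0 := by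
    intro f hf
    induction hf using Submodule.mul_induction_on' with
    | mem_mul_mem a ha b hb =>
      rw [map_mul]
      ext
      · simp [fst_jetAt ha]
      · simp [fst_jetAt ha, fst_jetAt hb]
    | add a _ b _ ha hb => rw [map_add, ha, hb, add_zero]
  have h1 := this _ h
  rw [jetAt_lf] at h1
  simpa using congrArg TrivSqZeroExt.snd h1

/-- A linear form divides only its scalar multiples among the linear forms. -/
theorem exists_smul_eq_of_lf_dvd {β γ : Module.Dual ℝ V} (h : lf β ∣ lf γ) :
    ∃ k : ℝ, γ = k • β := by
  obtain ⟨f, hf⟩ := h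
  by_cases hβ : ∃ v, β v ≠ 0
  · obtain ⟨v, hv⟩ := hβ
    refine ⟨γ v / β v, ?_⟩
    ext w
    have h1 := congrArg (evalAt (w - (β w / β v) • v)) hf
    rw [map_mul, evalAt_lf, evalAt_lf, map_sub, map_sub, map_smul, map_smul, smul_eq_mul,
      smul_eq_mul, div_mul_cancel₀ _ hv, sub_self, zero_mul] at h1
    rw [LinearMap.smul_apply, smul_eq_mul, ← sub_eq_zero, ← h1]
    ring
  · push Not at hβ
    refine ⟨0, ?_⟩
    ext w
    have h1 := congrArg (evalAt w) hf
    rw [map_mul, evalAt_lf, evalAt_lf, hβ, zero_mul] at h1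
    rw [h1, zero_smul]; rfl

instance : IsDomain (R V) :=
  (SymmetricAlgebra.equivMvPolynomial
    (Module.Basis.ofVectorSpace ℝ (Module.Dual ℝ V))).toMulEquiv.isDomain _

theorem prime_lf {l : Module.Dual ℝ V} (hl : l ≠ 0) : Prime (lf l) := by
  have hs : LinearIndepOn ℝ id ({l} : Set (Module.Dual ℝ V)) := LinearIndepOn.singleton hl
  have hmem : l ∈ hs.extend (Set.subset_univ _) := hs.subset_extend _ rfl
  let b := Module.Basis.extend hs
  have hb : b ⟨l, hmem⟩ = l := Module.Basis.extend_apply_self hs _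
  have := (MulEquiv.prime_iff (SymmetricAlgebra.equivMvPolynomial b).toMulEquiv (p := lf l)).symm
  rw [this]
  have hX := SymmetricAlgebra.equivMvPolynomial_ι_apply b ⟨l, hmem⟩
  rw [hb] at hX
  exact hX ▸ MvPolynomial.X_prime

theorem lf_ne_zero {l : Module.Dual ℝ V} (hl : l ≠ 0) : lf l ≠ 0 := (prime_lf hl).ne_zero

theorem not_lf_dvd_one {l : Module.Dual ℝ V} (hl : l ≠ 0) : ¬ lf l ∣ 1 :=
  (prime_lf hl).not_dvd_one

/-- Linearly independent linear forms are coprime. -/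
theorem lf_dvd_of_mul_eq {l₁ l₂ : Module.Dual ℝ V} (h : LinearIndependent ℝ ![l₁, l₂])
    {a b : R V} (hab : lf l₂ * a = lf l₁ * b) : lf l₁ ∣ a := by
  have h1 : l₁ ≠ 0 := h.ne_zero 0
  refine ((prime_lf h1).dvd_or_dvd
    (hab ▸ dvd_mul_right _ _ : lf l₁ ∣ lf l₂ * a)).resolve_left fun hd => ?_
  obtain ⟨k, hk⟩ := exists_smul_eq_of_lf_dvd hd
  exact (LinearIndependent.pair_iff' h1).mp h k hk.symm

end PolynomialRing

/-! ### Projective modules -/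

section Projective

variable {A : Type*} [CommRing A] {N : Type*} [AddCommGroup N] [Module A N]

/-- In a projective module one can divide as in the ring, because the coordinates of an element can
be divided. -/
theorem exists_eq_smul_of_projective [Module.Projective A N] {p q : A}
    (hpq : ∀ a b : A, q * a = p * b → p ∣ a) {m n : N} (h : q • m = p • n) :
    ∃ c : N, m = p • c := by
  obtain ⟨σ, hσ⟩ := Module.projective_def'.mp ‹Module.Projective A N›
  have hd : ∀ i, p ∣ σ m i := fun i => by
    refine hpq _ (σ n i) ?_
    have := DFunLike.congr_fun (congrArg σ h) i
    simpa using this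
  choose d hd using hd
  refine ⟨∑ i ∈ (σ m).support, d i • i, ?_⟩
  conv_lhs => rw [← LinearMap.id_apply (R := A) m, ← hσ, LinearMap.comp_apply,
    Finsupp.linearCombination_apply, Finsupp.sum]
  rw [Finset.smul_sum]
  refine Finset.sum_congr rfl fun i _ => ?_
  rw [hd, mul_smul]; rfl

theorem smul_eq_zero_of_projective [IsDomain A] [Module.Projective A N] {p : A} (hp : p ≠ 0) {m : N}
    (h : p • m = 0) : m = 0 := by
  obtain ⟨σ, hσ⟩ := Module.projective_def'.mp ‹Module.Projective A N›
  have h1 : p • σ m = 0 := by rw [← map_smul, h, map_zero]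
  have h2 : σ m = 0 := by
    ext i
    have := DFunLike.congr_fun h1 i
    simpa [hp] using this
  rw [← LinearMap.id_apply (R := A) m, ← hσ, LinearMap.comp_apply, h2, map_zero]

theorem projective_of_retract {N' : Type*} [AddCommGroup N'] [Module A N'] [Module.Projective A N]
    (i : N' →ₗ[A] N) (p : N →ₗ[A] N') (h : ∀ x, p (i x) = x) : Module.Projective A N' :=
  Module.Projective.of_split i p (LinearMap.ext h)

/-- The kernel of a surjection between projective modules is projective. -/
theorem projective_ker {N' : Type*} [AddCommGroup N'] [Module A N'] [Module.Projective A N]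
    [Module.Projective A N'] (f : N →ₗ[A] N') (hf : Function.Surjective f) :
    Module.Projective A (LinearMap.ker f) := by
  obtain ⟨g, hg⟩ := Module.projective_lifting_property f LinearMap.id hf
  have hg' : ∀ x, f (g x) = x := fun x => LinearMap.congr_fun hg x
  refine projective_of_retract (N := N) (LinearMap.ker f).subtype
    ((LinearMap.id - g ∘ₗ f).codRestrict (LinearMap.ker f) fun x => by simp [hg'])
    fun x => Subtype.ext ?_
  change (x : N) - g (f x) = x
  rw [LinearMap.mem_ker.mp x.2, map_zero, sub_zero]

/-- An extension of projective modules is projective. -/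
theorem projective_of_ker {N' : Type*} [AddCommGroup N'] [Module A N']
    [Module.Projective A N'] (f : N →ₗ[A] N') (hf : Function.Surjective f)
    [Module.Projective A (LinearMap.ker f)] : Module.Projective A N := by
  obtain ⟨g, hg⟩ := Module.projective_lifting_property f LinearMap.id hf
  have hg' : ∀ x, f (g x) = x := fun x => LinearMap.congr_fun hg x
  refine projective_of_retract (N := LinearMap.ker f × N')
    (((LinearMap.id - g ∘ₗ f).codRestrict (LinearMap.ker f) fun x => by simp [hg']).prod f)
    ((LinearMap.ker f).subtype.coprod g) fun x => ?_
  simp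

end Projective

/-! ### The group action on polynomial functions -/

section Twist

variable {S : Type*} {M : CoxeterMatrix S} {V : Type u} [AddCommGroup V] [Module ℝ V]
variable {W : Type*} [Group W] (cs : CoxeterSystem M W) (𝔥 : Realisation M V)

theorem act_lf (x : W) (l : Module.Dual ℝ V) : act cs 𝔥 x (lf l) = lf (dualAct cs 𝔥 x l) :=
  SymmetricAlgebra.lift_ι_apply _ _

theorem act_mul (x y : W) (f : R V) : act cs 𝔥 (x * y) f = act cs 𝔥 x (act cs 𝔥 y f) := by
  have : act cs 𝔥 (x * y) = (act cs 𝔥 x).comp (act cs 𝔥 y) := by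
    refine SymmetricAlgebra.algHom_ext (LinearMap.ext fun l => ?_)
    change act cs 𝔥 (x * y) (lf l) = act cs 𝔥 x (act cs 𝔥 y (lf l))
    rw [act_lf, act_lf, act_lf, dualAct_mul]
  exact DFunLike.congr_fun this f

theorem act_one (f : R V) : act cs 𝔥 1 f = f := by
  have : act cs 𝔥 1 = AlgHom.id ℝ (R V) := by
    refine SymmetricAlgebra.algHom_ext (LinearMap.ext fun l => ?_)
    change act cs 𝔥 1 (lf l) = lf l
    rw [act_lf, dualAct_one]
  exact DFunLike.congr_fun this f

theorem restrictGr_inl (x : W) (f : R V) : restrictGr cs 𝔥 x (inl V f) = f := RRlift_inl _ _ _ _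

theorem restrictGr_inr (x : W) (f : R V) : restrictGr cs 𝔥 x (inr V f) = act cs 𝔥 x f :=
  RRlift_inr _ _ _ _

/-- The automorphism `f ⊗ g ↦ f ⊗ w(g)` of `R ⊗ R`. -/
def twist (w : W) : RR V →ₐ[ℝ] RR V := RRlift V (inl V) ((inr V).comp (act cs 𝔥 w))

theorem twist_inl (w : W) (f : R V) : twist cs 𝔥 w (inl V f) = inl V f := RRlift_inl _ _ _ _

theorem twist_inr (w : W) (f : R V) : twist cs 𝔥 w (inr V f) = inr V (act cs 𝔥 w f) :=
  RRlift_inr _ _ _ _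

theorem algHom_RR_ext {A : Type*} [Semiring A] [Algebra ℝ A] {φ ψ : RR V →ₐ[ℝ] A}
    (h1 : ∀ f, φ (inl V f) = ψ (inl V f)) (h2 : ∀ f, φ (inr V f) = ψ (inr V f)) (t : RR V) :
    φ t = ψ t := by
  induction t using RR_induction V with
  | h0 => rw [map_zero, map_zero]
  | hadd a b ha hb => rw [map_add, map_add, ha, hb]
  | hmul f g => rw [map_mul, map_mul, h1, h2]

theorem restrictGr_twist (x w : W) (t : RR V) :
    restrictGr cs 𝔥 x (twist cs 𝔥 w t) = restrictGr cs 𝔥 (x * w) t := by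
  refine algHom_RR_ext (φ := (restrictGr cs 𝔥 x).comp (twist cs 𝔥 w)) (fun f => ?_) (fun f => ?_) t
  · rw [AlgHom.comp_apply, twist_inl, restrictGr_inl, restrictGr_inl]
  · rw [AlgHom.comp_apply, twist_inr, restrictGr_inr, restrictGr_inr, act_mul]

theorem twist_mul (w w' : W) (t : RR V) :
    twist cs 𝔥 (w * w') t = twist cs 𝔥 w (twist cs 𝔥 w' t) := by
  refine algHom_RR_ext (ψ := (twist cs 𝔥 w).comp (twist cs 𝔥 w')) (fun f => ?_) (fun f => ?_) t
  · rw [AlgHom.comp_apply, twist_inl, twist_inl, twist_inl]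
  · rw [AlgHom.comp_apply, twist_inr, twist_inr, twist_inr, act_mul]

theorem twist_one (t : RR V) : twist cs 𝔥 1 t = t := by
  refine algHom_RR_ext (ψ := AlgHom.id ℝ _) (fun f => ?_) (fun f => ?_) t
  · rw [twist_inl]; rfl
  · rw [twist_inr, act_one]; rfl

/-- Every polynomial is of the form `a + b α_s` with `s`-invariant `a` and `b`. -/
theorem exists_invariants (s : S) (f : R V) : ∃ a ∈ invariants cs 𝔥 s, ∃ b ∈ invariants cs 𝔥 s,
    f = a + b * lf (𝔥.root s) := by
  induction f using SymmetricAlgebra.induction with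
  | algebraMap c => exact ⟨_, Subalgebra.algebraMap_mem _ c, 0, Subalgebra.zero_mem _, by simp⟩
  | ι l =>
    refine ⟨lf (l - (1 / 2 * l (𝔥.coroot s)) • 𝔥.root s), ?_,
      algebraMap ℝ _ (1 / 2 * l (𝔥.coroot s)), Subalgebra.algebraMap_mem _ _, ?_⟩
    · change act cs 𝔥 (cs.simple s) _ = lf _
      rw [act_lf, dualAct_simple]
      congr 1
      rw [LinearMap.sub_apply, LinearMap.smul_apply, 𝔥.root_coroot_self, smul_eq_mul]
      module
    · rw [← Algebra.smul_def, map_sub, map_smul, sub_add_cancel]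
  | mul f g hf hg =>
    obtain ⟨a, ha, b, hb, rfl⟩ := hf
    obtain ⟨c, hc, d, hd, rfl⟩ := hg
    have h2 : lf (𝔥.root s) * lf (𝔥.root s) ∈ invariants cs 𝔥 s := by
      change act cs 𝔥 (cs.simple s) _ = lf _ * lf _
      rw [map_mul, act_lf, dualAct_simple_root, map_neg, neg_mul_neg]
    refine ⟨a * c + b * d * (lf (𝔥.root s) * lf (𝔥.root s)), ?_, a * d + b * c, ?_, by ring⟩
    · exact Subalgebra.add_mem _ (Subalgebra.mul_mem _ ha hc)
        (Subalgebra.mul_mem _ (Subalgebra.mul_mem _ hb hd) h2)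
    · exact Subalgebra.add_mem _ (Subalgebra.mul_mem _ ha hd) (Subalgebra.mul_mem _ hb hc)
  | add f g hf hg =>
    obtain ⟨a, ha, b, hb, rfl⟩ := hf
    obtain ⟨c, hc, d, hd, rfl⟩ := hg
    exact ⟨_, Subalgebra.add_mem _ ha hc, _, Subalgebra.add_mem _ hb hd, by ring⟩

end Twist

/-! ### Projective quotients -/

section Quotients

variable {A B : Type*} [CommRing A] [CommRing B] [Algebra A B]
variable {N : Type*} [AddCommGroup N] [Module B N] [Module A N] [IsScalarTower A B N]

/-- Projectivity is inherited by quotients with the same kernel. -/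
theorem projective_of_surjective_of_ker {X P Q : Type*} [AddCommGroup X] [Module A X]
    [AddCommGroup P] [Module A P] [AddCommGroup Q] [Module A Q] [Module.Projective A P]
    (p : X →ₗ[A] P) (q : X →ₗ[A] Q) (hp : Function.Surjective p) (hq : Function.Surjective q)
    (h : ∀ x, p x = 0 ↔ q x = 0) : Module.Projective A Q := by
  have hk : LinearMap.ker p = LinearMap.ker q := Submodule.ext h
  exact Module.Projective.of_equiv' ((p.quotKerEquivOfSurjective hp).symm ≪≫ₗ
    Submodule.quotEquivOfEq _ _ hk ≪≫ₗ q.quotKerEquivOfSurjective hq)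

/-- The projection to a quotient by a `B`-submodule, as an `A`-linear map. -/
def mkQA (A : Type*) [CommRing A] [Algebra A B] [Module A N] [IsScalarTower A B N]
    (K : Submodule B N) : N →ₗ[A] N ⧸ K := K.mkQ.restrictScalars A

theorem mkQA_eq_zero {K : Submodule B N} {n : N} : mkQA A K n = 0 ↔ n ∈ K :=
  Submodule.Quotient.mk_eq_zero K

theorem mkQA_surjective (K : Submodule B N) : Function.Surjective (mkQA A K) := K.mkQ_surjective

/-- The kernel of `N / K → N / L` is a quotient of `L`. -/
theorem exists_ker_factor {K L : Submodule B N} (h : K ≤ L) :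
    ∃ q : L →ₗ[A] LinearMap.ker ((Submodule.factor h).restrictScalars A),
      Function.Surjective q ∧ ∀ l, q l = 0 ↔ (l : N) ∈ K := by
  refine ⟨(mkQA A K ∘ₗ L.subtype.restrictScalars A).codRestrict _ fun l => ?_, ?_, fun l => ?_⟩
  · exact (Submodule.Quotient.mk_eq_zero L).mpr l.2
  · rintro ⟨x, hx⟩
    obtain ⟨n, rfl⟩ := K.mkQ_surjective x
    exact ⟨⟨n, (Submodule.Quotient.mk_eq_zero L).mp hx⟩, rfl⟩
  · rw [Subtype.ext_iff]
    exact Submodule.Quotient.mk_eq_zero K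

/-- If `N / L` and `L / K` are projective, then so is `N / K`; here `L / K` is given as a surjection
`q` on `L` with kernel `K`. -/
theorem projective_quotient_of_le {K L : Submodule B N} (h : K ≤ L) {Q : Type*} [AddCommGroup Q]
    [Module A Q] (q : L →ₗ[A] Q) (hq : Function.Surjective q) (hK : ∀ l, q l = 0 ↔ (l : N) ∈ K)
    [Module.Projective A Q] [Module.Projective A (N ⧸ L)] : Module.Projective A (N ⧸ K) := by
  obtain ⟨p, hp, hp'⟩ := exists_ker_factor (A := A) h
  have := projective_of_surjective_of_ker q p hq hp fun l => (hK l).trans (hp' l).symm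
  exact projective_of_ker ((Submodule.factor h).restrictScalars A) (Submodule.factor_surjective h)

/-- If `N / K` and `N / L` are projective, then so is `L / K`. -/
theorem projective_of_quotient_of_le {K L : Submodule B N} (h : K ≤ L) {Q : Type*} [AddCommGroup Q]
    [Module A Q] (q : L →ₗ[A] Q) (hq : Function.Surjective q) (hK : ∀ l, q l = 0 ↔ (l : N) ∈ K)
    [Module.Projective A (N ⧸ K)] [Module.Projective A (N ⧸ L)] : Module.Projective A Q := by
  obtain ⟨p, hp, hp'⟩ := exists_ker_factor (A := A) h
  have := projective_ker ((Submodule.factor h).restrictScalars A) (Submodule.factor_surjective h)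
  exact projective_of_surjective_of_ker p q hp hq fun l => (hp' l).trans (hK l).symm

theorem prodMap_self_eq_zero {P Q : Type*} [AddCommGroup P] [AddCommGroup Q] [Module A P]
    [Module A Q] (f : P →ₗ[A] Q) (x : P × P) : f.prodMap f x = 0 ↔ f x.1 = 0 ∧ f x.2 = 0 :=
  Prod.ext_iff

theorem projective_quotient_of_prod {T : Type*} [AddCommGroup T] [Module B T] [Module A T]
    [IsScalarTower A B T] {K : Submodule B N} {L : Submodule B T} (f : N × N →ₗ[A] T)
    (hf : Function.Surjective f) (h : ∀ x, f x ∈ L ↔ x.1 ∈ K ∧ x.2 ∈ K)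
    [Module.Projective A (N ⧸ K)] : Module.Projective A (T ⧸ L) := by
  have hp : Function.Surjective
      (LinearMap.prodMap (mkQA A K) (mkQA A K) : N × N →ₗ[A] (N ⧸ K) × (N ⧸ K)) :=
    Function.Surjective.prodMap (mkQA_surjective (A := A) K) (mkQA_surjective (A := A) K)
  have hq : Function.Surjective (mkQA A L ∘ₗ f) := (mkQA_surjective (A := A) L).comp hf
  refine projective_of_surjective_of_ker _ _ hp hq fun x => ?_
  refine (prodMap_self_eq_zero _ _).trans
    (Iff.trans ?_ ((h x).symm.trans (mkQA_eq_zero (A := A)).symm))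
  exact and_congr (mkQA_eq_zero (A := A)) (mkQA_eq_zero (A := A))

end Quotients

/-! ### Sections that vanish generically on twisted graphs -/

section GenericKernel

variable {V : Type u} [AddCommGroup V] [Module ℝ V]

/-- `R ⊗ R` as an algebra over `R` through the left embedding. -/
instance algebraLeft : Algebra (R V) (RR V) := (inl V).toRingHom.toAlgebra

variable {S : Type*} {M : CoxeterMatrix S} {W : Type*} [Group W] (cs : CoxeterSystem M W)
variable (𝔥 : Realisation M V)

section Basic

variable (N : Type*) [AddCommGroup N] [Module (RR V) N]

/-- The kernel of the localisation of `N` at the generic point of `Gr_x`: the sections that vanish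
generically on `Gr_x`. -/
def genericKer (x : W) : Submodule (RR V) N where
  carrier := {n | ∃ t, restrictGr cs 𝔥 x t ≠ 0 ∧ t • n = 0}
  zero_mem' := ⟨1, by simp, smul_zero _⟩
  add_mem' := by
    rintro a b ⟨t, ht, hta⟩ ⟨t', ht', htb⟩
    refine ⟨t * t', by rw [map_mul]; exact mul_ne_zero ht ht', ?_⟩
    rw [smul_add, mul_smul, mul_smul, htb, smul_zero, smul_comm, hta, smul_zero, add_zero]
  smul_mem' := by
    rintro r n ⟨t, ht, htn⟩
    exact ⟨t, ht, by rw [smul_comm, htn, smul_zero]⟩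

/-- The sections that vanish generically on `Gr_x` for all `x ∈ Y`. -/
def genericKerOn (Y : Set W) : Submodule (RR V) N := ⨅ x ∈ Y, genericKer cs 𝔥 N x

variable {N}

theorem mem_genericKerOn {Y : Set W} {n : N} :
    n ∈ genericKerOn cs 𝔥 N Y ↔ ∀ x ∈ Y, n ∈ genericKer cs 𝔥 N x := by
  simp [genericKerOn]

theorem genericKerOn_anti {Y Z : Set W} (h : Y ⊆ Z) :
    genericKerOn cs 𝔥 N Z ≤ genericKerOn cs 𝔥 N Y :=
  biInf_mono h

theorem genericKerOn_insert (Y : Set W) (x : W) : genericKerOn cs 𝔥 N (insert x Y) =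
    genericKer cs 𝔥 N x ⊓ genericKerOn cs 𝔥 N Y := iInf_insert

theorem genericKerOn_singleton (x : W) : genericKerOn cs 𝔥 N {x} = genericKer cs 𝔥 N x :=
  iInf_singleton

theorem mem_genericKer_of_smul {x : W} {n : N} {t : RR V} (ht : restrictGr cs 𝔥 x t ≠ 0)
    (h : t • n ∈ genericKer cs 𝔥 N x) : n ∈ genericKer cs 𝔥 N x := by
  obtain ⟨t', ht', h'⟩ := h
  exact ⟨t' * t, by rw [map_mul]; exact mul_ne_zero ht' ht, by rw [mul_smul, h']⟩

theorem genericKer_map {N' : Type*} [AddCommGroup N'] [Module (RR V) N'] (f : N →ₗ[RR V] N')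
    {x : W} {n : N} (h : n ∈ genericKer cs 𝔥 N x) : f n ∈ genericKer cs 𝔥 N' x := by
  obtain ⟨t, ht, h⟩ := h
  exact ⟨t, ht, by rw [← map_smul, h, map_zero]⟩

variable (N) in
/-- `N` has finite support on the twisted graphs, is generically reduced there, and has no other
associated points. -/
structure IsReducedOn : Prop where
  smul_mem : ∀ x t, restrictGr cs 𝔥 x t = 0 → ∀ n : N, t • n ∈ genericKer cs 𝔥 N x
  eq_zero : ∀ n : N, (∀ x, n ∈ genericKer cs 𝔥 N x) → n = 0
  finite : {x | genericKer cs 𝔥 N x ≠ ⊤}.Finite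

/-- Modulo the sections that vanish on `Gr_x`, `R ⊗ R` acts through its restriction to `Gr_x`. -/
theorem IsReducedOn.smul_sub_mem (hN : IsReducedOn cs 𝔥 N) (x : W) (t : RR V) (n : N) :
    t • n - inl V (restrictGr cs 𝔥 x t) • n ∈ genericKer cs 𝔥 N x := by
  rw [← sub_smul]
  refine hN.smul_mem x _ ?_ n
  rw [map_sub, restrictGr_inl, sub_self]

theorem IsReducedOn.inr_smul_sub_mem (hN : IsReducedOn cs 𝔥 N) (x : W) (l : Module.Dual ℝ V)
    (n : N) : inr V (lf l) • n - inl V (lf (dualAct cs 𝔥 x l)) • n ∈ genericKer cs 𝔥 N x := by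
  have := hN.smul_sub_mem cs 𝔥 x (inr V (lf l)) n
  rwa [restrictGr_inr, act_lf] at this

theorem restrictGr_root_ne_zero (x : W) (s : S) :
    restrictGr cs 𝔥 x (inr V (lf (𝔥.root s))) ≠ 0 := by
  rw [restrictGr_inr, act_lf]
  exact lf_ne_zero (dualAct_root_ne_zero cs 𝔥 x s)

theorem IsReducedOn.eq_zero_of_root_smul (hN : IsReducedOn cs 𝔥 N) {s : S} {n : N}
    (h : inr V (lf (𝔥.root s)) • n = 0) : n = 0 :=
  hN.eq_zero n fun x => mem_genericKer_of_smul cs 𝔥 (restrictGr_root_ne_zero cs 𝔥 x s)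
    (by rw [h]; exact Submodule.zero_mem _)

theorem mem_genericKer_of_add_sub {x : W} {a b : N} (h1 : a + b ∈ genericKer cs 𝔥 N x)
    (h2 : a - b ∈ genericKer cs 𝔥 N x) : a ∈ genericKer cs 𝔥 N x ∧ b ∈ genericKer cs 𝔥 N x := by
  have : CharZero (R V) :=
    charZero_of_injective_algebraMap (FaithfulSMul.algebraMap_injective ℝ (R V))
  have h3 : restrictGr cs 𝔥 x 2 ≠ 0 := by rw [map_ofNat]; exact two_ne_zero
  have h4 : a ∈ genericKer cs 𝔥 N x := by
    refine mem_genericKer_of_smul cs 𝔥 h3 ?_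
    rw [two_smul, show a + a = (a + b) + (a - b) by abel]
    exact Submodule.add_mem _ h1 h2
  exact ⟨h4, (Submodule.add_mem_iff_right _ h4).mp h1⟩

end Basic

section Left

variable {N : Type*} [AddCommGroup N] [Module (RR V) N] [Module (R V) N]
  [IsScalarTower (R V) (RR V) N]

theorem inl_smul (f : R V) (n : N) : inl V f • n = f • n := algebraMap_smul (RR V) f n

theorem eq_zero_of_smul_quotient {x : W} {f : R V} (hf : f ≠ 0) {n : N ⧸ genericKer cs 𝔥 N x}
    (h : f • n = 0) : n = 0 := by
  obtain ⟨n, rfl⟩ := Submodule.mkQ_surjective _ n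
  rw [← inl_smul, ← map_smul] at h
  rw [Submodule.mkQ_apply, Submodule.Quotient.mk_eq_zero] at h ⊢
  exact mem_genericKer_of_smul cs 𝔥 (by rwa [restrictGr_inl]) h

variable (N) in
/-- The sections that vanish generically on `Gr_Z`, restricted to `Gr_x`. -/
def relKer (x : W) (Z : Set W) : Submodule (RR V) (N ⧸ genericKer cs 𝔥 N x) :=
  (genericKerOn cs 𝔥 N Z).map (genericKer cs 𝔥 N x).mkQ

/-- `relKer` as a quotient of `genericKerOn`. -/
theorem exists_relKer (x : W) (Z : Set W) : ∃ q : genericKerOn cs 𝔥 N Z →ₗ[R V] relKer cs 𝔥 N x Z,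
    Function.Surjective q ∧ ∀ l, q l = 0 ↔ (l : N) ∈ genericKerOn cs 𝔥 N (insert x Z) := by
  refine ⟨(mkQA (R V) (genericKer cs 𝔥 N x) ∘ₗ
    (genericKerOn cs 𝔥 N Z).subtype.restrictScalars (R V)).codRestrict
      ((relKer cs 𝔥 N x Z).restrictScalars (R V)) fun l => ⟨l, l.2, rfl⟩, ?_, fun l => ?_⟩
  · rintro ⟨_, n, hn, rfl⟩
    exact ⟨⟨n, hn⟩, rfl⟩
  · rw [Subtype.ext_iff, genericKerOn_insert]
    exact (Submodule.Quotient.mk_eq_zero _).trans ⟨fun h => ⟨h, l.2⟩, fun h => h.1⟩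

/-- A Hartogs principle: if `Gr_x ∩ Gr_z` has codimension at least two in `Gr_x`, then the
condition to vanish on `Gr_z` does not affect the restriction to `Gr_x`, provided that the module of
restrictions is projective. -/
theorem relKer_insert [FiniteDimensional ℝ V] (hN : IsReducedOn cs 𝔥 N) {x z : W} (hxz : x ≠ z)
    (h' : ∀ r, cs.IsReflection r → z ≠ r * x) (Z : Set W)
    [Module.Projective (R V) (relKer cs 𝔥 N x (insert z Z))] :
    relKer cs 𝔥 N x (insert z Z) = relKer cs 𝔥 N x Z := by
  refine le_antisymm (Submodule.map_mono (genericKerOn_anti cs 𝔥 (Set.subset_insert _ _))) ?_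
  rintro _ ⟨n, hn, rfl⟩
  obtain ⟨l₁, l₂, hl⟩ := exists_linearIndependent_dualAct_sub cs 𝔥 hxz h'
  -- the form `inr l - inl (z l)` vanishes on `Gr_z` and restricts to `x l - z l` on `Gr_x`
  have key : ∀ l, lf (dualAct cs 𝔥 x l - dualAct cs 𝔥 z l) • (genericKer cs 𝔥 N x).mkQ n ∈
      relKer cs 𝔥 N x (insert z Z) := by
    intro l
    refine ⟨inr V (lf l) • n - inl V (lf (dualAct cs 𝔥 z l)) • n, ?_, ?_⟩
    · rw [SetLike.mem_coe, genericKerOn_insert]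
      refine ⟨hN.inr_smul_sub_mem cs 𝔥 z l n, ?_⟩
      exact Submodule.sub_mem _ (Submodule.smul_mem _ _ hn) (Submodule.smul_mem _ _ hn)
    · rw [← inl_smul, ← map_smul, ← sub_eq_zero, ← map_sub, Submodule.mkQ_apply,
        Submodule.Quotient.mk_eq_zero, map_sub, map_sub, sub_smul]
      convert hN.inr_smul_sub_mem cs 𝔥 x l n using 1
      abel
  obtain ⟨c, hc⟩ := exists_eq_smul_of_projective (A := R V) (p := lf _) (q := lf _)
    (m := (⟨_, key l₁⟩ : relKer cs 𝔥 N x (insert z Z))) (n := ⟨_, key l₂⟩)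
    (fun a b hab => lf_dvd_of_mul_eq hl hab)
    (Subtype.ext (smul_comm _ _ _))
  have hc' := congrArg Subtype.val hc
  have h1 : (genericKer cs 𝔥 N x).mkQ n - c = 0 := by
    refine eq_zero_of_smul_quotient cs 𝔥 (lf_ne_zero (hl.ne_zero 0)) ?_
    rw [smul_sub, sub_eq_zero]
    exact hc'
  rw [sub_eq_zero.mp h1]
  exact c.2

/-- The Hartogs principle for finitely many graphs that meet `Gr_x` in codimension at least two. -/
theorem relKer_union [FiniteDimensional ℝ V] (hN : IsReducedOn cs 𝔥 N) {x : W} {Y : Set W}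
    (hY : Y.Finite) (Z : Set W) (hx : x ∉ Y)
    (h' : ∀ r, cs.IsReflection r → r * x ∉ Y)
    (hp : Module.Projective (R V) (relKer cs 𝔥 N x (Y ∪ Z))) :
    relKer cs 𝔥 N x (Y ∪ Z) = relKer cs 𝔥 N x Z := by
  induction Y, hY using Set.Finite.induction_on with
  | empty => rw [Set.empty_union]
  | @insert z Y _ _ ih =>
    rw [Set.insert_union] at hp ⊢
    have h1 := relKer_insert cs 𝔥 hN (x := x) (z := z) (fun h => hx (h ▸ Set.mem_insert _ _))
      (fun r hr h => h' r hr (h ▸ Set.mem_insert _ _)) (Y ∪ Z)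
    rw [h1] at hp ⊢
    exact ih (fun h => hx (Set.mem_insert_of_mem _ h))
      (fun r hr h => h' r hr (Set.mem_insert_of_mem _ h)) hp

end Left

end GenericKernel

/-! ### Lower sets of the translated Bruhat orders -/

section Lower

variable {S : Type*} {M : CoxeterMatrix S} {W : Type*} [Group W] (cs : CoxeterSystem M W)

/-- `Y` is closed under passing to smaller elements in the Bruhat order translated by `u`, in which
`x` and `y` are compared through `u x` and `u y`. -/
def IsLower (u : W) (Y : Set W) : Prop :=
  ∀ x ∈ Y, ∀ r, cs.IsReflection r → cs.length (u * (r * x)) < cs.length (u * x) → r * x ∈ Y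

variable {V : Type*} [AddCommGroup V] [Module ℝ V] [FiniteDimensional ℝ V]

theorem length_translate_lt (𝔥 : PreRealisation M V) (u : W) {r x : W} {s : S}
    (hr : cs.IsReflection r) (h : cs.length (u * (r * x)) < cs.length (u * x))
    (hne : r * x ≠ x * cs.simple s) :
    cs.length (u * (r * (x * cs.simple s))) < cs.length (u * (x * cs.simple s)) := by
  have e : ∀ y, u * (r * y) = u * r * u⁻¹ * (u * y) := fun y => by group
  rw [e] at h ⊢
  rw [← mul_assoc u x]
  refine length_reflection_mul_lt cs 𝔥 (hr.conj u) h fun h' => hne ?_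
  rw [← e, mul_assoc] at h'
  exact mul_left_cancel h'

/-- The smallest set that contains a lower set and is stable under `s` is again a lower set. -/
theorem IsLower.union_mul_simple (𝔥 : PreRealisation M V) {u : W} {Y : Set W} (hY : IsLower cs u Y)
    (s : S) : IsLower cs u (Y ∪ {y | y * cs.simple s ∈ Y}) := by
  rintro x (hx | hx) r hr hlt
  · exact Or.inl (hY x hx r hr hlt)
  · by_cases h : r * x = x * cs.simple s
    · rw [h]; exact Or.inl hx
    · right
      have := hY _ hx r hr (length_translate_lt cs 𝔥 u hr hlt h)
      rwa [← mul_assoc] at this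

/-- If `Y` is not stable under right multiplication by `s`, then it has a maximal element `x` with
`x s ∉ Y`. -/
theorem IsLower.exists_maximal (𝔥 : PreRealisation M V) {u : W} {Y : Set W} (hY : IsLower cs u Y)
    (hfin : Y.Finite) {s : S} (hs : ¬ ∀ x ∈ Y, x * cs.simple s ∈ Y) :
    ∃ x ∈ Y, x * cs.simple s ∉ Y ∧ IsLower cs u (Y \ {x}) := by
  push Not at hs
  obtain ⟨x₀, h1, h2⟩ := hs
  obtain ⟨x, ⟨hx, hxs⟩, hmax⟩ := Set.exists_max_image {x | x ∈ Y ∧ x * cs.simple s ∉ Y}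
    (fun x => cs.length (u * x)) (hfin.subset fun x hx => hx.1) ⟨x₀, h1, h2⟩
  refine ⟨x, hx, hxs, fun y hy r hr hlt => ⟨hY y hy.1 r hr hlt, ?_⟩⟩
  rintro (h : r * y = x)
  by_cases hys : y * cs.simple s ∈ Y
  · by_cases h' : r * y = y * cs.simple s
    · rw [h] at h'
      rw [h', cs.simple_mul_simple_cancel_right] at hxs
      exact hxs hy.1
    · have := hY _ hys r hr (length_translate_lt cs 𝔥 u hr hlt h')
      rw [← mul_assoc, h] at this
      exact hxs this
  · have := hmax y ⟨hy.1, hys⟩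
    rw [h] at hlt
    omega

end Lower

/-! ### Induction from the invariants of a simple reflection -/

section Flags

variable {V : Type u} [AddCommGroup V] [Module ℝ V]
variable {S : Type*} {M : CoxeterMatrix S} {W : Type*} [Group W] (cs : CoxeterSystem M W)
variable (𝔥 : Realisation M V)

/-- All stalks of `N` along finite lower sets of the translated Bruhat orders are projective as left
`R`-modules. -/
def HasFlags (N : Type*) [AddCommGroup N] [Module (RR V) N] [Module (R V) N]
    [IsScalarTower (R V) (RR V) N] : Prop :=
  ∀ (u : W) (Y : Set W), Y.Finite → IsLower cs u Y →
    Module.Projective (R V) (N ⧸ genericKerOn cs 𝔥 N Y)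

/-- For a reflection `r` with root `β` and `x < r x`, the sections that vanish on `Gr_x` are
divisible by `β` on `Gr_{rx}`, up to factors prime to `β`. -/
def HasDivisibility (N : Type*) [AddCommGroup N] [Module (RR V) N] [Module (R V) N]
    [IsScalarTower (R V) (RR V) N] : Prop :=
  ∀ (x w : W) (s : S), cs.length x < cs.length (w * cs.simple s * w⁻¹ * x) →
    ∀ n ∈ genericKer cs 𝔥 N x, ∃ h : R V, ¬ lf (dualAct cs 𝔥 w (𝔥.root s)) ∣ h ∧ ∃ m : N,
      h • n - lf (dualAct cs 𝔥 w (𝔥.root s)) • m ∈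
        genericKer cs 𝔥 N (w * cs.simple s * w⁻¹ * x)

/-- A bimodule `T` that is obtained from `N` by induction from `R^s` on the right: every element is
uniquely of the form `n ⊗ 1 + m ⊗ α_s`, and there are the two projections `n ⊗ f ↦ n f` and
`n ⊗ f ↦ n s(f)`. -/
structure Induction (s : S) (N T : Type*) [AddCommGroup N] [Module (RR V) N] [Module (R V) N]
    [IsScalarTower (R V) (RR V) N] [AddCommGroup T] [Module (RR V) T] [Module (R V) T]
    [IsScalarTower (R V) (RR V) T] where
  fst : T →ₗ[RR V] N
  snd : T →+ N
  snd_smul : ∀ t τ, snd (t • τ) = twist cs 𝔥 (cs.simple s) t • snd τ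
  one : N →ₗ[R V] T
  root : N →ₗ[R V] T
  fst_one : ∀ n, fst (one n) = n
  snd_one : ∀ n, snd (one n) = n
  fst_root : ∀ n, fst (root n) = inr V (lf (𝔥.root s)) • n
  snd_root : ∀ n, snd (root n) = -(inr V (lf (𝔥.root s)) • n)
  exists_eq : ∀ τ, ∃ n m, τ = one n + root m

/-- The root of a reflection is determined up to a scalar. -/
theorem exists_root_eq_smul {w w' : W} {s s' : S}
    (h : w * cs.simple s * w⁻¹ = w' * cs.simple s' * w'⁻¹) :
    ∃ k : ℝ, dualAct cs 𝔥 w (𝔥.root s) = k • dualAct cs 𝔥 w' (𝔥.root s') := by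
  have h0 : 𝔥.rep cs w (𝔥.coroot s) ≠ 0 := fun h =>
    coroot_ne_zero 𝔥.toPreRealisation s ((LinearEquiv.map_eq_zero_iff _).mp h)
  obtain ⟨l, hl⟩ : ∃ l : Module.Dual ℝ V, l (𝔥.rep cs w (𝔥.coroot s)) = 1 :=
    Module.Projective.exists_dual_eq_one ℝ h0
  refine ⟨l (𝔥.rep cs w' (𝔥.coroot s')), ?_⟩
  ext v
  have h1 := rep_conj_apply cs 𝔥.toPreRealisation w s v
  rw [h, rep_conj_apply, sub_right_inj] at h1
  have h2 := congrArg l h1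
  rw [map_smul, map_smul, hl, smul_eq_mul, smul_eq_mul, mul_one] at h2
  rw [LinearMap.smul_apply, dualAct_apply, dualAct_apply, ← h2, smul_eq_mul, mul_comm]

namespace Induction

variable {cs 𝔥} {s : S} {N T : Type*} [AddCommGroup N] [Module (RR V) N] [Module (R V) N]
  [IsScalarTower (R V) (RR V) N] [AddCommGroup T] [Module (RR V) T] [Module (R V) T]
  [IsScalarTower (R V) (RR V) T] (I : Induction cs 𝔥 s N T)

theorem eq_zero (hN : IsReducedOn cs 𝔥 N) {τ : T} (h1 : I.fst τ = 0) (h2 : I.snd τ = 0) :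
    τ = 0 := by
  obtain ⟨n, m, rfl⟩ := I.exists_eq τ
  rw [map_add, I.fst_one, I.fst_root] at h1
  rw [map_add, I.snd_one, I.snd_root, ← sub_eq_add_neg] at h2
  have hn : n = 0 := hN.eq_zero n fun x => (mem_genericKer_of_add_sub cs 𝔥
    (by rw [h1]; exact Submodule.zero_mem _) (by rw [h2]; exact Submodule.zero_mem _)).1
  rw [hn, zero_add] at h1
  rw [hn, hN.eq_zero_of_root_smul cs 𝔥 h1, map_zero, map_zero, add_zero]

theorem snd_left_smul (f : R V) (τ : T) : I.snd (f • τ) = f • I.snd τ := by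
  rw [← inl_smul, I.snd_smul, twist_inl, inl_smul]

theorem fst_left_smul (f : R V) (τ : T) : I.fst (f • τ) = f • I.fst τ := by
  rw [← inl_smul, map_smul, inl_smul]

/-- The projection `snd` interchanges the graphs `Gr_x` and `Gr_{xs}`. -/
theorem mem_genericKer (hN : IsReducedOn cs 𝔥 N) {x : W} {τ : T} : τ ∈ genericKer cs 𝔥 T x ↔
    I.fst τ ∈ genericKer cs 𝔥 N x ∧ I.snd τ ∈ genericKer cs 𝔥 N (x * cs.simple s) := by
  constructor
  · rintro ⟨t, ht, h⟩
    refine ⟨⟨t, ht, by rw [← map_smul, h, map_zero]⟩, ⟨twist cs 𝔥 (cs.simple s) t, ?_, ?_⟩⟩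
    · rwa [restrictGr_twist, cs.simple_mul_simple_cancel_right]
    · rw [← I.snd_smul, h, map_zero]
  · rintro ⟨⟨t, ht, h⟩, ⟨t', ht', h'⟩⟩
    refine ⟨t * twist cs 𝔥 (cs.simple s) t', ?_, I.eq_zero hN ?_ ?_⟩
    · rw [map_mul, restrictGr_twist]; exact mul_ne_zero ht ht'
    · rw [map_smul, mul_comm, mul_smul, h, smul_zero]
    · rw [I.snd_smul, map_mul, ← twist_mul, cs.simple_mul_simple_self, twist_one, mul_smul, h',
        smul_zero]

theorem isReducedOn (I : Induction cs 𝔥 s N T) (hN : IsReducedOn cs 𝔥 N) : IsReducedOn cs 𝔥 T where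
  smul_mem x t ht τ := by
    rw [I.mem_genericKer hN, map_smul, I.snd_smul]
    refine ⟨hN.smul_mem x t ht _, hN.smul_mem _ _ ?_ _⟩
    rwa [restrictGr_twist, cs.simple_mul_simple_cancel_right]
  eq_zero τ h := by
    refine I.eq_zero hN (hN.eq_zero _ fun x => ((I.mem_genericKer hN).mp (h x)).1)
      (hN.eq_zero _ fun x => ?_)
    have := ((I.mem_genericKer hN).mp (h (x * cs.simple s))).2
    rwa [cs.simple_mul_simple_cancel_right] at this
  finite := by
    refine (hN.finite.union (hN.finite.image (· * cs.simple s))).subset fun x hx => ?_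
    by_contra hcon
    rw [Set.mem_union, not_or] at hcon
    have h1 : genericKer cs 𝔥 N x = ⊤ := not_not.mp hcon.1
    have h2 : genericKer cs 𝔥 N (x * cs.simple s) = ⊤ := by
      by_contra h2
      exact hcon.2 ⟨_, h2, cs.simple_mul_simple_cancel_right s⟩
    refine hx (eq_top_iff.mpr fun τ _ => (I.mem_genericKer hN).mpr ⟨?_, ?_⟩)
    · rw [h1]; trivial
    · rw [h2]; trivial

theorem finite (I : Induction cs 𝔥 s N T) [Module.Finite (R V) N] : Module.Finite (R V) T :=
  Module.Finite.of_surjective (I.one.coprod I.root) fun τ => by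
    obtain ⟨n, m, rfl⟩ := I.exists_eq τ
    exact ⟨(n, m), rfl⟩

theorem mem_genericKerOn_of_stable (hN : IsReducedOn cs 𝔥 N) {Z : Set W}
    (hZ : ∀ z ∈ Z, z * cs.simple s ∈ Z) (n m : N) :
    I.one n + I.root m ∈ genericKerOn cs 𝔥 T Z ↔
      n ∈ genericKerOn cs 𝔥 N Z ∧ m ∈ genericKerOn cs 𝔥 N Z := by
  simp only [mem_genericKerOn, I.mem_genericKer hN, map_add, I.fst_one, I.snd_one, I.fst_root,
    I.snd_root, ← sub_eq_add_neg]
  constructor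
  · intro h
    have key : ∀ z ∈ Z, n ∈ genericKer cs 𝔥 N z ∧ m ∈ genericKer cs 𝔥 N z := fun z hz => by
      have h1 := (h z hz).1
      have h2 := (h _ (hZ z hz)).2
      rw [cs.simple_mul_simple_cancel_right] at h2
      have h3 := mem_genericKer_of_add_sub cs 𝔥 h1 h2
      exact ⟨h3.1, mem_genericKer_of_smul cs 𝔥 (restrictGr_root_ne_zero cs 𝔥 z s) h3.2⟩
    exact ⟨fun z hz => (key z hz).1, fun z hz => (key z hz).2⟩
  · rintro ⟨hn, hm⟩ z hz
    exact ⟨Submodule.add_mem _ (hn z hz) (Submodule.smul_mem _ _ (hm z hz)),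
      Submodule.sub_mem _ (hn _ (hZ z hz)) (Submodule.smul_mem _ _ (hm _ (hZ z hz)))⟩

theorem projective_of_stable (I : Induction cs 𝔥 s N T) (hN : IsReducedOn cs 𝔥 N)
    {Z : Set W}
    (hZ : ∀ z ∈ Z, z * cs.simple s ∈ Z)
    [Module.Projective (R V) (N ⧸ genericKerOn cs 𝔥 N Z)] :
    Module.Projective (R V) (T ⧸ genericKerOn cs 𝔥 T Z) := by
  refine projective_quotient_of_prod (N := N) (K := genericKerOn cs 𝔥 N Z) (I.one.coprod I.root)
    (fun τ => ?_) fun x => ?_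
  · obtain ⟨n, m, rfl⟩ := I.exists_eq τ
    exact ⟨(n, m), rfl⟩
  · rw [LinearMap.coprod_apply, I.mem_genericKerOn_of_stable hN hZ]

/-- Modulo the sections that vanish on `Gr_x`, every element is of the form `n ⊗ 1`. -/
theorem root_sub_one_mem (hN : IsReducedOn cs 𝔥 N) (x : W) (m : N) :
    I.root m - I.one (lf (dualAct cs 𝔥 x (𝔥.root s)) • m) ∈ genericKer cs 𝔥 T x := by
  rw [I.mem_genericKer hN, map_sub, map_sub, I.fst_root, I.fst_one, I.snd_root, I.snd_one]
  constructor
  · rw [← inl_smul]; exact hN.inr_smul_sub_mem cs 𝔥 x _ m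
  · have := hN.inr_smul_sub_mem cs 𝔥 (x * cs.simple s) (𝔥.root s) m
    rw [dualAct_mul, dualAct_simple_root, map_neg, map_neg, map_neg, neg_smul, inl_smul] at this
    rw [← Submodule.neg_mem_iff]
    convert this using 1
    abel

/-- The sections that vanish on a set `Z` stable under `s`, restricted to `Gr_x`, form a projective
module: they agree with the sections of `N` that vanish on `Z`, restricted to the union of `Gr_x`
and `Gr_{xs}`. -/
theorem projective_relKer (I : Induction cs 𝔥 s N T) (hN : IsReducedOn cs 𝔥 N)
    {Z : Set W}
    (hZ : ∀ z ∈ Z, z * cs.simple s ∈ Z) (x : W)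
    [Module.Projective (R V) (N ⧸ genericKerOn cs 𝔥 N Z)]
    [Module.Projective (R V) (N ⧸ genericKerOn cs 𝔥 N (insert x (insert (x * cs.simple s) Z)))] :
    Module.Projective (R V) (relKer cs 𝔥 T x Z) := by
  have hone : ∀ n : N, n ∈ genericKerOn cs 𝔥 N Z → I.one n ∈ genericKerOn cs 𝔥 T Z := fun n hn => by
    have := (I.mem_genericKerOn_of_stable hN hZ n 0).mpr ⟨hn, Submodule.zero_mem _⟩
    rwa [map_zero, add_zero] at this
  refine projective_of_quotient_of_le (N := N)
    (K := genericKerOn cs 𝔥 N (insert x (insert (x * cs.simple s) Z)))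
    (genericKerOn_anti cs 𝔥 ((Set.subset_insert _ _).trans (Set.subset_insert x _)))
    ((mkQA (R V) (genericKer cs 𝔥 T x) ∘ₗ I.one ∘ₗ
      (genericKerOn cs 𝔥 N Z).subtype.restrictScalars (R V)).codRestrict
      ((relKer cs 𝔥 T x Z).restrictScalars (R V)) fun n => ⟨I.one n, hone n n.2, rfl⟩) ?_ ?_
  · rintro ⟨_, τ, hτ, rfl⟩
    obtain ⟨n, m, rfl⟩ := I.exists_eq τ
    obtain ⟨hn, hm⟩ := (I.mem_genericKerOn_of_stable hN hZ n m).mp hτ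
    refine ⟨⟨n + lf (dualAct cs 𝔥 x (𝔥.root s)) • m, Submodule.add_mem _ hn
      (by rw [← inl_smul]; exact Submodule.smul_mem _ _ hm)⟩, Subtype.ext ?_⟩
    change Submodule.Quotient.mk (I.one _) = Submodule.Quotient.mk _
    rw [eq_comm, Submodule.Quotient.eq]
    change I.one n + I.root m - I.one (n + _) ∈ _
    rw [map_add, add_sub_add_left_eq_sub]
    exact I.root_sub_one_mem hN x m
  · intro n
    rw [Subtype.ext_iff, genericKerOn_insert, genericKerOn_insert]
    refine (Submodule.Quotient.mk_eq_zero _).trans ?_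
    change I.one n ∈ _ ↔ _
    rw [I.mem_genericKer hN, I.fst_one, I.snd_one]
    exact ⟨fun h => ⟨h.1, h.2, n.2⟩, fun h => ⟨h.1, h.2.1⟩⟩

/-- Induction from `R^s` preserves the projectivity of stalks along lower sets. From a lower set `Y`
that is not stable under `s` one removes a maximal element `x` with `x s ∉ Y`. In the sections that
vanish on `Y \ {x}`, restricted to `Gr_x`, one may replace `Y \ {x}` by a larger set that is stable
under `s`, since the additional graphs meet `Gr_x` in codimension at least two. -/
theorem hasFlags [FiniteDimensional ℝ V] (I : Induction cs 𝔥 s N T)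
    (hN : IsReducedOn cs 𝔥 N) (hF : HasFlags cs 𝔥 N) : HasFlags cs 𝔥 T := by
  intro u Y hY hlow
  induction hn : Y.ncard using Nat.strong_induction_on generalizing Y with
  | _ n ih =>
  subst hn
  by_cases hst : ∀ x ∈ Y, x * cs.simple s ∈ Y
  · have := hF u Y hY hlow
    exact I.projective_of_stable hN hst
  obtain ⟨x, hx, hxs, hlow'⟩ := hlow.exists_maximal cs 𝔥.toPreRealisation hY hst
  have hins : insert x (Y \ {x}) = Y := by rw [Set.insert_sdiff_singleton, Set.insert_eq_of_mem hx]
  have h0 := ih _ (Set.ncard_sdiff_singleton_lt_of_mem hx hY) (Y \ {x}) (hY.subset Set.sdiff_subset)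
    hlow' rfl
  -- the smallest lower set that contains `Y \ {x}` and is stable under `s`
  set Z := Y \ {x} ∪ {y | y * cs.simple s ∈ Y \ {x}} with hZdef
  have hsfin : ∀ X : Set W, X.Finite → {y | y * cs.simple s ∈ X}.Finite := fun X hX =>
    hX.preimage (mul_left_injective (cs.simple s)).injOn
  have hZ : ∀ z ∈ Z, z * cs.simple s ∈ Z := by
    rintro z (hz | hz)
    · right
      rw [Set.mem_ofPred_eq, cs.simple_mul_simple_cancel_right]
      exact hz
    · exact Or.inl hz
  have hZfin : Z.Finite := (hY.subset Set.sdiff_subset).union (hsfin _ (hY.subset Set.sdiff_subset))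
  have hZlow : IsLower cs u Z := hlow'.union_mul_simple cs 𝔥.toPreRealisation s
  have hxZ : x ∉ Z := by
    rintro (h | h)
    · exact h.2 rfl
    · exact hxs h.1
  have hbig : insert x (insert (x * cs.simple s) Z) = Y ∪ {y | y * cs.simple s ∈ Y} := by
    ext y
    have e : ∀ y, y * cs.simple s = x ↔ y = x * cs.simple s := fun y => by
      constructor
      · rintro rfl; rw [cs.simple_mul_simple_cancel_right]
      · rintro rfl; rw [cs.simple_mul_simple_cancel_right]
    simp only [hZdef, Set.mem_insert_iff, Set.mem_union, Set.mem_sdiff, Set.mem_singleton_iff,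
      Set.mem_ofPred_eq, e]
    by_cases h1 : y = x
    · subst h1; simp [hx]
    · by_cases h2 : y = x * cs.simple s
      · subst h2; simp [hx]
      · simp [h1, h2]
  have p1 := hF u Z hZfin hZlow
  have p2 := hF u _ (hY.union (hsfin Y hY)) (hlow.union_mul_simple cs 𝔥.toPreRealisation s)
  rw [← hbig] at p2
  have p3 := I.projective_relKer hN hZ x
  have hZu : Z = (Z \ Y) ∪ (Y \ {x}) := by
    ext y
    simp only [Set.mem_union, Set.mem_sdiff, Set.mem_singleton_iff]
    constructor
    · intro hy
      by_cases h : y ∈ Y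
      · exact Or.inr ⟨h, fun h' => hxZ (h' ▸ hy)⟩
      · exact Or.inl ⟨hy, h⟩
    · rintro (h | h)
      · exact h.1
      · exact Or.inl h
  have p4 : relKer cs 𝔥 T x Z = relKer cs 𝔥 T x (Y \ {x}) := by
    rw [hZu] at p3 ⊢
    refine relKer_union cs 𝔥 (I.isReducedOn hN) (hZfin.subset Set.sdiff_subset) _
      (fun h => hxZ h.1) (fun r hr h => ?_) p3
    -- `r x` and `x` are comparable, but `x` is maximal in `Y` and `Z` is a lower set
    rcases (Nat.lt_or_gt_of_ne (show cs.length (u * (r * x)) ≠ cs.length (u * x) from by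
      have := (hr.conj u).length_mul_right_ne (u * x)
      rwa [show u * r * u⁻¹ * (u * x) = u * (r * x) by group] at this)) with hlt | hlt
    · exact h.2 (hlow x hx r hr hlt)
    · have hrx : r * (r * x) = x := by rw [← mul_assoc, hr.mul_self, one_mul]
      have := hZlow _ h.1 r hr (by rwa [hrx])
      rw [hrx] at this
      exact hxZ this
  rw [p4] at p3
  obtain ⟨q, hq, hq'⟩ := exists_relKer cs 𝔥 (N := T) x (Y \ {x})
  rw [hins] at hq'
  exact projective_quotient_of_le (genericKerOn_anti cs 𝔥 Set.sdiff_subset) q hq hq'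

/-- Induction from `R^s` preserves divisibility along the roots. -/
theorem hasDivisibility [FiniteDimensional ℝ V] (I : Induction cs 𝔥 s N T)
    (hN : IsReducedOn cs 𝔥 N) (hD : HasDivisibility cs 𝔥 N) :
    HasDivisibility cs 𝔥 T := by
  intro x w s' hlt τ hτ
  set r := w * cs.simple s' * w⁻¹ with hr
  set β := dualAct cs 𝔥 w (𝔥.root s') with hβ
  have hβ0 : β ≠ 0 := dualAct_root_ne_zero cs 𝔥 w s'
  have hrefl : cs.IsReflection r := ⟨w, s', rfl⟩
  obtain ⟨hu, hv⟩ := (I.mem_genericKer hN).mp hτ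
  by_cases hrx : r * x = x * cs.simple s
  · -- both elements of the orbit belong to the same coset of `s`
    obtain ⟨k, hk⟩ := exists_root_eq_smul cs 𝔥 (w := w) (w' := x) (s := s') (s' := s) (by
      rw [← hr, ← hrx, mul_assoc, mul_inv_cancel, mul_one])
    have hk0 : k ≠ 0 := by
      rintro rfl
      rw [zero_smul] at hk
      exact hβ0 hk
    refine ⟨1, not_lf_dvd_one hβ0, ?_⟩
    obtain ⟨n, m, rfl⟩ := I.exists_eq τ
    rw [map_add, I.fst_one, I.fst_root] at hu
    rw [map_add, I.snd_one, I.snd_root] at hv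
    refine ⟨I.one (algebraMap ℝ (R V) (-2 / k) • m), ?_⟩
    have e1 : lf β • I.one (algebraMap ℝ (R V) (-2 / k) • m) =
        -(I.one (lf (dualAct cs 𝔥 x (𝔥.root s)) • m) +
          I.one (lf (dualAct cs 𝔥 x (𝔥.root s)) • m)) := by
      rw [← map_smul, smul_smul, ← map_add, ← map_neg, ← two_smul (R V), ← neg_smul, smul_smul]
      congr 2
      rw [show β = k • _ from hk, map_smul, Algebra.smul_def, mul_right_comm, ← map_mul,
        mul_div_cancel₀ _ hk0, map_neg, map_ofNat]
    have h1 := I.root_sub_one_mem hN (x * cs.simple s) m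
    rw [dualAct_mul, dualAct_simple_root, map_neg, map_neg, neg_smul, map_neg, sub_neg_eq_add] at h1
    rw [e1, hrx, one_smul, sub_neg_eq_add]
    rw [show ∀ a b c : T, a + b + (c + c) = (a + c) + (b + c) from fun a b c => by abel]
    refine Submodule.add_mem _ ?_ h1
    rw [← map_add, I.mem_genericKer hN, I.fst_one, I.snd_one, cs.simple_mul_simple_cancel_right]
    have h2 := hN.inr_smul_sub_mem cs 𝔥 x (𝔥.root s) m
    have h3 := hN.inr_smul_sub_mem cs 𝔥 (x * cs.simple s) (𝔥.root s) m
    rw [dualAct_mul, dualAct_simple_root, map_neg, map_neg, map_neg, neg_smul] at h3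
    rw [inl_smul] at h2 h3
    constructor
    · convert Submodule.add_mem _ hv h3 using 1
      abel
    · convert Submodule.sub_mem _ hu h2 using 1
      abel
  · -- the two orbits are separated by the root `γ` of the reflection that relates `r x` and `r x s`
    set y := r * x with hy
    have hry : r * y = x := by rw [hy, ← mul_assoc, hrefl.mul_self, one_mul]
    have hlt' : cs.length (x * cs.simple s) < cs.length (r * (x * cs.simple s)) := by
      have h1 := length_reflection_mul_lt cs 𝔥.toPreRealisation (r := r) (x := y) (s := s) hrefl
        (by rwa [hry]) (fun h => hrx (by rw [← hry, h, cs.simple_mul_simple_cancel_right]))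
      rwa [← mul_assoc, hry, hy, mul_assoc] at h1
    obtain ⟨h₁, hh₁, n₁, hn₁⟩ := hD x w s' hlt _ hu
    obtain ⟨h₂, hh₂, n₂, hn₂⟩ := hD (x * cs.simple s) w s' hlt' _ hv
    rw [← hr, ← mul_assoc, ← hy] at hn₂
    rw [← hβ, ← hr, ← hy] at hn₁
    rw [← hβ] at hn₂ hh₁ hh₂
    set γ := dualAct cs 𝔥 y (𝔥.root s) with hγ
    set a := inr V (lf (𝔥.root s)) with ha
    have hg : ¬ lf β ∣ lf γ + lf γ := by
      rw [← map_add]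
      intro hd
      obtain ⟨k, hk⟩ := exists_smul_eq_of_lf_dvd hd
      refine dualAct_root_ne_smul cs 𝔥 (w := y) (w' := w) (s := s) (s' := s') ?_ (k / 2) ?_
      · intro h
        refine hrx ?_
        rw [← hr] at h
        rw [← hry, ← h]
        simp [mul_assoc]
      · rw [← hγ, ← hβ, div_eq_inv_mul, mul_smul, ← hk]
        module
    -- `1 ⊗ α_s` restricts to `γ` on `Gr_y` and to `-γ` on `Gr_{ys}`, so the factors `γ + 1 ⊗ α_s`
    -- and `γ - 1 ⊗ α_s` single out `n₁` on `Gr_y` and `n₂` on `Gr_{ys}`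
    refine ⟨(lf γ + lf γ) * (h₁ * h₂), fun hd => ?_, I.one (a • h₂ • n₁ + lf γ • h₂ • n₁ +
      (lf γ • h₁ • n₂ - a • h₁ • n₂)), ?_⟩
    · rcases (prime_lf hβ0).dvd_or_dvd hd with hd | hd
      · exact hg hd
      · exact ((prime_lf hβ0).dvd_or_dvd hd).elim hh₁ hh₂
    set p := h₂ • n₁ with hp
    set q := h₁ • n₂ with hq
    rw [I.mem_genericKer hN, map_sub, map_sub, I.fst_left_smul, I.snd_left_smul, I.fst_left_smul,
      I.snd_left_smul, I.fst_one, I.snd_one]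
    have ey : ∀ z : N, a • z - lf γ • z ∈ genericKer cs 𝔥 N y := fun z => by
      have := hN.inr_smul_sub_mem cs 𝔥 y (𝔥.root s) z
      rwa [inl_smul] at this
    have eys : ∀ z : N, a • z + lf γ • z ∈ genericKer cs 𝔥 N (y * cs.simple s) := fun z => by
      have := hN.inr_smul_sub_mem cs 𝔥 (y * cs.simple s) (𝔥.root s) z
      rw [dualAct_mul, dualAct_simple_root, map_neg, map_neg, map_neg, neg_smul, inl_smul,
        sub_neg_eq_add] at this
      exact this
    have hsm : ∀ {z : W} (f : R V) {n : N}, n ∈ genericKer cs 𝔥 N z →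
        f • n ∈ genericKer cs 𝔥 N z := fun f n hn => by
      rw [← inl_smul]; exact Submodule.smul_mem _ _ hn
    constructor
    · have e := Submodule.sub_mem _ (hsm ((lf γ + lf γ) * h₂) hn₁)
        (hsm (lf β) (Submodule.sub_mem _ (ey p) (ey q)))
      convert e using 1
      rw [hp, hq]
      module
    · have e := Submodule.sub_mem _ (hsm ((lf γ + lf γ) * h₁) hn₂)
        (hsm (lf β) (Submodule.sub_mem _ (eys p) (eys q)))
      convert e using 1
      rw [hp, hq]
      module

end Induction
end Flags

/-! ### Stratified bimodules -/

section Closure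

variable {V : Type u} [AddCommGroup V] [Module ℝ V]
variable {S : Type*} {M : CoxeterMatrix S} {W : Type*} [Group W] (cs : CoxeterSystem M W)
variable (𝔥 : Realisation M V)

/-- The properties of the support of a bimodule that are shared by all Soergel bimodules. -/
structure IsStratified (N : Type*) [AddCommGroup N] [Module (RR V) N] [Module (R V) N]
    [IsScalarTower (R V) (RR V) N] : Prop where
  finite : Module.Finite (R V) N
  isReducedOn : IsReducedOn cs 𝔥 N
  hasFlags : HasFlags cs 𝔥 N
  hasDivisibility : HasDivisibility cs 𝔥 N

variable {cs 𝔥}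

/-- A bimodule that lives on `Gr_x` vanishes generically on every other graph. -/
theorem genericKer_eq_top [FiniteDimensional ℝ V] {N : Type*} [AddCommGroup N]
    [Module (RR V) N] {x y : W} (hxy : x ≠ y)
    (h : ∀ t, restrictGr cs 𝔥 x t = 0 → ∀ n : N, t • n = 0) : genericKer cs 𝔥 N y = ⊤ := by
  obtain ⟨l, hl⟩ := exists_dualAct_ne cs 𝔥 hxy
  refine eq_top_iff.mpr fun n _ => ⟨inr V (lf l) - inl V (lf (dualAct cs 𝔥 x l)), ?_, h _ ?_ n⟩
  · rw [map_sub, restrictGr_inl, restrictGr_inr, act_lf, ← map_sub]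
    exact lf_ne_zero (sub_ne_zero.mpr hl.symm)
  · rw [map_sub, restrictGr_inl, restrictGr_inr, act_lf, sub_self]

variable {N : Type*} [AddCommGroup N] [Module (RR V) N] [Module (R V) N]
  [IsScalarTower (R V) (RR V) N]

theorem Induction.isStratified [FiniteDimensional ℝ V] {s : S} {T : Type*} [AddCommGroup T]
    [Module (RR V) T] [Module (R V) T] [IsScalarTower (R V) (RR V) T] (I : Induction cs 𝔥 s N T)
    (hN : IsStratified cs 𝔥 N) : IsStratified cs 𝔥 T where
  finite := have := hN.finite; I.finite
  isReducedOn := I.isReducedOn hN.isReducedOn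
  hasFlags := I.hasFlags hN.isReducedOn hN.hasFlags
  hasDivisibility := I.hasDivisibility hN.isReducedOn hN.hasDivisibility

/-- A map of `R ⊗ R`-modules is linear for the left action of `R`. -/
def leftLin {N' : Type*} [AddCommGroup N'] [Module (RR V) N'] [Module (R V) N']
    [IsScalarTower (R V) (RR V) N'] (f : N →ₗ[RR V] N') : N →ₗ[R V] N' where
  toFun := f
  map_add' := map_add f
  map_smul' r n := by rw [← inl_smul, map_smul, inl_smul, RingHom.id_apply]

/-- Direct summands of stratified bimodules are stratified. -/
theorem IsStratified.of_retract {N' : Type*} [AddCommGroup N'] [Module (RR V) N'] [Module (R V) N']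
    [IsScalarTower (R V) (RR V) N'] (i : N' →ₗ[RR V] N) (p : N →ₗ[RR V] N')
    (h : ∀ n, p (i n) = n) (hN : IsStratified cs 𝔥 N) : IsStratified cs 𝔥 N' where
  finite := have := hN.finite; Module.Finite.of_surjective (leftLin p) fun n => ⟨i n, h n⟩
  isReducedOn :=
    { smul_mem := fun x t ht n => by
        have := genericKer_map cs 𝔥 p (hN.isReducedOn.smul_mem x t ht (i n))
        rwa [map_smul, h] at this
      eq_zero := fun n hn => by
        rw [← h n, hN.isReducedOn.eq_zero (i n) fun x => genericKer_map cs 𝔥 i (hn x), map_zero]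
      finite := hN.isReducedOn.finite.subset fun x hx hx' => hx <| eq_top_iff.mpr fun n _ => by
        have : i n ∈ genericKer cs 𝔥 N x := by rw [hx']; trivial
        have := genericKer_map cs 𝔥 p this
        rwa [h] at this }
  hasFlags u Y hY hlow := by
    have := hN.hasFlags u Y hY hlow
    have hi : genericKerOn cs 𝔥 N' Y ≤ (genericKerOn cs 𝔥 N Y).comap i := fun n hn =>
      (mem_genericKerOn cs 𝔥).mpr fun x hx =>
        genericKer_map cs 𝔥 i ((mem_genericKerOn cs 𝔥).mp hn x hx)
    have hp : genericKerOn cs 𝔥 N Y ≤ (genericKerOn cs 𝔥 N' Y).comap p := fun n hn =>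
      (mem_genericKerOn cs 𝔥).mpr fun x hx =>
        genericKer_map cs 𝔥 p ((mem_genericKerOn cs 𝔥).mp hn x hx)
    refine projective_of_retract (leftLin (Submodule.mapQ _ _ i hi))
      (leftLin (Submodule.mapQ _ _ p hp)) fun x => ?_
    obtain ⟨n, rfl⟩ := Submodule.mkQ_surjective _ x
    exact congrArg _ (h n)
  hasDivisibility x w s hlt n hn := by
    obtain ⟨f, hf, m, hm⟩ := hN.hasDivisibility x w s hlt (i n) (genericKer_map cs 𝔥 i hn)
    refine ⟨f, hf, p m, ?_⟩
    have := genericKer_map cs 𝔥 p hm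
    rwa [map_sub, ← inl_smul, ← inl_smul, map_smul, map_smul, h, inl_smul, inl_smul] at this

section Pi

variable {k : ℕ} {P : Fin k → Type*} [∀ j, AddCommGroup (P j)] [∀ j, Module (RR V) (P j)]

theorem mem_genericKer_pi {x : W} {n : ∀ j, P j} :
    n ∈ genericKer cs 𝔥 (∀ j, P j) x ↔ ∀ j, n j ∈ genericKer cs 𝔥 (P j) x := by
  refine ⟨fun h j => genericKer_map cs 𝔥 (LinearMap.proj j) h, fun h => ?_⟩
  choose t ht htn using h
  refine ⟨∏ j, t j, ?_, funext fun j => ?_⟩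
  · rw [map_prod]
    exact Finset.prod_ne_zero_iff.mpr fun j _ => ht j
  · rw [Pi.smul_apply, ← Finset.prod_erase_mul _ _ (Finset.mem_univ j), mul_smul, htn, smul_zero]
    rfl

theorem mem_genericKerOn_pi {Y : Set W} {n : ∀ j, P j} :
    n ∈ genericKerOn cs 𝔥 (∀ j, P j) Y ↔ ∀ j, n j ∈ genericKerOn cs 𝔥 (P j) Y := by
  simp only [mem_genericKerOn, mem_genericKer_pi]
  exact ⟨fun h j x hx => h x hx j, fun h x hx j => h j x hx⟩

variable [∀ j, Module (R V) (P j)] [∀ j, IsScalarTower (R V) (RR V) (P j)]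

theorem IsStratified.pi (h : ∀ j, IsStratified cs 𝔥 (P j)) : IsStratified cs 𝔥 (∀ j, P j) where
  finite := by
    have := fun j => (h j).finite
    infer_instance
  isReducedOn :=
    { smul_mem := fun x t ht n => mem_genericKer_pi.mpr fun j =>
        (h j).isReducedOn.smul_mem x t ht (n j)
      eq_zero := fun n hn => funext fun j =>
        (h j).isReducedOn.eq_zero _ fun x => mem_genericKer_pi.mp (hn x) j
      finite := by
        refine (Set.finite_iUnion fun j => (h j).isReducedOn.finite).subset fun x hx => ?_
        by_contra hcon
        refine hx (eq_top_iff.mpr fun n _ => mem_genericKer_pi.mpr fun j => ?_)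
        rw [Set.mem_iUnion, not_exists] at hcon
        rw [show genericKer cs 𝔥 (P j) x = ⊤ from not_not.mp (hcon j)]
        trivial }
  hasFlags u Y hY hlow := by
    have := fun j => (h j).hasFlags u Y hY hlow
    have : Module.Projective (R V) (∀ j, P j ⧸ genericKerOn cs 𝔥 (P j) Y) :=
      Module.Projective.of_equiv' DFinsupp.linearEquivFunOnFintype
    have hp : Function.Surjective (LinearMap.pi fun j =>
        mkQA (R V) (genericKerOn cs 𝔥 (P j) Y) ∘ₗ LinearMap.proj j :
          (∀ j, P j) →ₗ[R V] ∀ j, P j ⧸ genericKerOn cs 𝔥 (P j) Y) := fun y => by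
      choose n hn using fun j => Submodule.mkQ_surjective _ (y j)
      exact ⟨n, funext hn⟩
    refine projective_of_surjective_of_ker _ _ hp
      (mkQA_surjective (A := R V) (genericKerOn cs 𝔥 (∀ j, P j) Y)) fun n => ?_
    refine Iff.trans ?_ (mkQA_eq_zero (A := R V)).symm
    rw [mem_genericKerOn_pi]
    exact funext_iff.trans (forall_congr' fun j => mkQA_eq_zero (A := R V))
  hasDivisibility x w s hlt n hn := by
    choose f hf m hm using fun j =>
      (h j).hasDivisibility x w s hlt (n j) (mem_genericKer_pi.mp hn j)
    refine ⟨∏ j, f j, fun hd => ?_, fun j => (∏ l ∈ Finset.univ.erase j, f l) • m j,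
      mem_genericKer_pi.mpr fun j => ?_⟩
    · obtain ⟨j, _, hj⟩ := (prime_lf (dualAct_root_ne_zero cs 𝔥 w s)).exists_mem_finset_dvd hd
      exact hf j hj
    · have := Submodule.smul_mem _ (inl V (∏ l ∈ Finset.univ.erase j, f l)) (hm j)
      rw [inl_smul, smul_sub, ← mul_smul, Finset.prod_erase_mul _ _ (Finset.mem_univ j),
        smul_comm] at this
      exact this

end Pi

section Cyclic

variable {x : W} {g : N}

/-- A cyclic module with annihilator the vanishing ideal of `Gr_x` is free of rank one over `R`. -/
theorem bijective_toSpanSingleton (hg : ∀ t : RR V, t • g = 0 ↔ restrictGr cs 𝔥 x t = 0)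
    (hgen : ∀ n, ∃ t : RR V, n = t • g) :
    Function.Bijective (LinearMap.toSpanSingleton (R V) N g) := by
  constructor
  · refine (injective_iff_map_eq_zero _).mpr fun f hf => ?_
    rw [LinearMap.toSpanSingleton_apply, ← inl_smul, hg, restrictGr_inl] at hf
    exact hf
  · intro n
    obtain ⟨t, rfl⟩ := hgen n
    refine ⟨restrictGr cs 𝔥 x t, ?_⟩
    rw [LinearMap.toSpanSingleton_apply, ← inl_smul, ← sub_eq_zero, ← sub_smul, hg, map_sub,
      restrictGr_inl, sub_self]

/-- The bimodule `R = R(id)` is stratified. -/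
theorem IsStratified.of_cyclic_one [FiniteDimensional ℝ V] {g : N}
    (hg : ∀ t : RR V, t • g = 0 ↔ restrictGr cs 𝔥 1 t = 0)
    (hgen : ∀ n, ∃ t : RR V, n = t • g) : IsStratified cs 𝔥 N := by
  have hbij := bijective_toSpanSingleton hg hgen
  have hann : ∀ t, restrictGr cs 𝔥 1 t = 0 → ∀ n : N, t • n = 0 := fun t ht n => by
    obtain ⟨t', rfl⟩ := hgen n
    rw [smul_comm, (hg t).mpr ht, smul_zero]
  have htop : ∀ y, 1 ≠ y → genericKer cs 𝔥 N y = ⊤ := fun y hy => genericKer_eq_top hy hann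
  have hbot : genericKer cs 𝔥 N 1 = ⊥ := by
    refine eq_bot_iff.mpr ?_
    rintro n ⟨t, ht, h⟩
    obtain ⟨t', rfl⟩ := hgen n
    rw [← mul_smul, hg, map_mul] at h
    exact (hg t').mpr ((mul_eq_zero.mp h).resolve_left ht)
  have hproj : Module.Projective (R V) N :=
    Module.Projective.of_equiv' (LinearEquiv.ofBijective _ hbij)
  refine ⟨Module.Finite.of_surjective _ hbij.2, ⟨fun x t ht n => ?_, fun n hn => ?_, ?_⟩,
    fun u Y _ _ => ?_, fun x w s hlt n _ => ?_⟩
  · by_cases hx : 1 = x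
    · subst hx; rw [hann t ht]; exact Submodule.zero_mem _
    · rw [htop x hx]; trivial
  · have := hn 1
    rwa [hbot] at this
  · refine (Set.finite_singleton (1 : W)).subset fun x hx => ?_
    by_contra h
    exact hx (htop x (Ne.symm h))
  · by_cases h1 : (1 : W) ∈ Y
    · have e : genericKerOn cs 𝔥 N Y = ⊥ :=
        eq_bot_iff.mpr fun n hn => by rw [← hbot]; exact (mem_genericKerOn cs 𝔥).mp hn 1 h1
      refine projective_of_surjective_of_ker LinearMap.id _ Function.surjective_id
        (mkQA_surjective (A := R V) (genericKerOn cs 𝔥 N Y)) fun n => ?_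
      refine Iff.trans ?_ (mkQA_eq_zero (A := R V)).symm
      rw [e, Submodule.mem_bot]; rfl
    · have e : genericKerOn cs 𝔥 N Y = ⊤ := eq_top_iff.mpr fun n _ =>
        (mem_genericKerOn cs 𝔥).mpr fun x hx => by
          rw [htop x fun h => h1 (h ▸ hx)]; trivial
      have : Subsingleton (N ⧸ genericKerOn cs 𝔥 N Y) := by
        rw [e]; infer_instance
      infer_instance
  · refine ⟨1, not_lf_dvd_one (dualAct_root_ne_zero cs 𝔥 w s), 0, ?_⟩
    rw [htop _ fun h => ?_]
    · trivial
    · rw [← h, cs.length_one] at hlt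
      exact absurd hlt (Nat.not_lt_zero _)

end Cyclic

end Closure

/-! ### Tensor products of bimodules -/

section Tensor

variable {V : Type u} [AddCommGroup V] [Module ℝ V]

/-- The left action of `R` on a graded bimodule. -/
instance leftModule (B : GBimod V) : Module (R V) B := Module.compHom B (inl V).toRingHom

instance (B : GBimod V) : IsScalarTower (R V) (RR V) B where
  smul_assoc f t b := mul_smul (inl V f) t b

variable {M N N' : GBimod V}

/-- The pure tensor `m ⊗ n`, as an element of the graded bimodule `M ⊗_R N`. -/
def tmul (m : M) (n : N) : tensor M N := tprod m n

theorem add_tmul (m m' : M) (n : N) : tmul (m + m') n = tmul m n + tmul m' n :=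
  tprod_add_left m m' n

theorem tmul_add (m : M) (n n' : N) : tmul m (n + n') = tmul m n + tmul m n' :=
  tprod_add_right m n n'

theorem zero_tmul (n : N) : tmul (0 : M) n = 0 := tprod_zero_left n

theorem tmul_zero (m : M) : tmul m (0 : N) = 0 := tprod_zero_right m

theorem tmul_balanced (r : R V) (m : M) (n : N) : tmul (inr V r • m) n = tmul m (inl V r • n) :=
  tprod_balanced r m n

theorem inl_smul_tmul (f : R V) (m : M) (n : N) : inl V f • tmul m n = tmul (inl V f • m) n :=
  inl_smul_tprod f m n

theorem inr_smul_tmul (f : R V) (m : M) (n : N) : inr V f • tmul m n = tmul m (inr V f • n) :=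
  inr_smul_tprod f m n

theorem tmul_induction {P : tensor M N → Prop} (hadd : ∀ x y, P x → P y → P (x + y))
    (h : ∀ m n, P (tmul m n)) (x : tensor M N) : P x :=
  tensor_induction (P := P) (by
    have := h 0 0
    rwa [zero_tmul] at this) hadd (fun _ _ m _ n _ => h m n) x

theorem tensor_addHom_ext {P : Type*} [AddCommGroup P] {f g : tensor M N →+ P}
    (h : ∀ (m : M) (n : N), f (tmul m n) = g (tmul m n)) : f = g := by
  refine AddMonoidHom.ext fun x => ?_
  induction x using tmul_induction with
  | hadd x y hx hy => rw [map_add, map_add, hx, hy]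
  | h m n => exact h m n

section Lift

variable {P : Type*} [AddCommGroup P]

/-- The additive map out of `M ⊗_R N` given by a balanced biadditive map. -/
def tensorLift (φ : M →+ N →+ P) (hφ : ∀ (r : R V) m n, φ (inr V r • m) n = φ m (inl V r • n)) :
    tensor M N →+ P :=
  TensorProduct.liftAddHom (R := R V) (M := RightRes M) (N := LeftRes N) φ hφ

theorem tensorLift_tmul (φ : M →+ N →+ P)
    (hφ : ∀ (r : R V) m n, φ (inr V r • m) n = φ m (inl V r • n)) (m : M) (n : N) :
    tensorLift φ hφ (tmul m n) = φ m n := rfl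

/-- An additive map out of `M ⊗_R N` is semilinear if it is so for both actions of `R` on pure
tensors. -/
theorem tensor_map_smul [Module (RR V) P] (f : tensor M N →+ P) (σ : RR V →ₐ[ℝ] RR V)
    (hl : ∀ r m n, f (tmul (inl V r • m) n) = σ (inl V r) • f (tmul m n))
    (hr : ∀ r m n, f (tmul m (inr V r • n)) = σ (inr V r) • f (tmul m n))
    (t : RR V) (x : tensor M N) : f (t • x) = σ t • f x := by
  induction t using RR_induction V with
  | h0 => rw [zero_smul, map_zero, map_zero, zero_smul]
  | hadd a b ha hb => rw [add_smul, map_add, ha, hb, map_add, add_smul]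
  | hmul a b =>
    induction x using tmul_induction with
    | hadd x y hx hy => rw [smul_add, map_add, hx, hy, map_add, smul_add]
    | h m n => rw [mul_smul, inr_smul_tmul, inl_smul_tmul, hl, hr, map_mul, mul_smul]

/-- An additive map out of `M ⊗_R N` that respects both actions of `R`. -/
def tensorLin [Module (RR V) P] (f : tensor M N →+ P)
    (hl : ∀ r m n, f (tmul (inl V r • m) n) = inl V r • f (tmul m n))
    (hr : ∀ r m n, f (tmul m (inr V r • n)) = inr V r • f (tmul m n)) :
    tensor M N →ₗ[RR V] P where
  toFun := f
  map_add' := map_add f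
  map_smul' := tensor_map_smul f (AlgHom.id ℝ (RR V)) hl hr

end Lift

/-- `(m, n) ↦ m ⊗ n` as a biadditive map. -/
def tmulHom : M →+ N →+ tensor M N :=
  AddMonoidHom.mk' (fun m => AddMonoidHom.mk' (fun n => tmul m n) (tmul_add m))
    fun m m' => AddMonoidHom.ext fun n => add_tmul m m' n

theorem tmulHom_apply (m : M) (n : N) : tmulHom m n = tmul m n := rfl

/-- The functoriality of `M ⊗_R N` in `N`. -/
def tensorMap (M : GBimod V) (g : N →ₗ[RR V] N') : tensor M N →ₗ[RR V] tensor M N' :=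
  tensorLin (tensorLift ((AddMonoidHom.compHom.flip g.toAddMonoidHom).comp tmulHom) fun r m n => by
      change tmul (inr V r • m) (g n) = tmul m (g (inl V r • n))
      rw [tmul_balanced, map_smul])
    (fun r m n => (inl_smul_tmul r m (g n)).symm)
    (fun r m n => by
      change tmul m (g (inr V r • n)) = inr V r • tmul m (g n)
      rw [map_smul, inr_smul_tmul])

theorem tensorMap_tmul (g : N →ₗ[RR V] N') (m : M) (n : N) :
    tensorMap M g (tmul m n) = tmul m (g n) := rfl

/-- The map `n ⊗ n' ↦ (m ⊗ n) ⊗ n'`. -/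
def assocInvAt (m : M) : tensor N N' →+ tensor (tensor M N) N' :=
  tensorLift (tmulHom.comp (tmulHom m : N →+ tensor M N)) fun r n n' => by
    change tmul (tmul m (inr V r • n)) n' = tmul (tmul m n) (inl V r • n')
    rw [← inr_smul_tmul, tmul_balanced]

theorem assocInvAt_tmul (m : M) (n : N) (n' : N') :
    assocInvAt m (tmul n n') = tmul (tmul m n) n' := rfl

theorem assocInvAt_add (m m' : M) :
    (assocInvAt (m + m') : tensor N N' →+ _) = assocInvAt m + assocInvAt m' :=
  tensor_addHom_ext fun n n' => by
    rw [AddMonoidHom.add_apply, assocInvAt_tmul, assocInvAt_tmul, assocInvAt_tmul, add_tmul,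
      add_tmul]

theorem assocInvAt_balanced (r : R V) (m : M) (x : tensor N N') :
    assocInvAt (inr V r • m) x = assocInvAt m (inl V r • x) := by
  induction x using tmul_induction with
  | hadd x y hx hy => rw [map_add, smul_add, map_add, hx, hy]
  | h n n' => rw [inl_smul_tmul, assocInvAt_tmul, assocInvAt_tmul, tmul_balanced]

theorem assocInvAt_inl_smul (r : R V) (m : M) (x : tensor N N') :
    assocInvAt (inl V r • m) x = inl V r • assocInvAt m x := by
  induction x using tmul_induction with
  | hadd x y hx hy => rw [map_add, map_add, hx, hy, smul_add]
  | h n n' => rw [assocInvAt_tmul, assocInvAt_tmul, inl_smul_tmul, inl_smul_tmul]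

theorem assocInvAt_inr_smul (r : R V) (m : M) (x : tensor N N') :
    assocInvAt m (inr V r • x) = inr V r • assocInvAt m x := by
  induction x using tmul_induction with
  | hadd x y hx hy => rw [smul_add, map_add, map_add, hx, hy, smul_add]
  | h n n' => rw [inr_smul_tmul, assocInvAt_tmul, assocInvAt_tmul, inr_smul_tmul]

/-- The associativity map `M ⊗ (N ⊗ N') → (M ⊗ N) ⊗ N'`. -/
def assocInv (M N N' : GBimod V) : tensor M (tensor N N') →ₗ[RR V] tensor (tensor M N) N' :=
  tensorLin (tensorLift (AddMonoidHom.mk' assocInvAt assocInvAt_add) assocInvAt_balanced)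
    assocInvAt_inl_smul assocInvAt_inr_smul

theorem assocInv_tmul (m : M) (n : N) (n' : N') :
    assocInv M N N' (tmul m (tmul n n')) = tmul (tmul m n) n' := rfl

/-- The map `m ⊗ n ↦ m ⊗ (n ⊗ n')`. -/
def assocAt (n' : N') : tensor M N →+ tensor M (tensor N N') :=
  tensorLift ((AddMonoidHom.compHom.flip (tmulHom.flip n' : N →+ tensor N N')).comp tmulHom)
    fun r m n => by
      change tmul (inr V r • m) (tmul n n') = tmul m (tmul (inl V r • n) n')
      rw [tmul_balanced, inl_smul_tmul]

theorem assocAt_tmul (m : M) (n : N) (n' : N') :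
    assocAt n' (tmul m n) = tmul m (tmul n n') := rfl

theorem assocAt_add (n₁ n₂ : N') :
    (assocAt (n₁ + n₂) : tensor M N →+ _) = assocAt n₁ + assocAt n₂ :=
  tensor_addHom_ext fun m n => by
    rw [AddMonoidHom.add_apply, assocAt_tmul, assocAt_tmul, assocAt_tmul, tmul_add, tmul_add]

theorem assocAt_balanced (r : R V) (x : tensor M N) (n' : N') :
    assocAt n' (inr V r • x) = assocAt (inl V r • n') x := by
  induction x using tmul_induction with
  | hadd x y hx hy => rw [map_add, smul_add, map_add, hx, hy]
  | h m n => rw [inr_smul_tmul, assocAt_tmul, assocAt_tmul, tmul_balanced]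

theorem assocAt_inl_smul (r : R V) (x : tensor M N) (n' : N') :
    assocAt n' (inl V r • x) = inl V r • assocAt n' x := by
  induction x using tmul_induction with
  | hadd x y hx hy => rw [smul_add, map_add, map_add, hx, hy, smul_add]
  | h m n => rw [inl_smul_tmul, assocAt_tmul, assocAt_tmul, inl_smul_tmul]

theorem assocAt_inr_smul (r : R V) (x : tensor M N) (n' : N') :
    assocAt (inr V r • n') x = inr V r • assocAt n' x := by
  induction x using tmul_induction with
  | hadd x y hx hy => rw [map_add, map_add, hx, hy, smul_add]
  | h m n => rw [assocAt_tmul, assocAt_tmul, inr_smul_tmul, inr_smul_tmul]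

/-- `assocAt` as a biadditive map. -/
def assocHom : tensor M N →+ N' →+ tensor M (tensor N N') :=
  AddMonoidHom.flip (AddMonoidHom.mk' (G := tensor M N →+ tensor M (tensor N N'))
    (fun n' : N' => assocAt n') fun n₁ n₂ => assocAt_add n₁ n₂)

theorem assocHom_apply (x : tensor M N) (n' : N') : assocHom x n' = assocAt n' x := rfl

/-- The associativity map `(M ⊗ N) ⊗ N' → M ⊗ (N ⊗ N')`. -/
def assoc (M N N' : GBimod V) : tensor (tensor M N) N' →ₗ[RR V] tensor M (tensor N N') :=
  tensorLin (tensorLift assocHom fun r x n' => by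
      rw [assocHom_apply, assocHom_apply, assocAt_balanced])
    (fun r x n' => by
      rw [tensorLift_tmul, tensorLift_tmul, assocHom_apply, assocHom_apply, assocAt_inl_smul])
    (fun r x n' => by
      rw [tensorLift_tmul, tensorLift_tmul, assocHom_apply, assocHom_apply, assocAt_inr_smul])

theorem assoc_tmul (m : M) (n : N) (n' : N') :
    assoc M N N' (tmul (tmul m n) n') = tmul m (tmul n n') := rfl

/-- Only this half of associativity is needed: it makes `M ⊗ (N ⊗ N')` a direct summand of
`(M ⊗ N) ⊗ N'`. -/
theorem assoc_assocInv (x : tensor M (tensor N N')) :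
    assoc M N N' (assocInv M N N' x) = x := by
  induction x using tmul_induction with
  | hadd x y hx hy => rw [map_add, map_add, hx, hy]
  | h m y =>
    induction y using tmul_induction with
    | hadd x y hx hy => rw [tmul_add, map_add, map_add, hx, hy]
    | h n n' => rw [assocInv_tmul, assoc_tmul]

end Tensor

/-! ### Stratification of Soergel bimodules -/

section Cyclic

variable {V : Type u} [AddCommGroup V] [Module ℝ V]
variable {J : Ideal (RR V)} {hJ : J.IsHomogeneous fun n : ℕ => lin₂ V ^ n}

/-- The class of `1` in `(R ⊗ R) / J`. -/
def cyclicOne (hJ : J.IsHomogeneous fun n : ℕ => lin₂ V ^ n) : cyclic J hJ :=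
  Submodule.Quotient.mk (p := J) (1 : RR V)

theorem smul_cyclicOne_eq_zero {t : RR V} : t • cyclicOne hJ = 0 ↔ t ∈ J := by
  refine Iff.trans ?_ (Submodule.Quotient.mk_eq_zero J)
  change (Submodule.Quotient.mk (p := J) (t * 1) : RR V ⧸ J) = 0 ↔ _
  rw [mul_one]

theorem exists_eq_smul_cyclicOne (c : cyclic J hJ) : ∃ t : RR V, c = t • cyclicOne hJ := by
  obtain ⟨t, rfl⟩ := Submodule.mkQ_surjective J c
  refine ⟨t, ?_⟩
  change Submodule.Quotient.mk t = (Submodule.Quotient.mk (p := J) (t * 1) : RR V ⧸ J)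
  rw [mul_one]

variable {S : Type*} {M : CoxeterMatrix S} {W : Type*} [Group W] (cs : CoxeterSystem M W)
variable (𝔥 : Realisation M V)

/-- The restriction to `Gr_w` of a function on a closed subset that contains `Gr_w`. -/
def restrictCyclic (w : W) (h : ∀ t ∈ J, restrictGr cs 𝔥 w t = 0) : cyclic J hJ →+ R V :=
  QuotientAddGroup.lift (Submodule.toAddSubgroup J)
    ((restrictGr cs 𝔥 w : RR V →+* R V) : RR V →+ R V) h

theorem restrictCyclic_smul_one {w : W} (h : ∀ t ∈ J, restrictGr cs 𝔥 w t = 0) (t : RR V) :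
    restrictCyclic cs 𝔥 w h (t • cyclicOne hJ) = restrictGr cs 𝔥 w t := by
  change restrictGr cs 𝔥 w (t * 1) = _
  rw [mul_one]

theorem restrictCyclic_smul {w : W} (h : ∀ t ∈ J, restrictGr cs 𝔥 w t = 0) (t : RR V)
    (c : cyclic J hJ) :
    restrictCyclic cs 𝔥 w h (t • c) = restrictGr cs 𝔥 w t * restrictCyclic cs 𝔥 w h c := by
  obtain ⟨t', rfl⟩ := exists_eq_smul_cyclicOne c
  rw [← mul_smul, restrictCyclic_smul_one, restrictCyclic_smul_one, map_mul]

/-- The map `n ⊗ f ↦ n f|_{Gr_w}` from `N ⊗_R (R ⊗ R) / J` to `N`. -/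
def tensorRestrict (N : GBimod V) (w : W) (h : ∀ t ∈ J, restrictGr cs 𝔥 w t = 0) :
    tensor N (cyclic J hJ) →+ N :=
  tensorLift (AddMonoidHom.mk' (fun n => AddMonoidHom.mk'
    (fun c => inr V (restrictCyclic cs 𝔥 w h c) • n) fun c c' => by rw [map_add, map_add, add_smul])
    fun n n' => AddMonoidHom.ext fun c => smul_add _ n n')
    fun r n c => by
      change inr V _ • inr V r • n = inr V (restrictCyclic cs 𝔥 w h (inl V r • c)) • n
      rw [restrictCyclic_smul, restrictGr_inl, map_mul, mul_comm, mul_smul]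

theorem tensorRestrict_tmul {N : GBimod V} {w : W} (h : ∀ t ∈ J, restrictGr cs 𝔥 w t = 0) (n : N)
    (c : cyclic J hJ) :
    tensorRestrict cs 𝔥 N w h (tmul n c) = inr V (restrictCyclic cs 𝔥 w h c) • n := rfl

theorem tensorRestrict_smul {N : GBimod V} {w : W} (h : ∀ t ∈ J, restrictGr cs 𝔥 w t = 0)
    (t : RR V) (x : tensor N (cyclic J hJ)) :
    tensorRestrict cs 𝔥 N w h (t • x) = twist cs 𝔥 w t • tensorRestrict cs 𝔥 N w h x := by
  refine tensor_map_smul _ _ (fun r n c => ?_) (fun r n c => ?_) t x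
  · rw [tensorRestrict_tmul, tensorRestrict_tmul, twist_inl, smul_comm]
  · rw [tensorRestrict_tmul, tensorRestrict_tmul, twist_inr, restrictCyclic_smul, restrictGr_inr,
      map_mul, mul_smul]

/-- The map `n ⊗ c ↦ n c` for a quotient of `R`, as a map of bimodules. -/
def tensorRestrictOne (N : GBimod V) (h : ∀ t ∈ J, restrictGr cs 𝔥 1 t = 0) :
    tensor N (cyclic J hJ) →ₗ[RR V] N where
  toFun := tensorRestrict cs 𝔥 N 1 h
  map_add' := map_add _
  map_smul' t x := by rw [tensorRestrict_smul, twist_one, RingHom.id_apply]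

theorem tensorRestrictOne_apply {N : GBimod V} (h : ∀ t ∈ J, restrictGr cs 𝔥 1 t = 0)
    (x : tensor N (cyclic J hJ)) :
    tensorRestrictOne cs 𝔥 N h x = tensorRestrict cs 𝔥 N 1 h x := rfl

/-- `n ↦ n ⊗ c`, linear for the left actions. -/
def tmulRight {N : GBimod V} (N' : GBimod V) (c : N) : N' →ₗ[R V] tensor N' N where
  toFun n := tmul n c
  map_add' n n' := add_tmul n n' c
  map_smul' f n := (inl_smul_tmul f n c).symm

theorem tmulRight_apply {N N' : GBimod V} (c : N) (n : N') : tmulRight N' c n = tmul n c := rfl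

theorem restrictGr_eq_zero_of_mem {t : RR V} {X : Set W} {x : W} (hx : x ∈ X)
    (ht : t ∈ idealGr cs 𝔥 X) : restrictGr cs 𝔥 x t = 0 := by
  have := (Submodule.mem_iInf _).mp ht x
  exact (Submodule.mem_iInf _).mp this hx

theorem mem_idealGr_singleton {t : RR V} {x : W} :
    t ∈ idealGr cs 𝔥 {x} ↔ restrictGr cs 𝔥 x t = 0 := by
  rw [idealGr, iInf_singleton]
  exact RingHom.mem_ker

theorem inr_smul_one_eq (r : R V) :
    inr V r • cyclicOne (idealGr_isHomogeneous cs 𝔥 {1}) =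
      inl V r • cyclicOne (idealGr_isHomogeneous cs 𝔥 {1}) := by
  rw [← sub_eq_zero, ← sub_smul, smul_cyclicOne_eq_zero, mem_idealGr_singleton, map_sub,
    restrictGr_inl, restrictGr_inr, act_one, sub_self]

theorem tmulRight_one_smul {N : GBimod V} (t : RR V) (n : N) :
    tmulRight N (cyclicOne (idealGr_isHomogeneous cs 𝔥 {1})) (t • n) =
      t • tmulRight N (cyclicOne (idealGr_isHomogeneous cs 𝔥 {1})) n := by
  induction t using RR_induction V with
  | h0 => rw [zero_smul, zero_smul, map_zero]
  | hadd a b ha hb => rw [add_smul, map_add, ha, hb, add_smul]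
  | hmul f g =>
    rw [mul_smul, mul_smul, tmulRight_apply, tmulRight_apply, inr_smul_tmul, inr_smul_one_eq,
      ← tmul_balanced, inl_smul_tmul]

/-- `N` is a direct summand of `N ⊗_R R(id)`. -/
theorem isStratified_tensor_one {N : GBimod V} (hN : IsStratified cs 𝔥 N) :
    IsStratified cs 𝔥 (tensor N (RGr cs 𝔥 {1})) := by
  have h : ∀ t ∈ idealGr cs 𝔥 {1}, restrictGr cs 𝔥 1 t = 0 := fun t ht =>
    restrictGr_eq_zero_of_mem cs 𝔥 (Set.mem_singleton _) ht
  let p : N →ₗ[RR V] tensor N (cyclic _ (idealGr_isHomogeneous cs 𝔥 {1})) :=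
    { toFun := tmulRight N (cyclicOne (idealGr_isHomogeneous cs 𝔥 {1}))
      map_add' := map_add _
      map_smul' := tmulRight_one_smul cs 𝔥 }
  change IsStratified cs 𝔥 (tensor N (cyclic _ (idealGr_isHomogeneous cs 𝔥 {1})))
  refine IsStratified.of_retract (tensorRestrictOne cs 𝔥 N h) p (fun x => ?_) hN
  induction x using tmul_induction with
  | hadd x y hx hy => rw [map_add, map_add, hx, hy]
  | h n c =>
    obtain ⟨t, rfl⟩ := exists_eq_smul_cyclicOne c
    rw [tensorRestrictOne_apply, tensorRestrict_tmul, restrictCyclic_smul_one]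
    change tmulRight N _ _ = _
    induction t using RR_induction V with
    | h0 => rw [map_zero, map_zero, zero_smul, zero_smul, map_zero, tmul_zero]
    | hadd a b ha hb => rw [map_add, map_add, add_smul, map_add, ha, hb, add_smul, tmul_add]
    | hmul f g =>
      rw [map_mul, restrictGr_inl, restrictGr_inr, act_one, map_mul, mul_comm, mul_smul,
        tmulRight_one_smul, tmulRight_apply, inr_smul_tmul, tmul_balanced, smul_comm, mul_smul,
        smul_comm]

theorem act_root (s : S) : act cs 𝔥 (cs.simple s) (lf (𝔥.root s)) = -lf (𝔥.root s) := by
  rw [act_lf, dualAct_simple_root, map_neg]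

theorem restrictGr_one_of_mem_idealInv {s : S} {t : RR V} (ht : t ∈ idealInv cs 𝔥 s) :
    restrictGr cs 𝔥 1 t = 0 := by
  have : idealInv cs 𝔥 s ≤ RingHom.ker (restrictGr cs 𝔥 1) := Ideal.span_le.mpr (by
    rintro _ ⟨f, hf, rfl⟩
    rw [SetLike.mem_coe, RingHom.mem_ker, map_sub, restrictGr_inl, restrictGr_inr, act_one,
      sub_self])
  exact this ht

theorem restrictGr_simple_of_mem_idealInv {s : S} {t : RR V} (ht : t ∈ idealInv cs 𝔥 s) :
    restrictGr cs 𝔥 (cs.simple s) t = 0 := by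
  have : idealInv cs 𝔥 s ≤ RingHom.ker (restrictGr cs 𝔥 (cs.simple s)) := Ideal.span_le.mpr (by
    rintro _ ⟨f, hf, rfl⟩
    rw [SetLike.mem_coe, RingHom.mem_ker, map_sub, restrictGr_inl, restrictGr_inr, sub_eq_zero]
    exact Eq.symm hf)
  exact this ht

theorem inr_smul_one_of_mem_invariants {s : S} {a : R V} (ha : a ∈ invariants cs 𝔥 s) :
    inr V a • cyclicOne (idealInv_isHomogeneous cs 𝔥 s) =
      inl V a • cyclicOne (idealInv_isHomogeneous cs 𝔥 s) := by
  rw [eq_comm, ← sub_eq_zero, ← sub_smul, smul_cyclicOne_eq_zero]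
  exact Ideal.subset_span ⟨a, ha, rfl⟩

/-- Since `R` is generated by `1` and `α_s` over `R^s`, so is `N ⊗_R R ⊗_{R^s} R` over `N`. -/
theorem exists_tmul_idealInv {s : S} {N : GBimod V}
    (x : tensor N (cyclic _ (idealInv_isHomogeneous cs 𝔥 s))) : ∃ n m : N,
      x = tmul n (cyclicOne (idealInv_isHomogeneous cs 𝔥 s)) +
        tmul m (inr V (lf (𝔥.root s)) • cyclicOne (idealInv_isHomogeneous cs 𝔥 s)) := by
  have hadd : ∀ x y : tensor N (cyclic _ (idealInv_isHomogeneous cs 𝔥 s)), (∃ n m : N,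
      x = tmul n (cyclicOne (idealInv_isHomogeneous cs 𝔥 s)) +
        tmul m (inr V (lf (𝔥.root s)) • cyclicOne (idealInv_isHomogeneous cs 𝔥 s))) → (∃ n m : N,
      y = tmul n (cyclicOne (idealInv_isHomogeneous cs 𝔥 s)) +
        tmul m (inr V (lf (𝔥.root s)) • cyclicOne (idealInv_isHomogeneous cs 𝔥 s))) → ∃ n m : N,
      x + y = tmul n (cyclicOne (idealInv_isHomogeneous cs 𝔥 s)) +
        tmul m (inr V (lf (𝔥.root s)) • cyclicOne (idealInv_isHomogeneous cs 𝔥 s)) := by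
    rintro _ _ ⟨n, m, rfl⟩ ⟨n', m', rfl⟩
    exact ⟨n + n', m + m', by rw [add_tmul, add_tmul, add_add_add_comm]⟩
  induction x using tmul_induction with
  | hadd x y hx hy => exact hadd x y hx hy
  | h n c =>
    obtain ⟨t, rfl⟩ := exists_eq_smul_cyclicOne c
    induction t using RR_induction V with
    | h0 =>
      exact ⟨0, 0, by rw [zero_smul, tmul_zero, zero_tmul, zero_tmul, add_zero]⟩
    | hadd a b ha hb =>
      rw [add_smul, tmul_add]
      exact hadd _ _ ha hb
    | hmul f g =>
      obtain ⟨a, ha, b, hb, rfl⟩ := exists_invariants cs 𝔥 s g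
      refine ⟨inr V f • inr V a • n, inr V f • inr V b • n, ?_⟩
      rw [mul_smul, ← tmul_balanced, map_add, add_smul, tmul_add,
        inr_smul_one_of_mem_invariants _ _ ha, ← tmul_balanced, mul_comm b, map_mul,
        mul_smul, inr_smul_one_of_mem_invariants _ _ hb,
        smul_comm (inr V (lf (𝔥.root s))) (inl V b), ← tmul_balanced]
      simp only [← mul_smul, mul_comm]

/-- `N ⊗_R R ⊗_{R^s} R` is induced from `N`. -/
def inductionCyclic (s : S) (N : GBimod V) :
    Induction cs 𝔥 s N (tensor N (cyclic _ (idealInv_isHomogeneous cs 𝔥 s))) where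
  fst := tensorRestrictOne cs 𝔥 N fun _ => restrictGr_one_of_mem_idealInv cs 𝔥
  snd := tensorRestrict cs 𝔥 N (cs.simple s) fun _ => restrictGr_simple_of_mem_idealInv cs 𝔥
  snd_smul := tensorRestrict_smul cs 𝔥 _
  one := tmulRight N (cyclicOne (idealInv_isHomogeneous cs 𝔥 s))
  root := tmulRight N (inr V (lf (𝔥.root s)) • cyclicOne (idealInv_isHomogeneous cs 𝔥 s))
  fst_one n := by
    rw [tmulRight_apply, tensorRestrictOne_apply, tensorRestrict_tmul,
      ← one_smul (RR V) (cyclicOne _), restrictCyclic_smul_one, map_one, map_one, one_smul]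
  snd_one n := by
    rw [tmulRight_apply, tensorRestrict_tmul,
      ← one_smul (RR V) (cyclicOne _), restrictCyclic_smul_one, map_one, map_one, one_smul]
  fst_root n := by
    rw [tmulRight_apply, tensorRestrictOne_apply, tensorRestrict_tmul, restrictCyclic_smul_one,
      restrictGr_inr, act_one]
  snd_root n := by
    rw [tmulRight_apply, tensorRestrict_tmul, restrictCyclic_smul_one,
      restrictGr_inr, act_root, map_neg, neg_smul]
  exists_eq := exists_tmul_idealInv cs 𝔥

theorem IsStratified.tensor_shift {N B : GBimod V} {j : ℤ} (h : IsStratified cs 𝔥 (tensor N B)) :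
    IsStratified cs 𝔥 (tensor N (B.shift j)) := by
  let i : B.shift j →ₗ[RR V] B := (LinearMap.id : B →ₗ[RR V] B)
  let p : B →ₗ[RR V] B.shift j := (LinearMap.id : B →ₗ[RR V] B)
  refine IsStratified.of_retract (tensorMap N i) (tensorMap N p) (fun x => ?_) h
  induction x using tmul_induction with
  | hadd x y hx hy => rw [map_add, map_add, hx, hy]
  | h n b => rw [tensorMap_tmul, tensorMap_tmul]; rfl

theorem IsStratified.tensor_dsum {N : GBimod V} {k : ℕ} {B : Fin k → GBimod V}
    (h : ∀ j, IsStratified cs 𝔥 (tensor N (B j))) :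
    IsStratified cs 𝔥 (tensor N (GBimod.dsum B)) := by
  let pr : ∀ j, GBimod.dsum B →ₗ[RR V] B j := fun j =>
    (LinearMap.proj j : (∀ j, B j) →ₗ[RR V] B j)
  let inc : ∀ j, B j →ₗ[RR V] GBimod.dsum B := fun j =>
    (LinearMap.single (RR V) (fun j => (B j).carrier) j : B j →ₗ[RR V] ∀ j, B j)
  have hinc : ∀ b : GBimod.dsum B, ∑ j, inc j (pr j b) = b := fun b =>
    Finset.univ_sum_single (M := fun j => (B j).carrier) b
  refine IsStratified.of_retract (LinearMap.pi fun j => tensorMap N (pr j))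
    (∑ j, tensorMap N (inc j) ∘ₗ LinearMap.proj j) (fun x => ?_) (IsStratified.pi h)
  rw [LinearMap.sum_apply]
  simp only [LinearMap.comp_apply, LinearMap.proj_apply, LinearMap.pi_apply]
  induction x using tmul_induction with
  | hadd x y hx hy => simp only [map_add, Finset.sum_add_distrib, hx, hy]
  | h n b =>
    simp only [tensorMap_tmul]
    refine (map_sum (tmulHom n : GBimod.dsum B →+ tensor N (GBimod.dsum B)) _ _).symm.trans ?_
    rw [hinc]
    rfl

/-- Tensoring with a Soergel bimodule on the right preserves stratified bimodules. The induction
over the Soergel bimodules works because `N` is arbitrary: then `N ⊗ (B ⊗ B')` is `(N ⊗ B) ⊗ B'`. -/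
theorem IsStratified.tensor_of_isSoergel [FiniteDimensional ℝ V] {B : GBimod V}
    (hB : IsSoergel cs 𝔥 B) :
    ∀ {N : GBimod V}, IsStratified cs 𝔥 N → IsStratified cs 𝔥 (tensor N B) := by
  induction hB with
  | unit => exact fun hN => isStratified_tensor_one cs 𝔥 hN
  | gen s =>
    exact fun hN => IsStratified.tensor_shift cs 𝔥 ((inductionCyclic cs 𝔥 s _).isStratified hN)
  | tensor _ _ h1 h2 =>
    exact fun hN =>
      IsStratified.of_retract (assocInv _ _ _) (assoc _ _ _) assoc_assocInv (h2 (h1 hN))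
  | dsum M _ h => exact fun hN => IsStratified.tensor_dsum cs 𝔥 fun j => h j hN
  | shift j _ h => exact fun hN => IsStratified.tensor_shift cs 𝔥 (h hN)
  | summand i p hip _ h =>
    refine fun {N} hN => IsStratified.of_retract (tensorMap N i.toLin) (tensorMap N p.toLin)
      (fun x => ?_) (h hN)
    induction x using tmul_induction with
    | hadd x y hx hy => rw [map_add, map_add, hx, hy]
    | h n b => rw [tensorMap_tmul, tensorMap_tmul, hip]

/-- All Soergel bimodules are stratified: `B` is a direct summand of `R(id) ⊗_R B`. -/
theorem isStratified_of_isSoergel [FiniteDimensional ℝ V] {B : GBimod V} (hB : IsSoergel cs 𝔥 B) :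
    IsStratified cs 𝔥 B := by
  have h1 : IsStratified cs 𝔥 (cyclic _ (idealGr_isHomogeneous cs 𝔥 {1})) :=
    IsStratified.of_cyclic_one (g := cyclicOne (idealGr_isHomogeneous cs 𝔥 {1}))
      (fun t => smul_cyclicOne_eq_zero.trans (mem_idealGr_singleton cs 𝔥)) exists_eq_smul_cyclicOne
  have h : ∀ t ∈ idealGr cs 𝔥 {1}, restrictGr cs 𝔥 1 t = 0 := fun t =>
    (mem_idealGr_singleton cs 𝔥).mp
  have h2 := IsStratified.tensor_of_isSoergel cs 𝔥 hB h1
  let p₀ : tensor (cyclic _ (idealGr_isHomogeneous cs 𝔥 {1})) B →+ B :=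
    tensorLift (AddMonoidHom.mk' (fun c => AddMonoidHom.mk'
      (fun b => inl V (restrictCyclic cs 𝔥 1 h c) • b) fun b b' => smul_add _ b b')
      fun c c' => AddMonoidHom.ext fun b => by
        change inl V (restrictCyclic cs 𝔥 1 h (c + c')) • b = inl V _ • b + inl V _ • b
        rw [map_add, map_add, add_smul])
      fun r c b => by
        change inl V (restrictCyclic cs 𝔥 1 h (inr V r • c)) • b = inl V _ • inl V r • b
        rw [restrictCyclic_smul, restrictGr_inr, act_one, map_mul, mul_comm, mul_smul]
  have hp₀ : ∀ c b, p₀ (tmul c b) = inl V (restrictCyclic cs 𝔥 1 h c) • b := fun _ _ => rfl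
  let p := tensorLin p₀ (fun r c b => by
      rw [hp₀, hp₀, restrictCyclic_smul, restrictGr_inl, map_mul, mul_smul])
    (fun r c b => by rw [hp₀, hp₀, smul_comm])
  let g := cyclicOne (idealGr_isHomogeneous cs 𝔥 {1})
  have hi : ∀ (t : RR V) (b : B), tmulHom g (t • b) = t • tmulHom g b := fun t b => by
    induction t using RR_induction V with
    | h0 => rw [zero_smul, zero_smul, map_zero]
    | hadd a b ha hb => rw [add_smul, map_add, ha, hb, add_smul]
    | hmul f f' =>
      rw [mul_smul, mul_smul, tmulHom_apply, tmulHom_apply, inr_smul_tmul, ← tmul_balanced,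
        inr_smul_one_eq, inl_smul_tmul]
  let i : B →ₗ[RR V] tensor (cyclic _ (idealGr_isHomogeneous cs 𝔥 {1})) B :=
    { toFun := tmulHom g, map_add' := map_add _, map_smul' := hi }
  refine IsStratified.of_retract i p (fun b => ?_) h2
  change p₀ (tmul g b) = b
  rw [hp₀, ← one_smul (RR V) g, restrictCyclic_smul_one, map_one, map_one, one_smul]

end Cyclic

/-! ### Residues at the origin -/

section Residue

variable {V : Type u} [AddCommGroup V] [Module ℝ V]

/-- The value of a polynomial function at the origin. -/
abbrev constTerm : R V →ₐ[ℝ] ℝ := SymmetricAlgebra.algebraMapInv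

theorem mem_augIdeal {f : R V} : f ∈ augIdeal V ↔ constTerm f = 0 := RingHom.mem_ker

theorem constTerm_algebraMap (c : ℝ) : constTerm (algebraMap ℝ (R V) c) = c :=
  SymmetricAlgebra.algebraMap_leftInverse _ _

variable {P : Type*} [AddCommGroup P] [Module (R V) P] {ι : Type*} [Fintype ι] [DecidableEq ι]

/-- If `v` is linearly independent modulo the augmentation ideal in a projective module, there are
linear functionals that are dual to `v` modulo the augmentation ideal. -/
theorem exists_dual_of_projective [Module.Projective (R V) P] (v : ι → P)
    (hv : ∀ a : ι → ℝ, ∑ i, algebraMap ℝ (R V) (a i) • v i ∈ augIdeal V • (⊤ : Submodule (R V) P) →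
      a = 0) :
    ∃ L : ι → P →ₗ[R V] R V, ∀ k i, constTerm (L k (v i)) = (1 : Matrix ι ι ℝ) k i := by
  obtain ⟨σ, hσ⟩ := Module.projective_def'.mp ‹Module.Projective (R V) P›
  let red : (P →₀ R V) →ₗ[ℝ] (P →₀ ℝ) := Finsupp.mapRange.linearMap constTerm.toLinearMap
  -- the residues of the coordinates of the `v i`
  let w : (ι → ℝ) →ₗ[ℝ] (P →₀ ℝ) := Fintype.linearCombination ℝ fun i => red (σ (v i))
  have hw : LinearMap.ker w = ⊥ := by
    refine LinearMap.ker_eq_bot'.mpr fun a ha => hv a ?_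
    rw [← LinearMap.id_apply (R := R V) (∑ i, algebraMap ℝ (R V) (a i) • v i), ← hσ,
      LinearMap.comp_apply, Finsupp.linearCombination_apply]
    refine Submodule.sum_mem _ fun q _ => Submodule.smul_mem_smul ?_ trivial
    have h1 := DFunLike.congr_fun ha q
    rw [Fintype.linearCombination_apply, Finsupp.finsetSum_apply] at h1
    rw [mem_augIdeal, map_sum, Finsupp.finsetSum_apply, map_sum]
    refine Eq.trans (Finset.sum_congr rfl fun i _ => ?_) h1
    rw [map_smul, Finsupp.smul_apply, smul_eq_mul, map_mul, constTerm_algebraMap]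
    rfl
  obtain ⟨g, hg⟩ := LinearMap.exists_leftInverse_of_injective w hw
  refine ⟨fun k => Finsupp.linearCombination (R V)
    (fun q => algebraMap ℝ (R V) (g (Finsupp.single q 1) k)) ∘ₗ σ, fun k i => ?_⟩
  have key : ∀ z : P →₀ R V, constTerm (Finsupp.linearCombination (R V)
      (fun q => algebraMap ℝ (R V) (g (Finsupp.single q 1) k)) z) = g (red z) k := fun z => by
    induction z using Finsupp.induction_linear with
    | zero => simp
    | add x y hx hy => rw [map_add, map_add, hx, hy, map_add, map_add, Pi.add_apply]
    | single q f =>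
      have : red (Finsupp.single q f) = constTerm f • Finsupp.single q (1 : ℝ) := by
        rw [Finsupp.smul_single, smul_eq_mul, mul_one]
        exact Finsupp.mapRange_single (hf := map_zero _)
      rw [this, map_smul, Finsupp.linearCombination_single, smul_eq_mul, map_mul,
        constTerm_algebraMap]
      rfl
  rw [LinearMap.comp_apply, key]
  have h2 := LinearMap.congr_fun hg (Pi.single i 1)
  rw [LinearMap.comp_apply, Fintype.linearCombination_apply_single, one_smul] at h2
  rw [h2, LinearMap.id_apply, Matrix.one_apply, Pi.single_apply]

/-- If `v` is linearly independent modulo the augmentation ideal in a projective module, then `p`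
divides a combination of `v` only if it divides the coefficients. Here `p` may be any element that
is coprime to the polynomials with constant term `1`. -/
theorem dvd_of_sum_smul_eq [Module.Projective (R V) P] (v : ι → P)
    (hv : ∀ a : ι → ℝ, ∑ i, algebraMap ℝ (R V) (a i) • v i ∈ augIdeal V • (⊤ : Submodule (R V) P) →
      a = 0)
    {p : R V} (hp : ∀ u f : R V, constTerm u = 1 → p ∣ u * f → p ∣ f) {f : ι → R V} {n : P}
    (h : ∑ i, f i • v i = p • n) (i : ι) : p ∣ f i := by
  obtain ⟨L, hL⟩ := exists_dual_of_projective v hv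
  let G : Matrix ι ι (R V) := Matrix.of fun k i => L k (v i)
  have hG : (constTerm : R V →ₐ[ℝ] ℝ).mapMatrix G = 1 := Matrix.ext fun k i => hL k i
  -- Cramer's rule, for the matrix of pairings with the dual functionals
  have hdet : constTerm G.det = 1 := by
    rw [AlgHom.map_det, hG, Matrix.det_one]
  refine hp _ _ hdet ?_
  have h1 : G.mulVec f = p • fun k => L k n := funext fun k => by
    have := congrArg (L k) h
    rw [map_sum, map_smul] at this
    rw [Pi.smul_apply, ← this]
    exact Finset.sum_congr rfl fun i _ => by rw [map_smul, smul_eq_mul, mul_comm]; rfl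
  have h2 : G.det • f = p • G.adjugate.mulVec fun k => L k n := by
    rw [← Matrix.mulVec_smul, ← h1, Matrix.mulVec_mulVec, Matrix.adjugate_mul, Matrix.smul_mulVec,
      Matrix.one_mulVec]
  exact ⟨_, congrFun h2 i⟩

/-- The case `p = 0` of the divisibility of coefficients. -/
theorem eq_zero_of_sum_smul_eq_zero [Module.Projective (R V) P] (v : ι → P)
    (hv : ∀ a : ι → ℝ, ∑ i, algebraMap ℝ (R V) (a i) • v i ∈ augIdeal V • (⊤ : Submodule (R V) P) →
      a = 0)
    {f : ι → R V} (h : ∑ i, f i • v i = 0) (i : ι) : f i = 0 := by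
  refine zero_dvd_iff.mp (dvd_of_sum_smul_eq v hv (p := 0) (n := 0) (fun u g hu hd => ?_) ?_ i)
  · rw [zero_dvd_iff] at hd ⊢
    refine (mul_eq_zero.mp hd).resolve_left ?_
    rintro rfl
    rw [map_zero] at hu
    exact zero_ne_one hu
  · rw [h, smul_zero]

theorem lf_dvd_of_dvd_mul {β : Module.Dual ℝ V} (hβ : β ≠ 0) (u f : R V) (hu : constTerm u = 1)
    (hd : lf β ∣ u * f) : lf β ∣ f := by
  refine ((prime_lf hβ).dvd_or_dvd hd).resolve_left ?_
  rintro ⟨g, rfl⟩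
  rw [map_mul, mem_augIdeal.mp (lf_mem_augIdeal β), zero_mul] at hu
  exact zero_ne_one hu

end Residue

/-! ### Homogeneous generators -/

section Graded

variable {V : Type u} [AddCommGroup V] [Module ℝ V]

instance (B : GBimod V) : IsScalarTower ℝ (R V) B where
  smul_assoc c f b := by
    rw [← inl_smul, ← inl_smul, map_smul, smul_assoc]

variable {E : GBimod V}

/-- Homogeneity of a real subspace. -/
def IsHomog (T : Set E) : Prop := ∀ i, ∀ n ∈ T, projOf E.isInternal i n ∈ T

theorem inl_mem_pow {f : R V} {k : ℕ} (hf : f ∈ lin V ^ k) : inl V f ∈ lin₂ V ^ k := by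
  have h := Submodule.mem_map_of_mem (f := (inl V).toLinearMap) hf
  rw [Submodule.map_pow] at h
  exact pow_le_pow_left' (inl_lin_le V) k h

theorem constTerm_of_mem_pow {f : R V} {k : ℕ} (hk : k ≠ 0) (hf : f ∈ lin V ^ k) :
    constTerm f = 0 := by
  have h := Submodule.mem_map_of_mem (f := (constTerm : R V →ₐ[ℝ] ℝ).toLinearMap) hf
  rw [Submodule.map_pow] at h
  have h0 : (lin V).map (constTerm : R V →ₐ[ℝ] ℝ).toLinearMap = ⊥ := by
    refine eq_bot_iff.mpr ?_
    rintro _ ⟨_, ⟨l, rfl⟩, rfl⟩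
    exact mem_augIdeal.mp (lf_mem_augIdeal l)
  rw [h0, ← Submodule.zero_eq_bot, zero_pow hk] at h
  exact h

/-- The lowest component of `f n` for a homogeneous `n` is `f(0) n`. -/
theorem proj_smul_eq_constTerm (f : R V) {i : ℤ} {n : E} (hn : n ∈ E.deg i) :
    projOf E.isInternal i (f • n) = constTerm f • n := by
  induction f using DirectSum.Decomposition.inductionOn (fun n : ℕ => lin V ^ n) with
  | zero => rw [zero_smul, map_zero, map_zero, zero_smul]
  | add x y hx hy => rw [add_smul, map_add, hx, hy, map_add, add_smul]
  | @homogeneous k x =>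
    obtain ⟨x, hx⟩ := x
    by_cases hk : k = 0
    · subst hk
      rw [pow_zero, Submodule.mem_one] at hx
      obtain ⟨c, rfl⟩ := hx
      change projOf E.isInternal i (algebraMap ℝ (R V) c • n) = constTerm (algebraMap ℝ (R V) c) • n
      rw [constTerm_algebraMap, algebraMap_smul, projOf_same _ (Submodule.smul_mem _ c hn)]
    · change projOf E.isInternal i (x • n) = constTerm x • n
      rw [constTerm_of_mem_pow hk hx, zero_smul, ← inl_smul]
      exact projOf_ne _ (by omega) (E.smul_mem k i _ n (inl_mem_pow hx) hn)

theorem isHomog_span {v : Set E} (hv : ∀ n ∈ v, ∃ i, n ∈ E.deg i) :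
    IsHomog (Submodule.span (R V) v : Set E) := by
  intro i n hn
  rw [SetLike.mem_coe] at hn ⊢
  induction hn using Submodule.span_induction generalizing i with
  | mem n h =>
    obtain ⟨j, hj⟩ := hv n h
    by_cases hij : j = i
    · subst hij; rw [projOf_same _ hj]; exact Submodule.subset_span h
    · rw [projOf_ne _ hij hj]; exact Submodule.zero_mem _
  | zero => rw [map_zero]; exact Submodule.zero_mem _
  | add x y _ _ hx hy => rw [map_add]; exact Submodule.add_mem _ (hx i) (hy i)
  | smul f x _ hx =>
    induction f using DirectSum.Decomposition.inductionOn (fun n : ℕ => lin V ^ n) with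
    | zero => rw [zero_smul, map_zero]; exact Submodule.zero_mem _
    | add f g hf hg => rw [add_smul, map_add]; exact Submodule.add_mem _ hf hg
    | @homogeneous k f =>
      have := proj_smul_of_mem E (inl_mem_pow f.2) (i - 2 * k) x
      rw [sub_add_cancel, inl_smul, inl_smul] at this
      rw [this]
      exact Submodule.smul_mem _ _ (hx _)

theorem IsHomog.sup {T T' : Submodule (R V) E} (h : IsHomog (T : Set E))
    (h' : IsHomog (T' : Set E)) : IsHomog ((T ⊔ T' : Submodule (R V) E) : Set E) := by
  intro i n hn
  obtain ⟨a, ha, b, hb, rfl⟩ := Submodule.mem_sup.mp hn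
  rw [map_add]
  exact Submodule.add_mem_sup (h i a ha) (h' i b hb)

/-- The graded Nakayama lemma. By the ungraded one, some `r` with constant term `1` maps everything
into `T`, and for homogeneous `n` the lowest component of `r n` is `n`. -/
theorem eq_top_of_isHomog [Module.Finite (R V) E] {T : Submodule (R V) E}
    (hT : IsHomog (T : Set E)) (h : ⊤ ≤ T ⊔ augIdeal V • ⊤) : T = ⊤ := by
  obtain ⟨r, hr, hrT⟩ := Submodule.exists_sub_one_mem_and_smul_le_of_fg_of_le_sup
    Module.Finite.fg_top le_top h
  have hr1 : constTerm r = 1 := by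
    have := mem_augIdeal.mp hr
    rwa [map_sub, map_one, sub_eq_zero] at this
  refine eq_top_iff.mpr fun n _ => ?_
  induction n using internal_induction E.isInternal with
  | h0 => exact Submodule.zero_mem _
  | hadd x y hx hy => exact Submodule.add_mem _ (hx trivial) (hy trivial)
  | hom i n hn =>
    have h1 := hT i _ (hrT (Submodule.smul_mem_pointwise_smul n r ⊤ trivial))
    rwa [proj_smul_eq_constTerm r hn, hr1, one_smul] at h1

theorem smul_sub_constTerm_smul_mem (f : R V) (n : E) :
    f • n - constTerm f • n ∈ augIdeal V • (⊤ : Submodule (R V) E) := by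
  rw [← algebraMap_smul (R V) (constTerm f) n, ← sub_smul]
  exact Submodule.smul_mem_smul (sub_algebraMap_mem_augIdeal f) trivial

theorem finite_quotient [Module.Finite (R V) E] {U : Submodule (R V) E} (hU : augIdeal V • ⊤ ≤ U) :
    Module.Finite ℝ (E ⧸ U) := by
  classical
  obtain ⟨s, hs⟩ := Module.finite_def.mp ‹Module.Finite (R V) E›
  refine ⟨⟨s.image U.mkQ, eq_top_iff.mpr fun x _ => ?_⟩⟩
  obtain ⟨n, rfl⟩ := U.mkQ_surjective x
  have hn : n ∈ Submodule.span (R V) (s : Set E) := by rw [hs]; trivial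
  induction hn using Submodule.span_induction with
  | mem n h => exact Submodule.subset_span (Finset.mem_image_of_mem _ h)
  | zero => rw [map_zero]; exact Submodule.zero_mem _
  | add x y _ _ hx hy => rw [map_add]; exact Submodule.add_mem _ (hx trivial) (hy trivial)
  | smul f x _ hx =>
    have h1 : U.mkQ (f • x) = constTerm f • U.mkQ x := by
      have := (Submodule.Quotient.mk_eq_zero U).mpr (hU (smul_sub_constTerm_smul_mem f x))
      rw [Submodule.Quotient.mk_sub, sub_eq_zero] at this
      exact this
    rw [h1]
    exact Submodule.smul_mem _ _ (hx trivial)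

/-- Homogeneous elements of a homogeneous submodule `P` that form a basis of its image modulo a
submodule `U` of finite codimension. -/
theorem exists_homogeneous_basis [Module.Finite (R V) E] {P U : Submodule (R V) E}
    (hP : IsHomog (P : Set E)) (hU : augIdeal V • ⊤ ≤ U) :
    ∃ (n : ℕ) (v : Fin n → E), (∀ i, v i ∈ P) ∧ (∀ i, ∃ j, v i ∈ E.deg j) ∧
      P ≤ Submodule.span (R V) (Set.range v) ⊔ U ∧
      ∀ a : Fin n → ℝ, ∑ i, algebraMap ℝ (R V) (a i) • v i ∈ U → a = 0 := by
  have := finite_quotient hU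
  let mk : E →ₗ[ℝ] E ⧸ U := U.mkQ.restrictScalars ℝ
  let κ := {n : E // n ∈ P ∧ ∃ j, n ∈ E.deg j}
  obtain ⟨κ', a, -, hspan, hind⟩ := exists_linearIndependent' ℝ fun n : κ => mk n
  have hfin : Finite κ' := hind.finite
  obtain ⟨n, ⟨e⟩⟩ := Finite.exists_equiv_fin κ'
  refine ⟨n, fun i => a (e.symm i), fun i => (a (e.symm i)).2.1, fun i => (a (e.symm i)).2.2,
    fun x hx => ?_, fun c hc => ?_⟩
  · have h1 : mk x ∈ Submodule.span ℝ (Set.range ((fun n : κ => mk n) ∘ a)) := by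
      obtain ⟨s, hs⟩ := projOf_sum E.isInternal x
      rw [hspan, ← hs s subset_rfl, map_sum]
      exact Submodule.sum_mem _ fun i _ =>
        Submodule.subset_span ⟨⟨_, hP i x hx, i, projOf_mem _ _ _⟩, rfl⟩
    have h2 : Submodule.span ℝ (Set.range ((fun n : κ => mk n) ∘ a)) ≤
        ((Submodule.span (R V)
          (Set.range fun i => (a (e.symm i) : E))).map U.mkQ).restrictScalars ℝ := by
      refine Submodule.span_le.mpr ?_
      rintro _ ⟨k, rfl⟩
      exact ⟨_, Submodule.subset_span
        ⟨e k, congrArg (fun k => (a k : E)) (e.symm_apply_apply k)⟩, rfl⟩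
    obtain ⟨y, hy, hxy⟩ := h2 h1
    have h3 : x - y ∈ U := (Submodule.Quotient.eq U).mp hxy.symm
    rw [← add_sub_cancel y x]
    exact Submodule.add_mem_sup hy h3
  · have h1 := Fintype.linearIndependent_iff.mp (hind.comp e.symm e.symm.injective) c ?_
    · exact funext h1
    · have h2 : mk (∑ i, algebraMap ℝ (R V) (c i) • (a (e.symm i) : E)) = 0 :=
        (Submodule.Quotient.mk_eq_zero U).mpr hc
      rw [map_sum] at h2
      refine Eq.trans (Finset.sum_congr rfl fun i _ => ?_) h2
      rw [algebraMap_smul, map_smul]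
      rfl

end Graded

/-! ### Generators and relations -/

section Generators

variable {V : Type u} [AddCommGroup V] [Module ℝ V]

/-- Maps of degree zero commute with the projections to the components. -/
theorem map_projOf {M N : GBimod V} (f : M →ₗ[RR V] N) (h : ∀ i, ∀ m ∈ M.deg i, f m ∈ N.deg i)
    (i : ℤ) (m : M) : f (projOf M.isInternal i m) = projOf N.isInternal i (f m) := by
  induction m using internal_induction M.isInternal with
  | h0 => simp only [map_zero]
  | hadd x y hx hy => simp only [map_add, hx, hy]
  | hom j x hx =>
    by_cases hij : j = i
    · subst hij; rw [projOf_same _ hx, projOf_same _ (h _ _ hx)]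
    · rw [projOf_ne _ hij hx, projOf_ne _ hij (h _ _ hx), map_zero]

/-- A bijection of degree zero is an isomorphism of graded spaces. -/
theorem map_deg_iff {M N : GBimod V} (f : M ≃ₗ[RR V] N) (h : ∀ i, ∀ m ∈ M.deg i, f m ∈ N.deg i)
    (i : ℤ) (m : M) : f m ∈ N.deg i ↔ m ∈ M.deg i := by
  refine ⟨fun hm => ?_, h i m⟩
  have h1 := map_projOf f.toLinearMap h i m
  rw [LinearEquiv.coe_coe, projOf_same _ hm, f.injective.eq_iff] at h1
  rw [← h1]
  exact projOf_mem _ _ _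

variable {S : Type*} {M : CoxeterMatrix S} {W : Type*} [Group W] (cs : CoxeterSystem M W)
variable (𝔥 : Realisation M V) {E : GBimod V}

/-- The map `RGr X → E` given by an element that is annihilated by the functions that vanish on
`Gr_X`. -/
def liftRGr {X : Set W} {v : E} (h : ∀ t ∈ idealGr cs 𝔥 X, t • v = 0) : RGr cs 𝔥 X →ₗ[RR V] E :=
  (Submodule.liftQ (idealGr cs 𝔥 X) (LinearMap.toSpanSingleton (RR V) E v) fun t ht => h t ht :
    (RR V ⧸ idealGr cs 𝔥 X) →ₗ[RR V] E)

/-- The constant function `1` on `Gr_X`. -/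
def oneRGr (X : Set W) : RGr cs 𝔥 X := cyclicOne (idealGr_isHomogeneous cs 𝔥 X)

theorem smul_oneRGr_eq_zero {X : Set W} {t : RR V} : t • oneRGr cs 𝔥 X = 0 ↔ t ∈ idealGr cs 𝔥 X :=
  smul_cyclicOne_eq_zero

theorem exists_eq_smul_oneRGr {X : Set W} (c : RGr cs 𝔥 X) : ∃ t : RR V, c = t • oneRGr cs 𝔥 X :=
  exists_eq_smul_cyclicOne c

theorem liftRGr_smul {X : Set W} {v : E} (h : ∀ t ∈ idealGr cs 𝔥 X, t • v = 0) (t : RR V) :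
    liftRGr cs 𝔥 h (t • oneRGr cs 𝔥 X) = t • v := by
  change (t * 1) • v = _
  rw [mul_one]

theorem liftRGr_mem {X : Set W} {v : E} (h : ∀ t ∈ idealGr cs 𝔥 X, t • v = 0) {p i : ℤ}
    (hv : v ∈ E.deg p) {c : RGr cs 𝔥 X} (hc : c ∈ (RGr cs 𝔥 X).deg i) :
    liftRGr cs 𝔥 h c ∈ E.deg (i + p) := by
  obtain ⟨t, ht, rfl⟩ := hc
  have key : (⨆ (k : ℕ) (_ : 2 * (k : ℤ) = i), lin₂ V ^ k) ≤
      (E.deg (i + p)).comap ((LinearMap.toSpanSingleton (RR V) E v).restrictScalars ℝ) := by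
    refine iSup₂_le fun k hk t' ht' => ?_
    subst hk
    rw [add_comm]
    exact E.smul_mem k p t' v ht' hv
  exact key ht

/-- An isomorphism from a sum of bimodules in `F` that shifts the degree of the `k`th summand by
`p k`. -/
theorem isSumOfShifts_of_bijective {F : Set (GBimod V)} {n : ℕ} (Y : Fin n → GBimod V)
    (hY : ∀ k, Y k ∈ F) (p : Fin n → ℤ) (Ψ : (∀ k, Y k) →ₗ[RR V] E) (hΨ : Function.Bijective Ψ)
    (hdeg : ∀ i, ∀ c : ∀ k, Y k, (∀ k, c k ∈ (Y k).deg (i + p k)) → Ψ c ∈ E.deg i) :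
    GBimod.IsSumOfShifts F E := by
  let e : GBimod.dsum (fun k => (Y k).shift (p k)) ≃ₗ[RR V] E :=
    (LinearEquiv.ofBijective Ψ hΨ : (∀ k, Y k) ≃ₗ[RR V] E)
  refine ⟨n, Y, p, hY, ⟨⟨e.symm, fun i m => ?_⟩⟩⟩
  have := map_deg_iff e (fun i c hc => hdeg i c fun k => hc k trivial) i (e.symm m)
  rw [← this, e.apply_symm_apply]

/-- A bimodule with homogeneous generators `v k` whose only relations are that `v k` is annihilated
by the vanishing ideal of `Gr_{X k}`. -/
theorem isSumOfShifts_of_generators_fin {F : Set (GBimod V)} {n : ℕ} (X : Fin n → Set W)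
    (v : Fin n → E) (hX : ∀ k, RGr cs 𝔥 (X k) ∈ F) (hv : ∀ k, ∃ p, v k ∈ E.deg p)
    (hgen : ∀ m, ∃ t : Fin n → RR V, m = ∑ k, t k • v k)
    (hrel : ∀ t : Fin n → RR V, ∑ k, t k • v k = 0 ↔ ∀ k, t k ∈ idealGr cs 𝔥 (X k)) :
    GBimod.IsSumOfShifts F E := by
  classical
  choose p hp using hv
  have hann : ∀ k, ∀ t ∈ idealGr cs 𝔥 (X k), t • v k = 0 := fun k t ht => by
    have := (hrel (Pi.single k t)).mpr fun j => by
      by_cases hj : j = k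
      · subst hj; rwa [Pi.single_eq_same]
      · rw [Pi.single_eq_of_ne hj]; exact Ideal.zero_mem _
    rw [Finset.sum_eq_single k (fun j _ hj => by rw [Pi.single_eq_of_ne hj, zero_smul])
      (fun h => absurd (Finset.mem_univ k) h), Pi.single_eq_same] at this
    exact this
  have hΨ : ∀ c : ∀ k, RGr cs 𝔥 (X k),
      (∑ k, liftRGr cs 𝔥 (hann k) ∘ₗ LinearMap.proj k : (∀ k, RGr cs 𝔥 (X k)) →ₗ[RR V] E) c =
        ∑ k, liftRGr cs 𝔥 (hann k) (c k) := fun c => LinearMap.sum_apply _ _ _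
  refine isSumOfShifts_of_bijective (fun k => RGr cs 𝔥 (X k)) hX (fun k => -p k)
    (∑ k, liftRGr cs 𝔥 (hann k) ∘ₗ LinearMap.proj k) ⟨?_, fun m => ?_⟩ fun i c hc => ?_
  · refine (injective_iff_map_eq_zero _).mpr fun c hc => ?_
    choose t ht using fun k => exists_eq_smul_oneRGr cs 𝔥 (c k)
    rw [hΨ] at hc
    simp only [ht, liftRGr_smul] at hc
    refine funext fun k => ?_
    rw [ht, (smul_oneRGr_eq_zero cs 𝔥).mpr ((hrel t).mp hc k)]
    rfl
  · obtain ⟨t, rfl⟩ := hgen m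
    refine ⟨fun k => t k • oneRGr cs 𝔥 (X k), ?_⟩
    rw [hΨ]
    simp only [liftRGr_smul]
  · rw [hΨ]
    refine Submodule.sum_mem _ fun k _ => ?_
    have h1 := liftRGr_mem cs 𝔥 (hann k) (hp k) (hc k)
    rwa [neg_add_cancel_right] at h1

theorem isSumOfShifts_of_generators {F : Set (GBimod V)} {ι : Type*} [Fintype ι] (X : ι → Set W)
    (v : ι → E) (hX : ∀ k, RGr cs 𝔥 (X k) ∈ F) (hv : ∀ k, ∃ p, v k ∈ E.deg p)
    (hgen : ∀ m, ∃ t : ι → RR V, m = ∑ k, t k • v k)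
    (hrel : ∀ t : ι → RR V, ∑ k, t k • v k = 0 ↔ ∀ k, t k ∈ idealGr cs 𝔥 (X k)) :
    GBimod.IsSumOfShifts F E := by
  let e := Fintype.equivFin ι
  refine isSumOfShifts_of_generators_fin cs 𝔥 (X ∘ e.symm) (v ∘ e.symm) (fun k => hX _)
    (fun k => hv _) (fun m => ?_) fun t => ?_
  · obtain ⟨t, rfl⟩ := hgen m
    exact ⟨t ∘ e.symm, (e.symm.sum_comp fun k => t k • v k).symm⟩
  · have h1 := hrel (t ∘ e)
    rw [← e.symm.sum_comp, ← e.symm.forall_congr_right] at h1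
    simpa using h1

end Generators

/-! ### Coordinates on projective quotients -/

section Splitting

variable {V : Type u} [AddCommGroup V] [Module ℝ V] {E : GBimod V}

/-- Homogeneous elements that form a basis modulo the augmentation ideal in a projective quotient
`E / D` form a basis of `E / D`. -/
theorem exists_coordinates [Module.Finite (R V) E] {D : Submodule (RR V) E}
    [Module.Projective (R V) (E ⧸ D)] (hD : E.IsHomogeneous D) {ι : Type*} [Fintype ι]
    [DecidableEq ι] (v : ι → E) (hv : ∀ i, ∃ j, v i ∈ E.deg j)
    (hspan : ⊤ ≤ Submodule.span (R V) (Set.range v) ⊔ (augIdeal V • ⊤ ⊔ D.restrictScalars (R V)))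
    (hind : ∀ a : ι → ℝ, ∑ i, algebraMap ℝ (R V) (a i) • v i ∈
      augIdeal V • ⊤ ⊔ D.restrictScalars (R V) → a = 0) :
    ∃ φ : ι → E →ₗ[R V] R V, (∀ i, ∀ d ∈ D, φ i d = 0) ∧
      (∀ i k, φ i (v k) = if i = k then 1 else 0) ∧ ∀ n, n - ∑ i, φ i n • v i ∈ D := by
  let q := mkQA (R V) D
  have hq : Function.Surjective q := mkQA_surjective (A := R V) D
  have hker : ∀ n, q n = 0 ↔ n ∈ D := fun n => mkQA_eq_zero (A := R V)
  have hli : LinearIndependent (R V) fun i => q (v i) := by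
    refine Fintype.linearIndependent_iff.mpr fun f hf =>
      eq_zero_of_sum_smul_eq_zero (fun i => q (v i)) (fun a ha => hind a ?_) hf
    have h1 : (augIdeal V • (⊤ : Submodule (R V) E)).map q = augIdeal V • ⊤ := by
      rw [Submodule.map_smul'', Submodule.map_top, LinearMap.range_eq_top.mpr hq]
    have h2 : q (∑ i, algebraMap ℝ (R V) (a i) • v i) ∈
        (augIdeal V • (⊤ : Submodule (R V) E)).map q := by
      rw [h1, map_sum]
      simpa only [map_smul] using ha
    obtain ⟨z, hz, hzq⟩ := h2
    have h3 := (hker _).mp (show q (∑ i, algebraMap ℝ (R V) (a i) • v i - z) = 0 by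
      rw [map_sub, hzq, sub_self])
    rw [← add_sub_cancel z (∑ i, algebraMap ℝ (R V) (a i) • v i)]
    exact Submodule.add_mem_sup hz h3
  have htop : Submodule.span (R V) (Set.range v) ⊔ D.restrictScalars (R V) = ⊤ := by
    refine eq_top_of_isHomog (IsHomog.sup (isHomog_span ?_) hD) ?_
    · rintro _ ⟨i, rfl⟩; exact hv i
    · rwa [sup_assoc, sup_comm (D.restrictScalars (R V))]
  have hsp : ⊤ ≤ Submodule.span (R V) (Set.range fun i => q (v i)) := by
    intro x _
    obtain ⟨n, rfl⟩ := hq x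
    obtain ⟨a, ha, d, hd, rfl⟩ := Submodule.mem_sup.mp (show n ∈ _ ⊔ _ by rw [htop]; trivial)
    rw [map_add, (hker d).mpr hd, add_zero, Set.range_comp' q v, ← Submodule.map_span]
    exact Submodule.mem_map_of_mem ha
  let b := Module.Basis.mk hli hsp
  have hb : ∀ i, b i = q (v i) := fun i => Module.Basis.mk_apply hli hsp i
  refine ⟨fun i => b.coord i ∘ₗ q, fun i d hd => ?_, fun i k => ?_, fun n => ?_⟩
  · rw [LinearMap.comp_apply, (hker d).mpr hd, map_zero]
  · rw [LinearMap.comp_apply, ← hb, Module.Basis.coord_apply, Module.Basis.repr_self,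
      Finsupp.single_apply]
    simp only [eq_comm]
  · rw [← hker, map_sub, map_sum, sub_eq_zero]
    simp only [map_smul, ← hb]
    exact (b.sum_repr (q n)).symm

/-- Elements `e` and `c` that form bases modulo `C + D` and of the image of `C` modulo `D`, in both
cases up to the augmentation ideal, together form a basis of `E / D`. -/
theorem exists_coordinates_sum [Module.Finite (R V) E] {C D : Submodule (RR V) E}
    [Module.Projective (R V) (E ⧸ D)] (hD : E.IsHomogeneous D) {a b : ℕ} {e : Fin a → E}
    {c : Fin b → E} (he : ∀ i, ∃ j, e i ∈ E.deg j) (hc : ∀ i, ∃ j, c i ∈ E.deg j)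
    (hcC : ∀ i, c i ∈ C)
    (hspan : ⊤ ≤ Submodule.span (R V) (Set.range e) ⊔
      (augIdeal V • ⊤ ⊔ (C.restrictScalars (R V) ⊔ D.restrictScalars (R V))))
    (hind : ∀ r : Fin a → ℝ, ∑ i, algebraMap ℝ (R V) (r i) • e i ∈
      augIdeal V • ⊤ ⊔ (C.restrictScalars (R V) ⊔ D.restrictScalars (R V)) → r = 0)
    (hspan' : C.restrictScalars (R V) ≤ Submodule.span (R V) (Set.range c) ⊔
      (augIdeal V • ⊤ ⊔ D.restrictScalars (R V)))
    (hind' : ∀ r : Fin b → ℝ, ∑ i, algebraMap ℝ (R V) (r i) • c i ∈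
      augIdeal V • ⊤ ⊔ D.restrictScalars (R V) → r = 0) :
    ∃ (φ : Fin a → E →ₗ[R V] R V) (ψ : Fin b → E →ₗ[R V] R V),
      (∀ d ∈ D, (∀ i, φ i d = 0) ∧ ∀ j, ψ j d = 0) ∧
      (∀ i k, φ i (e k) = if i = k then 1 else 0) ∧ (∀ i k, φ i (c k) = 0) ∧
      (∀ i k, ψ i (e k) = 0) ∧ (∀ i k, ψ i (c k) = if i = k then 1 else 0) ∧
      ∀ n, n - (∑ i, φ i n • e i + ∑ j, ψ j n • c j) ∈ D := by
  have hs : ⊤ ≤ Submodule.span (R V) (Set.range (Sum.elim e c)) ⊔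
      (augIdeal V • ⊤ ⊔ D.restrictScalars (R V)) := by
    rw [Set.Sum.elim_range, Submodule.span_union]
    refine hspan.trans (sup_le ?_ (sup_le ?_ (sup_le ?_ ?_)))
    · exact le_sup_left.trans le_sup_left
    · exact le_sup_left.trans le_sup_right
    · exact hspan'.trans (sup_le_sup_right le_sup_right _)
    · exact le_sup_right.trans le_sup_right
  have hi : ∀ r : Fin a ⊕ Fin b → ℝ, ∑ i, algebraMap ℝ (R V) (r i) • Sum.elim e c i ∈
      augIdeal V • ⊤ ⊔ D.restrictScalars (R V) → r = 0 := by
    intro r hr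
    rw [Fintype.sum_sum_type] at hr
    simp only [Sum.elim_inl, Sum.elim_inr] at hr
    have hle : augIdeal V • ⊤ ⊔ D.restrictScalars (R V) ≤
        augIdeal V • (⊤ : Submodule (R V) E) ⊔
          (C.restrictScalars (R V) ⊔ D.restrictScalars (R V)) :=
      sup_le_sup_left le_sup_right _
    have hl : (fun i => r (Sum.inl i)) = 0 := by
      refine hind _ ((Submodule.add_mem_iff_left _ ?_).mp (hle hr))
      refine Submodule.sum_mem _ fun i _ => Submodule.smul_mem _ _ ?_
      exact (le_sup_left.trans le_sup_right : C.restrictScalars (R V) ≤ _) (hcC i)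
    have hr' : (fun i => r (Sum.inr i)) = 0 := by
      refine hind' _ ?_
      rwa [Finset.sum_eq_zero fun i _ => ?_, zero_add] at hr
      rw [congrFun hl i, Pi.zero_apply, map_zero, zero_smul]
    funext i
    cases i with
    | inl i => exact congrFun hl i
    | inr i => exact congrFun hr' i
  obtain ⟨φ, h1, h2, h3⟩ := exists_coordinates hD (Sum.elim e c)
    (fun i => by cases i with | inl i => exact he i | inr i => exact hc i) hs hi
  refine ⟨fun i => φ (Sum.inl i), fun j => φ (Sum.inr j), fun d hd =>
      ⟨fun i => h1 _ d hd, fun i => h1 _ d hd⟩, fun i k => ?_, fun i k => ?_, fun i k => ?_,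
      fun i k => ?_, fun n => ?_⟩
  · simpa using h2 (Sum.inl i) (Sum.inl k)
  · simpa using h2 (Sum.inl i) (Sum.inr k)
  · simpa using h2 (Sum.inr i) (Sum.inl k)
  · simpa using h2 (Sum.inr i) (Sum.inr k)
  · simpa using h3 n

end Splitting

/-! ### Decomposition of bimodules with a biflag -/

section Biflag

variable {V : Type u} [AddCommGroup V] [Module ℝ V]
variable {S : Type*} {M : CoxeterMatrix S} {W : Type*} [Group W] (cs : CoxeterSystem M W)
variable (𝔥 : Realisation M V) {E : GBimod V}

/-- Subbimodules `C` and `D` of `E` such that `C` and `E / D` live on `Gr_x` and `D` and `E / C`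
live on `Gr_y`. -/
structure IsBiflag (x y : W) (C D : Submodule (RR V) E) : Prop where
  finite : Module.Finite (R V) E
  homogeneous_left : E.IsHomogeneous C
  homogeneous_right : E.IsHomogeneous D
  projective : Module.Projective (R V) D
  projective_quot_left : Module.Projective (R V) (E ⧸ C)
  projective_quot_right : Module.Projective (R V) (E ⧸ D)
  smul_left : ∀ t, restrictGr cs 𝔥 x t = 0 → ∀ c ∈ C, t • c = 0
  smul_right : ∀ t, restrictGr cs 𝔥 y t = 0 → ∀ d ∈ D, t • d = 0
  smul_mem_left : ∀ t, restrictGr cs 𝔥 y t = 0 → ∀ n : E, t • n ∈ C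
  smul_mem_right : ∀ t, restrictGr cs 𝔥 x t = 0 → ∀ n : E, t • n ∈ D

namespace IsBiflag

variable {cs 𝔥} {x y : W} {C D : Submodule (RR V) E}
variable {β : Module.Dual ℝ V} {t₁ t₂ : RR V}

/-- On `D` the root acts through the summand `t₂`, because `t₁` vanishes on `Gr_y`. -/
theorem left_smul_eq (h : IsBiflag cs 𝔥 x y C D)
    (ht₁ : restrictGr cs 𝔥 y t₁ = 0) (h12 : t₁ + t₂ = inl V (lf β)) {d : E}
    (hd : d ∈ D) : t₂ • d = lf β • d := by
  rw [← inl_smul, ← h12, add_smul, h.smul_right t₁ ht₁ d hd, zero_add]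

theorem eq_zero_of_lf_smul (h : IsBiflag cs 𝔥 x y C D)
    (hβ : β ≠ 0) {d : E} (hd : d ∈ D) (h0 : lf β • d = 0) : d = 0 := by
  have := h.projective
  exact congrArg Subtype.val (smul_eq_zero_of_projective (A := R V) (lf_ne_zero hβ)
    (m := (⟨d, hd⟩ : D)) (Subtype.ext h0))

/-- `C` and `D` have zero intersection: on it both summands of the root act as zero. -/
theorem eq_zero_of_mem (h : IsBiflag cs 𝔥 x y C D) (hβ : β ≠ 0) (ht₁ : restrictGr cs 𝔥 y t₁ = 0)
    (ht₂ : restrictGr cs 𝔥 x t₂ = 0) (h12 : t₁ + t₂ = inl V (lf β)) {n : E} (hC : n ∈ C)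
    (hD : n ∈ D) : n = 0 :=
  h.eq_zero_of_lf_smul hβ hD (by rw [← h.left_smul_eq ht₁ h12 hD, h.smul_left t₂ ht₂ n hC])

/-- A functional on `E / D`, which lives on `Gr_x`, is linear for the restriction to `Gr_x`. -/
theorem map_smul_of_right (h : IsBiflag cs 𝔥 x y C D)
    {φ : E →ₗ[R V] R V} (hφ : ∀ d ∈ D, φ d = 0) (t : RR V) (n : E) :
    φ (t • n) = restrictGr cs 𝔥 x t * φ n := by
  have h1 := hφ _ (h.smul_mem_right (t - inl V (restrictGr cs 𝔥 x t))
    (by rw [map_sub, restrictGr_inl, sub_self]) n)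
  rwa [sub_smul, inl_smul, map_sub, map_smul φ (restrictGr cs 𝔥 _ t), smul_eq_mul,
    sub_eq_zero] at h1

theorem map_smul_of_left (h : IsBiflag cs 𝔥 x y C D)
    {φ : E →ₗ[R V] R V} (hφ : ∀ c ∈ C, φ c = 0) (t : RR V) (n : E) :
    φ (t • n) = restrictGr cs 𝔥 y t * φ n := by
  have h1 := hφ _ (h.smul_mem_left (t - inl V (restrictGr cs 𝔥 y t))
    (by rw [map_sub, restrictGr_inl, sub_self]) n)
  rwa [sub_smul, inl_smul, map_sub, map_smul φ (restrictGr cs 𝔥 _ t), smul_eq_mul,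
    sub_eq_zero] at h1

section Generators

variable {a b : ℕ} {e : Fin a → E} {g : Fin b → E} {χ : Fin a → E →ₗ[R V] R V}
  {ψ : Fin b → E →ₗ[R V] R V}

/-- The coordinates along `e` of an element of `D` lie in the augmentation ideal, since `e` is
linearly independent modulo `C + D` there. -/
theorem constTerm_coordinate_eq_zero (hg : ∀ k, g k ∈ D)
    (hind : ∀ r : Fin a → ℝ, ∑ i, algebraMap ℝ (R V) (r i) • e i ∈
      augIdeal V • ⊤ ⊔ (C.restrictScalars (R V) ⊔ D.restrictScalars (R V)) → r = 0)
    (hsum : ∀ n, n - (∑ i, χ i n • e i + ∑ k, ψ k n • g k) ∈ C) {d : E} (hd : d ∈ D) (i : Fin a) :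
    constTerm (χ i d) = 0 := by
  refine congrFun (hind (fun i => constTerm (χ i d)) ?_) i
  have h1 : ∑ i, χ i d • e i - ∑ i, algebraMap ℝ (R V) (constTerm (χ i d)) • e i ∈
      augIdeal V • (⊤ : Submodule (R V) E) := by
    rw [← Finset.sum_sub_distrib]
    refine Submodule.sum_mem _ fun i _ => ?_
    rw [← sub_smul]
    exact Submodule.smul_mem_smul (sub_algebraMap_mem_augIdeal _) trivial
  have h2 : ∑ i, χ i d • e i ∈ C.restrictScalars (R V) ⊔ D.restrictScalars (R V) := by
    have h3 : d - ∑ k, ψ k d • g k ∈ D.restrictScalars (R V) :=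
      Submodule.sub_mem _ hd (Submodule.sum_mem _ fun k _ => Submodule.smul_mem _ _ (hg k))
    have h4 := Submodule.add_mem_sup (Submodule.neg_mem (C.restrictScalars (R V)) (hsum d)) h3
    convert h4 using 1
    abel
  rw [← sub_sub_cancel (∑ i, χ i d • e i) (∑ i, algebraMap ℝ (R V) (constTerm (χ i d)) • e i)]
  exact Submodule.sub_mem _ (Submodule.mem_sup_right h2) (Submodule.mem_sup_left h1)

/-- The subbimodule `D` is generated over `R` by the `g k` and the multiples `t₂ e i`: the latter
are independent modulo the augmentation ideal because `β` does not lie in its square. -/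
theorem exists_sum_eq (h : IsBiflag cs 𝔥 x y C D) (hβ : β ≠ 0) (ht₁ : restrictGr cs 𝔥 y t₁ = 0)
    (ht₂ : restrictGr cs 𝔥 x t₂ = 0) (h12 : t₁ + t₂ = inl V (lf β)) (hg : ∀ k, g k ∈ D)
    (hind : ∀ r : Fin a → ℝ, ∑ i, algebraMap ℝ (R V) (r i) • e i ∈
      augIdeal V • ⊤ ⊔ (C.restrictScalars (R V) ⊔ D.restrictScalars (R V)) → r = 0)
    (hχ : ∀ c ∈ C, ∀ i, χ i c = 0) (hχe : ∀ i k, χ i (e k) = if i = k then 1 else 0)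
    (hsum : ∀ n, n - (∑ i, χ i n • e i + ∑ k, ψ k n • g k) ∈ C) {d : E} (hd : d ∈ D) :
    ∃ (f : Fin a → R V) (f' : Fin b → R V), d = ∑ i, f i • t₂ • e i + ∑ k, f' k • g k := by
  have := h.projective
  let w : Fin a → D := fun i => ⟨t₂ • e i, h.smul_mem_right t₂ ht₂ (e i)⟩
  have hw : ∀ r : Fin a → ℝ, ∑ i, algebraMap ℝ (R V) (r i) • w i ∈
      augIdeal V • (⊤ : Submodule (R V) D) → r = 0 := by
    intro r hr
    have key : ∀ z ∈ augIdeal V • (⊤ : Submodule (R V) D), ∀ i,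
        χ i (z : E) ∈ augIdeal V * augIdeal V := fun z hz i => by
      induction hz using Submodule.smul_induction_on' with
      | smul f hf d _ =>
        change χ i (f • (d : E)) ∈ _
        rw [map_smul]
        exact Ideal.mul_mem_mul hf
          (mem_augIdeal.mpr (constTerm_coordinate_eq_zero hg hind hsum d.2 i))
      | add z _ z' _ hz hz' =>
        change χ i ((z : E) + z') ∈ _
        rw [map_add]
        exact Ideal.add_mem _ hz hz'
    funext k
    have h1 := key _ hr k
    have h2 : χ k ((∑ i, algebraMap ℝ (R V) (r i) • w i : D) : E) = lf (r k • β) := by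
      rw [Submodule.coe_sum, map_sum, Finset.sum_eq_single k]
      · change χ k (algebraMap ℝ (R V) (r k) • t₂ • e k) = _
        have h3 : t₂ = inl V (lf β) - t₁ := by rw [← h12, add_sub_cancel_left]
        rw [map_smul, h3, sub_smul, map_sub, hχ _ (h.smul_mem_left t₁ ht₁ _), inl_smul, map_smul,
          hχe, if_pos rfl, sub_zero, smul_eq_mul, smul_eq_mul, mul_one, map_smul, Algebra.smul_def]
      · intro i _ hik
        change χ k (algebraMap ℝ (R V) (r i) • t₂ • e i) = _
        rw [map_smul, h.map_smul_of_left (fun c hc => hχ c hc k), hχe, if_neg (Ne.symm hik),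
          mul_zero, smul_zero]
      · exact fun hk => absurd (Finset.mem_univ k) hk
    rw [h2] at h1
    exact (smul_eq_zero.mp (eq_zero_of_lf_mem h1)).resolve_right hβ
  have hd' : lf β • d = ∑ i, χ i d • t₂ • e i + lf β • ∑ k, ψ k d • g k := by
    have h1 := h.smul_left t₂ ht₂ _ (hsum d)
    rw [smul_sub, sub_eq_zero, h.left_smul_eq ht₁ h12 hd, smul_add, Finset.smul_sum,
      Finset.smul_sum] at h1
    rw [h1, Finset.smul_sum]
    congr 1
    · exact Finset.sum_congr rfl fun i _ => by
        rw [← inl_smul, ← inl_smul, smul_comm]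
    · refine Finset.sum_congr rfl fun k _ => ?_
      rw [h.left_smul_eq ht₁ h12]
      exact Submodule.smul_mem (D.restrictScalars (R V)) _ (hg k)
  have hmem : d - ∑ k, ψ k d • g k ∈ D.restrictScalars (R V) :=
    Submodule.sub_mem _ hd (Submodule.sum_mem _ fun k _ => Submodule.smul_mem _ _ (hg k))
  have hdvd := dvd_of_sum_smul_eq w hw (lf_dvd_of_dvd_mul hβ) (f := fun i => χ i d)
    (n := ⟨d - ∑ k, ψ k d • g k, hmem⟩) (Subtype.ext (by
      rw [Submodule.coe_sum]
      change ∑ i, χ i d • t₂ • e i = lf β • (d - ∑ k, ψ k d • g k)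
      rw [smul_sub, hd', add_sub_cancel_right]))
  choose f hf using hdvd
  refine ⟨f, fun k => ψ k d, ?_⟩
  rw [← sub_eq_zero]
  refine h.eq_zero_of_lf_smul hβ (d := d - (∑ i, f i • t₂ • e i + ∑ k, ψ k d • g k)) ?_ ?_
  · have h1 : ∑ i, f i • t₂ • e i ∈ D.restrictScalars (R V) :=
      Submodule.sum_mem _ fun i _ => Submodule.smul_mem _ _ (h.smul_mem_right t₂ ht₂ _)
    have h2 := Submodule.sub_mem _ hmem h1
    rwa [sub_sub, add_comm] at h2
  · rw [smul_sub, smul_add, hd']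
    simp only [hf, mul_smul, ← Finset.smul_sum, sub_self]

end Generators

/-- A graded bimodule with a biflag is a direct sum of shifts of `R(x, y)`, `R(x)` and `R(y)`. The
last kind does not occur if `D` vanishes modulo the augmentation ideal and `C`. -/
theorem isSumOfShifts (h : IsBiflag cs 𝔥 x y C D) (hβ : β ≠ 0) (ht₁ : restrictGr cs 𝔥 y t₁ = 0)
    (ht₂ : restrictGr cs 𝔥 x t₂ = 0) (h12 : t₁ + t₂ = inl V (lf β)) {F : Set (GBimod V)}
    (hxy : RGr cs 𝔥 {x, y} ∈ F) (hx : RGr cs 𝔥 {x} ∈ F)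
    (hy : RGr cs 𝔥 {y} ∈ F ∨
      D.restrictScalars (R V) ≤ augIdeal V • ⊤ ⊔ C.restrictScalars (R V)) :
    GBimod.IsSumOfShifts F E := by
  have := h.finite
  have := h.projective_quot_left
  have := h.projective_quot_right
  obtain ⟨a, e, -, he, hspan, hind⟩ := exists_homogeneous_basis (E := E) (P := ⊤)
    (U := augIdeal V • ⊤ ⊔ (C.restrictScalars (R V) ⊔ D.restrictScalars (R V)))
    (fun _ _ _ => trivial) le_sup_left
  obtain ⟨b, c, hcC, hc, hspanC, hindC⟩ := exists_homogeneous_basis (E := E)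
    (P := C.restrictScalars (R V)) (U := augIdeal V • ⊤ ⊔ D.restrictScalars (R V))
    h.homogeneous_left le_sup_left
  obtain ⟨b', g, hgD, hg, hspanD, hindD⟩ := exists_homogeneous_basis (E := E)
    (P := D.restrictScalars (R V)) (U := augIdeal V • ⊤ ⊔ C.restrictScalars (R V))
    h.homogeneous_right le_sup_left
  obtain ⟨φ, φ', hφ, hφe, hφc, hφe', hφc', hφsum⟩ := exists_coordinates_sum h.homogeneous_right he
    hc hcC hspan hind hspanC hindC
  obtain ⟨χ, χ', hχ, hχe, hχg, hχe', hχg', hχsum⟩ := exists_coordinates_sum h.homogeneous_left he hg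
    hgD (by rwa [sup_comm (D.restrictScalars (R V))]) (by rwa [sup_comm (D.restrictScalars (R V))])
    hspanD hindD
  -- `e` and `c` form a basis of `E / D`, and `e` and `g` form a basis of `E / C`; all of them
  -- together generate `E`, and each `e i`, `c j`, `g k` spans a copy of `R(x, y)`, `R(x)`, `R(y)`
  refine isSumOfShifts_of_generators cs 𝔥 (ι := Fin a ⊕ (Fin b ⊕ Fin b'))
    (Sum.elim (fun _ => {x, y}) (Sum.elim (fun _ => {x}) fun _ => {y}))
    (Sum.elim e (Sum.elim c g)) ?_ ?_ (fun n => ?_) fun t => ?_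
  · rintro (i | j | k)
    · exact hxy
    · exact hx
    · refine hy.resolve_right fun hD => ?_
      have h1 := hindD (Pi.single k 1) (Submodule.sum_mem _ fun l _ =>
        Submodule.smul_mem _ _ (hD (hgD l)))
      have h2 := congrFun h1 k
      rw [Pi.single_eq_same, Pi.zero_apply] at h2
      exact one_ne_zero h2
  · rintro (i | j | k)
    · exact he i
    · exact hc j
    · exact hg k
  · obtain ⟨f, f', hf⟩ := h.exists_sum_eq hβ ht₁ ht₂ h12 hgD hind (fun c hc i => (hχ c hc).1 i) hχe
      hχsum (hφsum n)
    refine ⟨Sum.elim (fun i => inl V (φ i n) + inl V (f i) * t₂)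
      (Sum.elim (fun j => inl V (φ' j n)) fun k => inl V (f' k)), ?_⟩
    rw [sub_eq_iff_eq_add] at hf
    rw [Fintype.sum_sum_type, Fintype.sum_sum_type]
    simp only [Sum.elim_inl, Sum.elim_inr, add_smul, mul_smul, inl_smul, Finset.sum_add_distrib]
    conv_lhs => rw [hf]
    abel
  · rw [Fintype.sum_sum_type, Fintype.sum_sum_type]
    simp only [Sum.elim_inl, Sum.elim_inr]
    have hmem : ∀ {s : RR V} {z : W}, s ∈ idealGr cs 𝔥 {z} ↔ restrictGr cs 𝔥 z s = 0 :=
      mem_idealGr_singleton cs 𝔥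
    have hmem' : ∀ {s : RR V}, s ∈ idealGr cs 𝔥 {x, y} ↔
        restrictGr cs 𝔥 x s = 0 ∧ restrictGr cs 𝔥 y s = 0 := fun {s} => by
      rw [idealGr, iInf_insert, iInf_singleton]
      exact and_congr RingHom.mem_ker RingHom.mem_ker
    constructor
    · intro h0
      have h1 := fun i => h.map_smul_of_right fun d hd => (hφ d hd).1 i
      have h2 := fun i => h.map_smul_of_right fun d hd => (hφ d hd).2 i
      have h3 := fun i => h.map_smul_of_left fun d hd => (hχ d hd).1 i
      have h4 := fun i => h.map_smul_of_left fun d hd => (hχ d hd).2 i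
      have hA := fun i => congrArg (φ i) h0
      have hB := fun i => congrArg (φ' i) h0
      have hA' := fun i => congrArg (χ i) h0
      have hB' := fun i => congrArg (χ' i) h0
      simp only [map_add, map_sum, map_zero, h1, h2, hφe, hφc, hφe', hφc', (hφ _ (hgD _)).1,
        (hφ _ (hgD _)).2, mul_ite, mul_one, mul_zero, Finset.sum_const_zero, Finset.sum_ite_eq,
        Finset.mem_univ, if_true, add_zero, zero_add] at hA hB
      simp only [map_add, map_sum, map_zero, h3, h4, hχe, hχg, hχe', hχg', (hχ _ (hcC _)).1,
        (hχ _ (hcC _)).2, mul_ite, mul_one, mul_zero, Finset.sum_const_zero, Finset.sum_ite_eq,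
        Finset.mem_univ, if_true, add_zero, zero_add] at hA' hB'
      rintro (i | j | k)
      · exact hmem'.mpr ⟨hA i, hA' i⟩
      · exact hmem.mpr (hB j)
      · exact hmem.mpr (hB' k)
    · intro ht
      have h1 : ∀ i, t (Sum.inl i) • e i = 0 := fun i => by
        obtain ⟨hi, hi'⟩ := hmem'.mp (ht (Sum.inl i))
        exact h.eq_zero_of_mem hβ ht₁ ht₂ h12 (h.smul_mem_left _ hi' _) (h.smul_mem_right _ hi _)
      have h2 : ∀ j, t (Sum.inr (Sum.inl j)) • c j = 0 := fun j =>
        h.smul_left _ (hmem.mp (ht (Sum.inr (Sum.inl j)))) _ (hcC j)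
      have h3 : ∀ k, t (Sum.inr (Sum.inr k)) • g k = 0 := fun k =>
        h.smul_right _ (hmem.mp (ht (Sum.inr (Sum.inr k)))) _ (hgD k)
      simp only [h1, h2, h3, Finset.sum_const_zero, add_zero]

end IsBiflag

end Biflag

/-! ### Biflags given by exact sequences -/

section Biflags

variable {V : Type u} [AddCommGroup V] [Module ℝ V]
variable {S : Type*} {M : CoxeterMatrix S} {W : Type*} [Group W] (cs : CoxeterSystem M W)
variable (𝔥 : Realisation M V)

/-- The root `x α_s` is the sum of a function that vanishes on `Gr_{xs}` and one that vanishes on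
`Gr_x`. -/
theorem exists_add_eq_root (x : W) (s : S) : ∃ t₁ t₂ : RR V,
    restrictGr cs 𝔥 (x * cs.simple s) t₁ = 0 ∧ restrictGr cs 𝔥 x t₂ = 0 ∧
      t₁ + t₂ = inl V (lf (dualAct cs 𝔥 x (𝔥.root s))) := by
  refine ⟨(2⁻¹ : ℝ) • (inl V (lf (dualAct cs 𝔥 x (𝔥.root s))) + inr V (lf (𝔥.root s))),
    (2⁻¹ : ℝ) • (inl V (lf (dualAct cs 𝔥 x (𝔥.root s))) - inr V (lf (𝔥.root s))), ?_, ?_, ?_⟩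
  · rw [map_smul, map_add, restrictGr_inl, restrictGr_inr, act_lf, dualAct_mul, dualAct_simple_root,
      map_neg, map_neg, add_neg_cancel, smul_zero]
  · rw [map_smul, map_sub, restrictGr_inl, restrictGr_inr, act_lf, sub_self, smul_zero]
  · rw [← smul_add, add_add_sub_cancel, ← two_smul ℝ, smul_smul, inv_mul_cancel₀ two_ne_zero,
      one_smul]

variable {cs 𝔥} {x : W}

/-- The bimodule `R(x)` is free of rank one over `R` and lives on `Gr_x`. -/
theorem finite_projective_RGr (x : W) : Module.Finite (R V) (RGr cs 𝔥 {x}) ∧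
    Module.Projective (R V) (RGr cs 𝔥 {x}) ∧
      ∀ t, restrictGr cs 𝔥 x t = 0 → ∀ c : RGr cs 𝔥 {x}, t • c = 0 := by
  have h1 : ∀ t : RR V, t • oneRGr cs 𝔥 {x} = 0 ↔ restrictGr cs 𝔥 x t = 0 := fun t =>
    (smul_oneRGr_eq_zero cs 𝔥).trans (mem_idealGr_singleton cs 𝔥)
  have hb := bijective_toSpanSingleton h1 (exists_eq_smul_oneRGr cs 𝔥)
  refine ⟨Module.Finite.of_surjective _ hb.2,
    Module.Projective.of_equiv' (LinearEquiv.ofBijective _ hb), fun t ht c => ?_⟩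
  obtain ⟨t', rfl⟩ := exists_eq_smul_oneRGr cs 𝔥 c
  rw [smul_comm, (h1 t).mpr ht, smul_zero]

theorem IsSumOfShifts.finite_projective {C : GBimod V}
    (h : GBimod.IsSumOfShifts {RGr cs 𝔥 {x}} C) : Module.Finite (R V) C ∧
      Module.Projective (R V) C ∧ ∀ t, restrictGr cs 𝔥 x t = 0 → ∀ c : C, t • c = 0 := by
  obtain ⟨n, Y, m, hY, ⟨e, -⟩⟩ := h
  have hp : ∀ k, Module.Finite (R V) (Y k) ∧ Module.Projective (R V) (Y k) ∧
      ∀ t, restrictGr cs 𝔥 x t = 0 → ∀ c : Y k, t • c = 0 := fun k => by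
    rw [Set.mem_singleton_iff.mp (hY k)]
    exact finite_projective_RGr x
  have h1 := fun k => (hp k).1
  have h2 := fun k => (hp k).2.1
  let e' : C ≃ₗ[RR V] ∀ k, Y k := e
  have : Module.Projective (R V) (∀ k, Y k) :=
    Module.Projective.of_equiv' DFinsupp.linearEquivFunOnFintype
  refine ⟨Module.Finite.of_surjective (leftLin e'.symm.toLinearMap) e'.symm.surjective,
    projective_of_retract (leftLin e'.toLinearMap) (leftLin e'.symm.toLinearMap)
      e'.symm_apply_apply, fun t ht c => e'.injective (funext fun k => ?_)⟩
  rw [map_smul, map_zero]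
  exact (hp k).2.2 t ht _

/-- The images of `C` and `D` under the two given injections. -/
theorem HasBiflag.exists_isBiflag {y : W} {E : GBimod V} (h : HasBiflag cs 𝔥 x y E) :
    ∃ C D : Submodule (RR V) E, IsBiflag cs 𝔥 x y C D := by
  obtain ⟨⟨C, D', f, g, ⟨hf, hfg, hg⟩, hC, hD'⟩, D, C', f', g', ⟨hf', hfg', hg'⟩, hD, hC'⟩ := h
  obtain ⟨C1, -, C3⟩ := IsSumOfShifts.finite_projective hC
  obtain ⟨D1', D2', D3'⟩ := IsSumOfShifts.finite_projective hD'
  obtain ⟨-, D2, D3⟩ := IsSumOfShifts.finite_projective hD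
  obtain ⟨-, C2', C3'⟩ := IsSumOfShifts.finite_projective hC'
  refine ⟨LinearMap.range f.toLin, LinearMap.range f'.toLin, ?_, ?_, ?_, ?_, ?_, ?_, ?_, ?_, ?_, ?_⟩
  · refine Module.finite_def.mpr (Submodule.fg_of_fg_map_of_fg_inf_ker (leftLin g.toLin) ?_ ?_)
    · rw [Submodule.map_top, (LinearMap.range_eq_top (f := leftLin g.toLin)).mpr hg]
      exact Module.Finite.fg_top
    · have e : ⊤ ⊓ LinearMap.ker (leftLin g.toLin) =
          (⊤ : Submodule (R V) C).map (leftLin f.toLin) := by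
        rw [top_inf_eq, Submodule.map_top]
        exact Submodule.ext hfg
      rw [e]
      exact Module.Finite.fg_top.map _
  · rintro i _ ⟨c, rfl⟩
    exact ⟨_, map_projOf f.toLin f.map_deg i c⟩
  · rintro i _ ⟨c, rfl⟩
    exact ⟨_, map_projOf f'.toLin f'.map_deg i c⟩
  · exact projective_of_retract (leftLin (LinearEquiv.ofInjective f'.toLin hf').symm.toLinearMap)
      (leftLin (LinearEquiv.ofInjective f'.toLin hf').toLinearMap)
      (LinearEquiv.ofInjective f'.toLin hf').apply_symm_apply
  · exact projective_of_surjective_of_ker (leftLin g.toLin)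
      (mkQA (R V) (LinearMap.range f.toLin)) hg (mkQA_surjective _) fun n => by
        rw [mkQA_eq_zero]; exact hfg n
  · exact projective_of_surjective_of_ker (leftLin g'.toLin) (mkQA (R V) (LinearMap.range f'.toLin))
      hg' (mkQA_surjective _) fun n => by rw [mkQA_eq_zero]; exact hfg' n
  · rintro t ht _ ⟨c, rfl⟩
    rw [← map_smul, C3 t ht, map_zero]
  · rintro t ht _ ⟨c, rfl⟩
    rw [← map_smul, D3 t ht, map_zero]
  · exact fun t ht n => (hfg _).mp (by rw [map_smul, D3' t ht])
  · exact fun t ht n => (hfg' _).mp (by rw [map_smul, C3' t ht])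

end Biflags

/-! ### Stalks along two twisted graphs -/

section Stalks

variable {V : Type u} [AddCommGroup V] [Module ℝ V]
variable {S : Type*} {M : CoxeterMatrix S} {W : Type*} [Group W] (cs : CoxeterSystem M W)
variable (𝔥 : Realisation M V)

theorem length_lt_of_bruhatLT {x y : W} (h : BruhatLT cs x y) : cs.length x < cs.length y := by
  induction h with
  | single h => exact h.2
  | tail _ h ih => exact ih.trans h.2

theorem isLower_singleton (z : W) : IsLower cs z⁻¹ {z} := by
  rintro _ rfl r _ h
  rw [inv_mul_cancel, cs.length_one] at h
  exact absurd h (Nat.not_lt_zero _)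

/-- This holds for all `x`, also if `x s < x`, because translation by `x⁻¹` moves the pair to
`{1, s}`. -/
theorem isLower_pair (x : W) (s : S) : IsLower cs x⁻¹ {x, x * cs.simple s} := by
  rintro _ (rfl | rfl) r hr h
  · rw [inv_mul_cancel, cs.length_one] at h
    exact absurd h (Nat.not_lt_zero _)
  · rw [inv_mul_cancel_left, cs.length_simple, Nat.lt_one_iff, cs.length_eq_zero_iff,
      inv_mul_eq_one] at h
    exact Or.inl h.symm

variable {cs 𝔥} {x : W}

/-- A function that vanishes on `Gr_F` but not on `Gr_x`. -/
theorem exists_mem_idealGr [FiniteDimensional ℝ V] {F : Set W} (hF : F.Finite) {x : W}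
    (hx : x ∉ F) : ∃ t ∈ idealGr cs 𝔥 F, restrictGr cs 𝔥 x t ≠ 0 := by
  induction F, hF using Set.Finite.induction_on with
  | empty => exact ⟨1, by simp [idealGr], by rw [map_one]; exact one_ne_zero⟩
  | @insert z F _ _ ih =>
    obtain ⟨t, ht, htx⟩ := ih fun h => hx (Set.mem_insert_of_mem _ h)
    obtain ⟨l, hl⟩ := exists_dualAct_ne cs 𝔥 (x := x) (z := z)
      fun h => hx (h ▸ Set.mem_insert _ _)
    refine ⟨(inr V (lf l) - inl V (lf (dualAct cs 𝔥 z l))) * t, ?_, ?_⟩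
    · rw [idealGr, iInf_insert]
      refine ⟨Ideal.mul_mem_right _ _ ?_, Ideal.mul_mem_left _ _ ht⟩
      refine RingHom.mem_ker.mpr ?_
      rw [map_sub, restrictGr_inl, restrictGr_inr, act_lf, sub_self]
    · rw [map_mul, map_sub, restrictGr_inl, restrictGr_inr, act_lf, ← map_sub]
      exact mul_ne_zero (lf_ne_zero (sub_ne_zero.mpr hl)) htx

/-- For a reduced bimodule the sections that are supported away from `Y` are the sections that
vanish generically on `Gr_x` for `x ∈ Y`. -/
theorem sectionsWithSupport_compl [FiniteDimensional ℝ V] {B : GBimod V}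
    (hB : IsReducedOn cs 𝔥 B) (Y : Set W) :
    sectionsWithSupport cs 𝔥 B Yᶜ = genericKerOn cs 𝔥 B Y := by
  refine le_antisymm ?_ fun b hb => ?_
  · rintro b ⟨F, hF, hFY, n, hn⟩
    refine (mem_genericKerOn cs 𝔥).mpr fun x hx => ?_
    obtain ⟨t, ht, htx⟩ := exists_mem_idealGr (cs := cs) (𝔥 := 𝔥) hF (x := x) fun h => hFY h hx
    exact ⟨t ^ n, by rw [map_pow]; exact pow_ne_zero n htx, hn _ (Ideal.pow_mem_pow ht n)⟩
  · refine ⟨{x | genericKer cs 𝔥 B x ≠ ⊤} \ Y, hB.finite.subset Set.sdiff_subset,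
      fun x hx => hx.2, 1, fun t ht => hB.eq_zero _ fun x => ?_⟩
    rw [pow_one] at ht
    by_cases hx : x ∈ Y
    · exact Submodule.smul_mem _ _ ((mem_genericKerOn cs 𝔥).mp hb x hx)
    · by_cases h : genericKer cs 𝔥 B x = ⊤
      · rw [h]; trivial
      · exact hB.smul_mem x t (restrictGr_eq_zero_of_mem cs 𝔥
          (X := {x | genericKer cs 𝔥 B x ≠ ⊤} \ Y) ⟨h, hx⟩ ht) b

theorem isHomogeneous_genericKer [FiniteDimensional ℝ V] {B : GBimod V}
    (hB : IsReducedOn cs 𝔥 B) (x : W) : B.IsHomogeneous (genericKer cs 𝔥 B x) := by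
  rw [← genericKerOn_singleton, ← sectionsWithSupport_compl hB]
  exact sectionsWithSupport_isHomogeneous cs 𝔥 B _

theorem IsStratified.projective_quotient {N : Type*} [AddCommGroup N] [Module (RR V) N]
    [Module (R V) N] [IsScalarTower (R V) (RR V) N] (hN : IsStratified cs 𝔥 N) (x : W) :
    Module.Projective (R V) (N ⧸ genericKer cs 𝔥 N x) := by
  rw [← genericKerOn_singleton]
  exact hN.hasFlags x⁻¹ {x} (Set.finite_singleton x) (isLower_singleton cs x)

/-- The quotient of `N` by a submodule `K` that contains the kernel of a surjection `p`, computed in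
the image of `p`. The map `f` is `p`, as an `A`-linear map. -/
theorem projective_quotient_map {A B : Type*} [CommRing A] [CommRing B] [Algebra A B]
    {N N' : Type*} [AddCommGroup N] [Module B N] [Module A N] [IsScalarTower A B N]
    [AddCommGroup N'] [Module B N'] [Module A N'] [IsScalarTower A B N']
    (f : N →ₗ[A] N') (hf : Function.Surjective f) (p : N →ₗ[B] N') (hfp : ∀ n, f n = p n)
    {K : Submodule B N} (hK : ∀ n, p n = 0 → n ∈ K) [Module.Projective A (N ⧸ K)] :
    Module.Projective A (N' ⧸ K.map p) := by
  have hq : Function.Surjective (mkQA A (K.map p) ∘ₗ f) := (K.map p).mkQ_surjective.comp hf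
  refine projective_of_surjective_of_ker (mkQA A K) _ K.mkQ_surjective hq fun n => ?_
  rw [LinearMap.comp_apply, mkQA_eq_zero, mkQA_eq_zero, hfp]
  refine ⟨fun hn => ⟨n, hn, rfl⟩, ?_⟩
  rintro ⟨n', hn', h⟩
  have h1 : n' - n ∈ K := hK _ (by rw [map_sub]; exact sub_eq_zero.mpr h)
  exact (Submodule.sub_mem_iff_right _ hn').mp h1

section Quotient

variable {B E : GBimod V} {s : S} (p : B →ₗ[RR V] E)

/-- The quotient of a stratified bimodule by the sections that vanish on `Gr_x` and on `Gr_{xs}` has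
a biflag; its subbimodules consist of the sections that vanish on one of the two graphs. -/
theorem IsStratified.isBiflag [FiniteDimensional ℝ V] (hB : IsStratified cs 𝔥 B)
    (hp : Function.Surjective p) (hd : ∀ i, ∀ b ∈ B.deg i, p b ∈ E.deg i)
    (hk : ∀ b, p b = 0 ↔ b ∈ genericKerOn cs 𝔥 B {x, x * cs.simple s}) :
    IsBiflag cs 𝔥 x (x * cs.simple s) ((genericKer cs 𝔥 B (x * cs.simple s)).map p)
      ((genericKer cs 𝔥 B x).map p) := by
  have hmem : ∀ b, p b = 0 ↔
      b ∈ genericKer cs 𝔥 B x ∧ b ∈ genericKer cs 𝔥 B (x * cs.simple s) := fun b => by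
    rw [hk, genericKerOn_insert, genericKerOn_singleton, Submodule.mem_inf]
  have hhom : ∀ z, E.IsHomogeneous ((genericKer cs 𝔥 B z).map p) := by
    rintro z i _ ⟨b, hb, rfl⟩
    exact ⟨_, isHomogeneous_genericKer hB.isReducedOn z i b hb, map_projOf p hd i b⟩
  have hquot : ∀ z, (∀ b, p b = 0 → b ∈ genericKer cs 𝔥 B z) →
      Module.Projective (R V) (E ⧸ (genericKer cs 𝔥 B z).map p) := fun z hz =>
    have := hB.projective_quotient z
    projective_quotient_map (leftLin p) hp p (fun _ => rfl) hz
  have := hB.finite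
  refine ⟨Module.Finite.of_surjective (leftLin p) hp, hhom _, hhom _, ?_,
    hquot _ fun b hb => ((hmem b).mp hb).2, hquot _ fun b hb => ((hmem b).mp hb).1, ?_, ?_, ?_, ?_⟩
  · have := hB.projective_quotient x
    have := hB.hasFlags x⁻¹ {x, x * cs.simple s} (Set.toFinite _) (isLower_pair cs x s)
    refine projective_of_quotient_of_le (A := R V)
      (K := genericKerOn cs 𝔥 B {x, x * cs.simple s}) (L := genericKer cs 𝔥 B x)
      (fun b hb => ((hmem b).mp ((hk b).mpr hb)).1)
      ((leftLin p ∘ₗ (genericKer cs 𝔥 B x).subtype.restrictScalars (R V)).codRestrict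
        (((genericKer cs 𝔥 B x).map p).restrictScalars (R V)) fun l => ⟨l, l.2, rfl⟩) ?_ fun l => ?_
    · rintro ⟨_, b, hb, rfl⟩
      exact ⟨⟨b, hb⟩, rfl⟩
    · rw [Subtype.ext_iff]
      exact hk l
  · rintro t ht _ ⟨b, hb, rfl⟩
    rw [← map_smul]
    exact (hmem _).mpr ⟨hB.isReducedOn.smul_mem _ t ht b, Submodule.smul_mem _ _ hb⟩
  · rintro t ht _ ⟨b, hb, rfl⟩
    rw [← map_smul]
    exact (hmem _).mpr ⟨Submodule.smul_mem _ _ hb, hB.isReducedOn.smul_mem _ t ht b⟩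
  · intro t ht n
    obtain ⟨b, rfl⟩ := hp n
    exact ⟨_, hB.isReducedOn.smul_mem _ t ht b, map_smul p t b⟩
  · intro t ht n
    obtain ⟨b, rfl⟩ := hp n
    exact ⟨_, hB.isReducedOn.smul_mem _ t ht b, map_smul p t b⟩

/-- If `x < xs`, then by divisibility the sections that vanish on `Gr_x` need no generators besides
those that vanish on `Gr_{xs}`. -/
theorem IsStratified.le_augIdeal_smul_sup (hB : IsStratified cs 𝔥 B)
    (hs : cs.length x < cs.length (x * cs.simple s)) :
    ((genericKer cs 𝔥 B x).map p).restrictScalars (R V) ≤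
      augIdeal V • ⊤ ⊔ ((genericKer cs 𝔥 B (x * cs.simple s)).map p).restrictScalars (R V) := by
  rintro _ ⟨b, hb, rfl⟩
  have hw : x * cs.simple s * x⁻¹ * x = x * cs.simple s := inv_mul_cancel_right _ _
  obtain ⟨h, hdvd, m, hm⟩ := hB.hasDivisibility x x s (by rwa [hw]) b hb
  rw [hw] at hm
  have := hB.projective_quotient (x * cs.simple s)
  obtain ⟨c, hc⟩ := exists_eq_smul_of_projective (A := R V)
    (p := lf (dualAct cs 𝔥 x (𝔥.root s))) (q := h)
    (m := mkQA (R V) (genericKer cs 𝔥 B (x * cs.simple s)) b) (n := mkQA (R V) _ m)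
    (fun a a' haa => ((prime_lf (dualAct_root_ne_zero cs 𝔥 x s)).dvd_or_dvd
      ⟨a', haa⟩).resolve_left hdvd)
    (by rw [← sub_eq_zero, ← map_smul, ← map_smul, ← map_sub, mkQA_eq_zero]; exact hm)
  obtain ⟨c, rfl⟩ := mkQA_surjective (A := R V) _ c
  rw [← sub_eq_zero, ← map_smul, ← map_sub, mkQA_eq_zero] at hc
  refine Submodule.mem_sup.mpr ⟨lf (dualAct cs 𝔥 x (𝔥.root s)) • p c,
    Submodule.smul_mem_smul (lf_mem_augIdeal _) trivial, _, ⟨_, hc, rfl⟩, ?_⟩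
  have := map_smul (leftLin p) (lf (dualAct cs 𝔥 x (𝔥.root s))) c
  rw [map_sub]
  exact (congrArg (· + (p b - _)) this.symm).trans (add_sub_cancel _ _)

end Quotient

theorem IsSoergel.isSumOfShifts_stalk [FiniteDimensional ℝ V] {B : GBimod V}
    (hB : IsSoergel cs 𝔥 B) {s : S} (hs : cs.length x < cs.length (x * cs.simple s)) :
    GBimod.IsSumOfShifts {RGr cs 𝔥 {x, x * cs.simple s}, RGr cs 𝔥 {x}}
      (stalk cs 𝔥 B {x, x * cs.simple s}) := by
  have h := isStratified_of_isSoergel cs 𝔥 hB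
  let p : B →ₗ[RR V] stalk cs 𝔥 B {x, x * cs.simple s} :=
    (sectionsWithSupport cs 𝔥 B {x, x * cs.simple s}ᶜ).mkQ
  obtain ⟨t₁, t₂, ht₁, ht₂, h12⟩ := exists_add_eq_root cs 𝔥 x s
  refine (h.isBiflag (s := s) p (Submodule.mkQ_surjective _) (fun i b hb => ⟨b, hb, rfl⟩)
    fun b => ?_).isSumOfShifts (dualAct_root_ne_zero cs 𝔥 x s) ht₁ ht₂ h12 (Or.inl rfl) (Or.inr rfl)
      (Or.inr (h.le_augIdeal_smul_sup p hs))
  rw [← sectionsWithSupport_compl h.isReducedOn]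
  exact Submodule.Quotient.mk_eq_zero _

theorem HasBiflag.isSumOfShifts {s : S} {E : GBimod V}
    (h : HasBiflag cs 𝔥 x (x * cs.simple s) E) :
    GBimod.IsSumOfShifts {RGr cs 𝔥 {x}, RGr cs 𝔥 {x * cs.simple s},
      RGr cs 𝔥 {x, x * cs.simple s}} E := by
  obtain ⟨C, D, hCD⟩ := h.exists_isBiflag
  obtain ⟨t₁, t₂, ht₁, ht₂, h12⟩ := exists_add_eq_root cs 𝔥 x s
  exact hCD.isSumOfShifts (dualAct_root_ne_zero cs 𝔥 x s) ht₁ ht₂ h12 (Or.inr (Or.inr rfl))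
    (Or.inl rfl) (Or.inl (Or.inr (Or.inl rfl)))

end Stalks

end Soergel

end

theorem mainTheorem5 {S : Type*} {M : CoxeterMatrix S} {W : Type*} [Group W]
    (cs : CoxeterSystem M W) {V : Type*} [AddCommGroup V] [Module ℝ V] [FiniteDimensional ℝ V]
    (𝔥 : Soergel.Realisation M V) (x : W) (s : S) :
    (Soergel.BruhatLT cs x (x * cs.simple s) →
      ∀ B : Soergel.GBimod V, Soergel.IsSoergel cs 𝔥 B →
        Soergel.GBimod.IsSumOfShifts
          {Soergel.RGr cs 𝔥 {x, x * cs.simple s}, Soergel.RGr cs 𝔥 {x}}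
          (Soergel.stalk cs 𝔥 B {x, x * cs.simple s})) ∧
    (∀ E : Soergel.GBimod V, Soergel.HasBiflag cs 𝔥 x (x * cs.simple s) E →
      Soergel.GBimod.IsSumOfShifts
        {Soergel.RGr cs 𝔥 {x}, Soergel.RGr cs 𝔥 {x * cs.simple s},
          Soergel.RGr cs 𝔥 {x, x * cs.simple s}} E) := by
  exact ⟨fun hlt _ hB => hB.isSumOfShifts_stalk (Soergel.length_lt_of_bruhatLT cs hlt),
    fun _ hE => hE.isSumOfShifts⟩
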